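/- Let $c>0$, $D>0$, $0<\alpha\le 1$ and $1<\alpha+\beta\le 2$. Let $Q(x,t)$, $x\in\mathbb{R}^3$, $t\ge 0$, be a fundamental solution of the fractional hyperbolic diffusion equation $$\frac{1}{c^{2}}\frac{\partial^{\alpha+\beta}q}{\partial t^{\alpha+\beta}}+\frac1D\frac{\partial^{\alpha}q}{\partial t^{\alpha}}=\Delta q ,\qquad q|_{t=0}=\delta(x),\qquad \frac{\partial q}{\partial t}\Big|_{t=0}=0 ,$$ where the time derivatives are Caputo derivatives, $\frac{d^{\gamma}f}{dt^{\gamma}}(t)=\frac{1}{\Gamma(n-\gamma)}\int_0^t\frac{f^{(n)}(\tau)}{(t-\tau)^{\gamma+1-n}}\,d\tau$ for $n-1<\gamma<n$, $n\in\mathbb{N}$, and ordinary derivatives for integer $\gamma$. Here $Q(\cdot,t)$ is a tempered distribution on $\mathbb{R}^3$ for each $t\ge0$, and the equation is understood by pairing with Schwartz functions $\varphi$ of $x$, where $t\mapsto\langle Q(\cdot,t),\varphi\rangle$ is $C^2$ on $(0,\infty)$ with a second derivative that is integrable near $0$. Then the Fourier transform $H(\kappa,t)=\int_{\mathbb{R}^3}e^{i\langle\kappa,x\rangle}Q(x,t)\,dx$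 (in the sense of tempered distributions) is a continuous function of $\kappa\in\mathbb{R}^3$ for every $t\ge0$, and it is given by $$H(\kappa,t)=\frac{1}{2\pi i}\int_{\mathrm{Ha}}e^{\xi}\,\xi^{\alpha-1}\,\frac{\xi^{\beta}+c^{2}D^{-1}t^{\beta}}{\xi^{\alpha+\beta}+c^{2}D^{-1}\xi^{\alpha}t^{\beta}+\|\kappa\|^{2}c^{2}t^{\alpha+\beta}}\,d\xi ,\qquad \kappa\in\mathbb{R}^3,\ t\ge 0,$$ with an absolutely convergent integral. The powers of $\xi$ are the branches defined by $\arg\xi\in[-\pi,\pi]$, the two sides of the cut $(-\infty,0]$ being kept apart. $\mathrm{Ha}$ is any Hankel contour that encloses the singularities of the integrand: it comes from infinity along the ray $\arg\xi=-\theta$, follows the circle $|\xi|=r$ counterclockwise, and returns to infinity along the ray $\arg\xi=\theta$, where $r>0$, $\pi/2<\theta\le\pi$, and the denominator has no zero with $|\xi|\ge r$, $|\arg\xi|\le\theta$. For every $\kappa$, $t$ and $\theta$ such contours exist. -/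

import Mathlib

open scoped SchwartzMap FourierTransform Laplacian

noncomputable section

namespace FractionalTelegraph

/-- The physical space `ℝ³` with its Euclidean structure. -/
abbrev E3 : Type := EuclideanSpace ℝ (Fin 3)

/-- The Caputo derivative of order `γ > 0` of `f` at time `t`. With `n = ⌈γ⌉` it is
`1 / Γ(n - γ) * ∫₀ᵗ f⁽ⁿ⁾(τ) / (t - τ) ^ (γ + 1 - n) dτ` when `n - 1 < γ < n`, and the ordinary
derivative `f⁽ⁿ⁾(t)` when `γ = n`. -/
def caputoDeriv (γ : ℝ) (f : ℝ → ℂ) (t : ℝ) : ℂ :=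
  if γ = (⌈γ⌉₊ : ℝ) then iteratedDeriv ⌈γ⌉₊ f t
  else (1 / (Real.Gamma ((⌈γ⌉₊ : ℝ) - γ) : ℂ)) *
    ∫ τ in (0 : ℝ)..t, iteratedDeriv ⌈γ⌉₊ f τ / (((t - τ) ^ (γ + 1 - (⌈γ⌉₊ : ℝ)) : ℝ) : ℂ)

/-- `Q` (of which only the values at `t ≥ 0` matter) is a fundamental solution of
`c⁻² ∂^(α+β) q / ∂t^(α+β) + D⁻¹ ∂^α q / ∂t^α = Δ q` in `ℝ³`, with Caputo derivatives in time and
the initial conditions `q = δ`, `∂q/∂t = 0` at `t = 0`. The solution takes its values in the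
tempered distributions on `ℝ³` and is differentiated in time against test functions: each
pairing `t ↦ ⟨Q(t), φ⟩` is `C²` for `t > 0` with a second derivative integrable near `0`, so that
the Caputo derivatives of order at most `2` are defined. -/
structure IsFundamentalSolution (c D α β : ℝ) (Q : ℝ → 𝓢'(E3, ℂ)) : Prop where
  contDiffOn : ∀ φ : 𝓢(E3, ℂ), ContDiffOn ℝ 2 (fun t => Q t φ) (Set.Ioi 0)
  integrableOn : ∀ φ : 𝓢(E3, ℂ), ∀ T : ℝ,
    MeasureTheory.IntegrableOn (iteratedDeriv 2 (fun t => Q t φ)) (Set.Ioc 0 T)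
  equation : ∀ φ : 𝓢(E3, ℂ), ∀ t : ℝ, 0 < t →
    (1 / (c : ℂ) ^ 2) * caputoDeriv (α + β) (fun s => Q s φ) t
      + (1 / (D : ℂ)) * caputoDeriv α (fun s => Q s φ) t = (Δ (Q t)) φ
  initial_value : Q 0 = TemperedDistribution.delta (0 : E3)
  initial_velocity : ∀ φ : 𝓢(E3, ℂ), HasDerivWithinAt (fun t => Q t φ) 0 (Set.Ici 0) 0

/-- The Fourier transform `x ↦ ∫ exp(i⟨κ, x⟩) φ(κ) dκ` of a Schwartz function, obtained from
Mathlib's inverse Fourier transform, whose kernel is `exp(2πi⟨κ, x⟩)`, by rescaling. -/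
def fourierTest (φ : 𝓢(E3, ℂ)) : 𝓢(E3, ℂ) :=
  SchwartzMap.compCLMOfContinuousLinearEquiv ℂ
    (ContinuousLinearEquiv.smulLeft (R₁ := ℝ) (M₁ := E3)
      (Units.mk0 ((2 * Real.pi)⁻¹) (inv_ne_zero Real.two_pi_pos.ne'))) (𝓕⁻ φ)

theorem fourierTest_apply (φ : 𝓢(E3, ℂ)) (x : E3) :
    fourierTest φ x = ∫ κ : E3, Complex.exp (Complex.I * (inner ℝ κ x : ℝ)) * φ κ := by
  have h : fourierTest φ x = (𝓕⁻ φ) ((2 * Real.pi)⁻¹ • x) := rfl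
  rw [h, SchwartzMap.fourierInv_coe, Real.fourierInv_eq']
  refine MeasureTheory.integral_congr_ae (Filter.Eventually.of_forall fun κ => ?_)
  simp only [inner_smul_right, smul_eq_mul]
  have hpi : (Real.pi : ℂ) ≠ 0 := by exact_mod_cast Real.pi_ne_zero
  congr 2
  push_cast
  field_simp

/-- The Fourier transform `∫ exp(i⟨κ, x⟩) T(x) dx` of the tempered distribution `T` is the
continuous function `h` of `κ`: integrated against any Schwartz function `φ(κ)` it gives
`⟨T, ∫ exp(i⟨κ, ·⟩) φ(κ) dκ⟩`. -/
structure IsFourierTransform (T : 𝓢'(E3, ℂ)) (h : E3 → ℂ) : Prop where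
  continuous : Continuous h
  integrable : ∀ φ : 𝓢(E3, ℂ), MeasureTheory.Integrable (fun κ => h κ * φ κ)
  pairing : ∀ φ : 𝓢(E3, ℂ), T (fourierTest φ) = ∫ κ : E3, h κ * φ κ

/-! Points of the slit plane are written in polar form `ξ = ρ exp(iϑ)` with `ρ > 0` and
`-π ≤ ϑ ≤ π`, where the two sides `ϑ = -π` and `ϑ = π` of the cut along the negative real axis
are kept apart, as a contour running along the cut requires. -/

/-- The point `ξ = ρ exp(iϑ)`. -/
def polarPoint (ρ ϑ : ℝ) : ℂ := (ρ : ℂ) * Complex.exp (Complex.I * ϑ)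

/-- The power `ξ ^ s = ρ ^ s exp(isϑ)`; it is the principal branch for `-π < ϑ ≤ π`. -/
def polarPow (s ρ ϑ : ℝ) : ℂ := ((ρ ^ s : ℝ) : ℂ) * Complex.exp (Complex.I * (s * ϑ))

theorem polarPow_eq_cpow (s : ℝ) {ρ ϑ : ℝ} (hρ : 0 < ρ) (h : ϑ ∈ Set.Ioc (-Real.pi) Real.pi) :
    polarPow s ρ ϑ = polarPoint ρ ϑ ^ (s : ℂ) := by
  have h0 : polarPoint ρ ϑ ≠ 0 :=
    mul_ne_zero (by exact_mod_cast hρ.ne') (Complex.exp_ne_zero _)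
  have hl : Complex.log (polarPoint ρ ϑ) = (Real.log ρ : ℂ) + Complex.I * ϑ := by
    have he : polarPoint ρ ϑ = Complex.exp ((Real.log ρ : ℂ) + Complex.I * ϑ) := by
      rw [Complex.exp_add, ← Complex.ofReal_exp, Real.exp_log hρ]; rfl
    rw [he, Complex.log_exp] <;> simp [h.1, h.2]
  rw [Complex.cpow_def_of_ne_zero h0, hl, polarPow, Real.rpow_def_of_pos hρ]
  push_cast
  rw [← Complex.exp_add]
  congr 1
  ring

/-- The integral `∫_Ha F(ξ) dξ` over the Hankel contour of radius `r` and opening angle `θ`: it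
comes from infinity along the ray `ϑ = -θ`, follows the circle `|ξ| = r` counterclockwise from
`ϑ = -θ` to `ϑ = θ` and returns to infinity along the ray `ϑ = θ`. For `θ = π` the rays are the
lower and the upper side of the cut `(-∞, -r]`. -/
def hankelIntegral (r θ : ℝ) (F : ℝ → ℝ → ℂ) : ℂ :=
  -(∫ ρ in Set.Ioi r, F ρ (-θ) * Complex.exp (Complex.I * ((-θ : ℝ) : ℂ)))
    + (∫ ϑ in (-θ)..θ, F r ϑ * (Complex.I * polarPoint r ϑ))
    + ∫ ρ in Set.Ioi r, F ρ θ * Complex.exp (Complex.I * θ)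

/-- Absolute convergence of the integral over the Hankel contour. -/
structure HankelIntegrable (r θ : ℝ) (F : ℝ → ℝ → ℂ) : Prop where
  lower : MeasureTheory.IntegrableOn (fun ρ => F ρ (-θ)) (Set.Ioi r)
  arc : IntervalIntegrable (fun ϑ => F r ϑ) MeasureTheory.volume (-θ) θ
  upper : MeasureTheory.IntegrableOn (fun ρ => F ρ θ) (Set.Ioi r)

/-- `ξ ^ (α + β) + c² D⁻¹ ξ ^ α t ^ β + ‖κ‖² c² t ^ (α + β)` at `ξ = ρ exp(iϑ)`. -/
def denominator (c D α β : ℝ) (κ : E3) (t ρ ϑ : ℝ) : ℂ :=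
  polarPow (α + β) ρ ϑ + ((c ^ 2 * D⁻¹ : ℝ) : ℂ) * polarPow α ρ ϑ * ((t ^ β : ℝ) : ℂ)
    + ((‖κ‖ ^ 2 * c ^ 2 * t ^ (α + β) : ℝ) : ℂ)

/-- `exp(ξ) ξ ^ (α - 1) (ξ ^ β + c² D⁻¹ t ^ β)` over the denominator, at `ξ = ρ exp(iϑ)`. -/
def integrand (c D α β : ℝ) (κ : E3) (t ρ ϑ : ℝ) : ℂ :=
  Complex.exp (polarPoint ρ ϑ) * polarPow (α - 1) ρ ϑ *
    ((polarPow β ρ ϑ + ((c ^ 2 * D⁻¹ * t ^ β : ℝ) : ℂ)) / denominator c D α β κ t ρ ϑ)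

/-- The Hankel contour of radius `r` and opening angle `θ` encloses all the singularities of the
integrand: the denominator has no zero on the contour, nor in the region
`|ξ| > r`, `|arg ξ| < θ` to the right of it. -/
def Encloses (c D α β : ℝ) (κ : E3) (t r θ : ℝ) : Prop :=
  ∀ ρ ϑ : ℝ, r ≤ ρ → ϑ ∈ Set.Icc (-θ) θ → denominator c D α β κ t ρ ϑ ≠ 0

end FractionalTelegraph

end

noncomputable section

namespace FractionalTelegraph

open scoped SchwartzMap FourierTransform Laplacian ContDiff LineDeriv
open MeasureTheory Set Filter Topology

/-! Put `a = c² / D` and `γ = α + β`. At a fixed frequency the Fourier transform `h(t)` should solve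
`c⁻² ∂^γ h + D⁻¹ ∂^α h = -‖κ‖² h` with `h(0) = 1`, `h'(0) = 0`. Applying the Riemann–Liouville
integral `J^γ` turns this into the Volterra equation `h + a J^β h + c² ‖κ‖² J^γ h = 1 + a t^β / Γ(β
+ 1)`. The Hankel integral solves this equation, and the solution is unique in a sense weak enough
to apply to a distribution.

Existence. In the variable `w = log ξ` all powers are entire exponentials, the two sides of the cut
are the distinct lines `Im w = ±π`, and contours are moved by Cauchy's theorem on rectangles. With
`x = a t^β` and `y = ‖κ‖² c² t^γ` the integrand is `exp ξ / ξ` times `A / (1 + X)`, where `A = 1 + x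
ξ^(-β)` and `X = x ξ^(-β) + y ξ^(-γ)`. For `|ξ|` large this is a convergent Neumann series in the
monomials `t^p ξ^(-p)`. Hankel's formula (`hankelIntegral_expDivPow`) sends such a monomial to `2πi
t^p / Γ(p + 1)`, so `J^δ` becomes multiplication by `t^δ ξ^(-δ)`, and the Volterra equation is the
image of the identity `(1 + X) · A / (1 + X) = A` (`hankelSol_volterra`).

Uniqueness. The Fourier transform of `Q(t)` is not known to be a function, so no frequency can be
fixed. Instead, for `φ` of compact support, let `v_k(t)` be the difference between `Q(t)` and the
candidate when both are tested with `‖κ‖^(2k) φ`. The equations do not close up but form a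
hierarchy, `v_k + a J^β v_k + c² J^γ v_(k+1) = 0`. If `v_k` grows at most geometrically in `k`, a
contraction in an exponentially weighted norm forces `v_k = 0` (`eq_zero_of_volterra_hierarchy`).
The geometric growth comes from two facts: all Schwartz seminorms of `‖κ‖^(2k) φ` grow with one
common ratio (`seminorm_iterate_normSqMul_le`), and the distributions `Q(t)`, `t ∈ [0, T]`, are
uniformly bounded on a bounded sequence of test functions (`uniform_bound_of_pointwise`).

General test functions are reached by density, which needs polynomial growth of the candidate in
`κ`. On a circle enclosing the poles `exp ξ` is exponentially large in a power of `‖κ‖`. However,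
the denominator has no zero in the right half-plane for `t > 0`, so this part of the contour can be
pushed back to the imaginary axis, where `|exp ξ| = 1` (`norm_hankelSol_le`). -/

/-! ### Functions of the logarithm -/

/-- The logarithm `log ρ + iϑ` of the point `ρ exp(iϑ)`. -/
def logPt (ρ ϑ : ℝ) : ℂ := (Real.log ρ : ℂ) + ϑ * Complex.I

/-- A function on the logarithmic plane, in polar coordinates. -/
def ofLog (g : ℂ → ℂ) (ρ ϑ : ℝ) : ℂ := g (logPt ρ ϑ)

theorem exp_logPt {ρ : ℝ} (hρ : 0 < ρ) (ϑ : ℝ) : Complex.exp (logPt ρ ϑ) = polarPoint ρ ϑ := by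
  rw [logPt, Complex.exp_add, ← Complex.ofReal_exp, Real.exp_log hρ, polarPoint, mul_comm Complex.I]

theorem exp_mul_logPt {ρ : ℝ} (hρ : 0 < ρ) (s ϑ : ℝ) :
    Complex.exp (s * logPt ρ ϑ) = polarPow s ρ ϑ := by
  rw [logPt, mul_add, Complex.exp_add, polarPow, Real.rpow_def_of_pos hρ, Complex.ofReal_exp]
  push_cast
  congr 2 <;> ring

theorem logPt_re (ρ ϑ : ℝ) : (logPt ρ ϑ).re = Real.log ρ := by simp [logPt]

theorem logPt_im (ρ ϑ : ℝ) : (logPt ρ ϑ).im = ϑ := by simp [logPt]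

theorem continuousAt_ofLog_radial {g : ℂ → ℂ} {ρ ϑ : ℝ} (hρ : 0 < ρ)
    (hg : ContinuousAt g (logPt ρ ϑ)) : ContinuousAt (fun ρ => ofLog g ρ ϑ) ρ := by
  refine ContinuousAt.comp (f := fun ρ => logPt ρ ϑ) hg ?_
  unfold logPt
  exact ((Complex.continuous_ofReal.continuousAt).comp
    (Real.continuousAt_log hρ.ne')).add continuousAt_const

theorem continuousAt_ofLog_angular {g : ℂ → ℂ} {ρ ϑ : ℝ}
    (hg : ContinuousAt g (logPt ρ ϑ)) : ContinuousAt (fun ϑ => ofLog g ρ ϑ) ϑ := by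
  refine ContinuousAt.comp (f := fun ϑ => logPt ρ ϑ) hg ?_
  unfold logPt
  fun_prop

/-- Substitution of `ρ = exp x` on a segment of a ray. -/
theorem integral_ray_segment {g : ℂ → ℂ} {r R ϑ : ℝ} (hr : 0 < r) (hrR : r ≤ R)
    (hg : ∀ ρ ∈ Icc r R, ContinuousAt g (logPt ρ ϑ)) :
    ∫ x in Real.log r..Real.log R, g (x + ϑ * Complex.I) * Complex.exp (x + ϑ * Complex.I)
      = ∫ ρ in r..R, ofLog g ρ ϑ * Complex.exp (Complex.I * ϑ) := by
  have hR : 0 < R := hr.trans_le hrR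
  have hlog : Real.log r ≤ Real.log R := Real.log_le_log hr hrR
  have himg : Real.exp '' uIcc (Real.log r) (Real.log R) ⊆ Icc r R := by
    rintro _ ⟨x, hx, rfl⟩
    rw [uIcc_of_le hlog] at hx
    exact ⟨by simpa [Real.exp_log hr] using Real.exp_le_exp.2 hx.1,
      by simpa [Real.exp_log hR] using Real.exp_le_exp.2 hx.2⟩
  have h := intervalIntegral.integral_deriv_smul_comp'' (a := Real.log r) (b := Real.log R)
    (f := Real.exp) (f' := Real.exp) (g := fun ρ => ofLog g ρ ϑ * Complex.exp (Complex.I * ϑ))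
    Real.continuous_exp.continuousOn
    (fun x _ => (Real.hasDerivAt_exp x).hasDerivWithinAt) Real.continuous_exp.continuousOn ?_
  · rw [Real.exp_log hr, Real.exp_log hR] at h
    rw [← h]
    refine intervalIntegral.integral_congr fun x _ => ?_
    simp only [Function.comp, ofLog, logPt, Real.log_exp, Complex.real_smul, Complex.exp_add,
      Complex.ofReal_exp, mul_comm Complex.I]
    ring
  · refine ContinuousOn.mul (fun ρ hρ => ?_) continuousOn_const
    have hρ' := himg hρ
    exact (continuousAt_ofLog_radial (hr.trans_le hρ'.1) (hg ρ hρ')).continuousWithinAt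

/-- Cauchy's theorem for a sector of an annulus. -/
theorem integral_boundary_sector {g : ℂ → ℂ} {r R θ₁ θ₂ : ℝ} (hr : 0 < r) (hrR : r ≤ R)
    (hθ : θ₁ ≤ θ₂)
    (hg : ∀ ρ ∈ Icc r R, ∀ ϑ ∈ Icc θ₁ θ₂, DifferentiableAt ℂ g (logPt ρ ϑ)) :
    (∫ ρ in r..R, ofLog g ρ θ₂ * Complex.exp (Complex.I * θ₂))
        - (∫ ρ in r..R, ofLog g ρ θ₁ * Complex.exp (Complex.I * θ₁))
      = (∫ ϑ in θ₁..θ₂, ofLog g R ϑ * (Complex.I * polarPoint R ϑ))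
        - ∫ ϑ in θ₁..θ₂, ofLog g r ϑ * (Complex.I * polarPoint r ϑ) := by
  have hR : 0 < R := hr.trans_le hrR
  have hlog : Real.log r ≤ Real.log R := Real.log_le_log hr hrR
  have h := Complex.integral_boundary_rect_eq_zero_of_differentiableOn
    (fun w => g w * Complex.exp w) (logPt r θ₁) (logPt R θ₂) ?_
  · simp only [logPt_re, logPt_im] at h
    rw [integral_ray_segment hr hrR fun ρ hρ => (hg ρ hρ θ₁ ⟨le_rfl, hθ⟩).continuousAt,
      integral_ray_segment hr hrR fun ρ hρ => (hg ρ hρ θ₂ ⟨hθ, le_rfl⟩).continuousAt] at h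
    have harc : ∀ s : ℝ, 0 < s →
        Complex.I • ∫ y in θ₁..θ₂, g ((Real.log s : ℂ) + y * Complex.I) *
          Complex.exp ((Real.log s : ℂ) + y * Complex.I)
        = ∫ ϑ in θ₁..θ₂, ofLog g s ϑ * (Complex.I * polarPoint s ϑ) := by
      intro s hs
      rw [← intervalIntegral.integral_smul]
      refine intervalIntegral.integral_congr fun y _ => ?_
      simp only [ofLog, ← exp_logPt hs, logPt, smul_eq_mul]
      ring
    rw [harc r hr, harc R hR] at h
    linear_combination -h
  · intro w hw
    rw [logPt_re, logPt_re, logPt_im, logPt_im, uIcc_of_le hlog, uIcc_of_le hθ,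
      Complex.mem_reProdIm] at hw
    have hw' : w = logPt (Real.exp w.re) w.im := by
      rw [logPt, Real.log_exp, Complex.re_add_im]
    have h1 : DifferentiableAt ℂ g w := by
      rw [hw']
      refine hg _ ⟨?_, ?_⟩ _ hw.2
      · simpa [Real.exp_log hr] using Real.exp_le_exp.2 hw.1.1
      · simpa [Real.exp_log hR] using Real.exp_le_exp.2 hw.1.2
    exact (h1.mul Complex.differentiableAt_exp).differentiableWithinAt

/-! ### Hankel integrals -/

theorem hankelIntegral_congr {r θ : ℝ} (hθ : 0 ≤ θ) {F G : ℝ → ℝ → ℂ}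
    (h : ∀ ρ ϑ : ℝ, r ≤ ρ → ϑ ∈ Icc (-θ) θ → F ρ ϑ = G ρ ϑ) :
    hankelIntegral r θ F = hankelIntegral r θ G := by
  have h1 : -θ ≤ θ := by linarith
  unfold hankelIntegral
  congr 1
  · congr 1
    · congr 1
      refine setIntegral_congr_fun measurableSet_Ioi fun ρ hρ => ?_
      simp only [h ρ (-θ) (le_of_lt hρ) ⟨le_rfl, h1⟩]
    · refine intervalIntegral.integral_congr fun ϑ hϑ => ?_
      rw [uIcc_of_le h1] at hϑ
      simp only [h r ϑ le_rfl hϑ]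
  · refine setIntegral_congr_fun measurableSet_Ioi fun ρ hρ => ?_
    simp only [h ρ θ (le_of_lt hρ) ⟨h1, le_rfl⟩]

theorem HankelIntegrable.congr {r θ : ℝ} (hθ : 0 ≤ θ) {F G : ℝ → ℝ → ℂ}
    (hF : HankelIntegrable r θ F)
    (h : ∀ ρ ϑ : ℝ, r ≤ ρ → ϑ ∈ Icc (-θ) θ → F ρ ϑ = G ρ ϑ) : HankelIntegrable r θ G := by
  have h1 : -θ ≤ θ := by linarith
  refine ⟨?_, ?_, ?_⟩
  · exact hF.lower.congr_fun (fun ρ hρ => h ρ (-θ) (le_of_lt hρ) ⟨le_rfl, h1⟩) measurableSet_Ioi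
  · refine hF.arc.congr fun ϑ hϑ => ?_
    rw [uIoc_of_le h1] at hϑ
    exact h r ϑ le_rfl ⟨hϑ.1.le, hϑ.2⟩
  · exact hF.upper.congr_fun (fun ρ hρ => h ρ θ (le_of_lt hρ) ⟨h1, le_rfl⟩) measurableSet_Ioi

theorem continuous_polarPoint_angular (r : ℝ) : Continuous (polarPoint r) := by
  unfold polarPoint; fun_prop

theorem HankelIntegrable.arc_mul {r θ : ℝ} {F : ℝ → ℝ → ℂ} (hF : HankelIntegrable r θ F) :
    IntervalIntegrable (fun ϑ => F r ϑ * (Complex.I * polarPoint r ϑ)) volume (-θ) θ :=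
  hF.arc.mul_continuousOn
    (continuous_const.mul (continuous_polarPoint_angular r)).continuousOn

theorem HankelIntegrable.add {r θ : ℝ} {F G : ℝ → ℝ → ℂ} (hF : HankelIntegrable r θ F)
    (hG : HankelIntegrable r θ G) : HankelIntegrable r θ (fun ρ ϑ => F ρ ϑ + G ρ ϑ) :=
  ⟨hF.lower.add hG.lower, hF.arc.add hG.arc, hF.upper.add hG.upper⟩

theorem HankelIntegrable.const_mul {r θ : ℝ} {F : ℝ → ℝ → ℂ} (hF : HankelIntegrable r θ F)
    (c : ℂ) : HankelIntegrable r θ (fun ρ ϑ => c * F ρ ϑ) :=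
  ⟨hF.lower.const_mul c, hF.arc.const_mul c, hF.upper.const_mul c⟩

theorem hankelIntegral_add {r θ : ℝ} {F G : ℝ → ℝ → ℂ} (hF : HankelIntegrable r θ F)
    (hG : HankelIntegrable r θ G) :
    hankelIntegral r θ (fun ρ ϑ => F ρ ϑ + G ρ ϑ)
      = hankelIntegral r θ F + hankelIntegral r θ G := by
  unfold hankelIntegral
  simp only [add_mul]
  rw [integral_add (hF.lower.mul_const _) (hG.lower.mul_const _),
    integral_add (hF.upper.mul_const _) (hG.upper.mul_const _),
    intervalIntegral.integral_add hF.arc_mul hG.arc_mul]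
  ring

theorem hankelIntegral_const_mul (r θ : ℝ) (F : ℝ → ℝ → ℂ) (c : ℂ) :
    hankelIntegral r θ (fun ρ ϑ => c * F ρ ϑ) = c * hankelIntegral r θ F := by
  unfold hankelIntegral
  simp only [mul_assoc]
  rw [integral_const_mul, integral_const_mul, intervalIntegral.integral_const_mul]
  ring

/-- The Hankel integral does not depend on the radius of the contour, as long as the integrand
is holomorphic between the contours. -/
theorem hankelIntegral_radius {g : ℂ → ℂ} {r R θ : ℝ} (hr : 0 < r) (hrR : r ≤ R) (hθ : 0 ≤ θ)
    (hg : ∀ ρ ∈ Icc r R, ∀ ϑ ∈ Icc (-θ) θ, DifferentiableAt ℂ g (logPt ρ ϑ))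
    (hi : HankelIntegrable R θ (ofLog g)) :
    HankelIntegrable r θ (ofLog g) ∧
      hankelIntegral r θ (ofLog g) = hankelIntegral R θ (ofLog g) := by
  have h1 : -θ ≤ θ := by linarith
  have hint : ∀ ϑ ∈ Icc (-θ) θ, IntervalIntegrable (fun ρ => ofLog g ρ ϑ) volume r R := by
    intro ϑ hϑ
    refine ContinuousOn.intervalIntegrable fun ρ hρ => ?_
    rw [uIcc_of_le hrR] at hρ
    exact (continuousAt_ofLog_radial (hr.trans_le hρ.1)
      (hg ρ hρ ϑ hϑ).continuousAt).continuousWithinAt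
  have hunion : Ioi r = Ioc r R ∪ Ioi R := (Ioc_union_Ioi_eq_Ioi hrR).symm
  have hray : ∀ ϑ ∈ Icc (-θ) θ, IntegrableOn (fun ρ => ofLog g ρ ϑ) (Ioi R) →
      IntegrableOn (fun ρ => ofLog g ρ ϑ) (Ioi r) := by
    intro ϑ hϑ h
    rw [hunion]
    exact ((intervalIntegrable_iff_integrableOn_Ioc_of_le hrR).1 (hint ϑ hϑ)).union h
  have hsplit : ∀ ϑ ∈ Icc (-θ) θ, IntegrableOn (fun ρ => ofLog g ρ ϑ) (Ioi R) →
      ∀ c : ℂ, ∫ ρ in Ioi r, ofLog g ρ ϑ * c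
        = (∫ ρ in r..R, ofLog g ρ ϑ * c) + ∫ ρ in Ioi R, ofLog g ρ ϑ * c := by
    intro ϑ hϑ h c
    rw [intervalIntegral.integral_of_le hrR, hunion,
      setIntegral_union (Ioc_disjoint_Ioi le_rfl) measurableSet_Ioi]
    · exact ((intervalIntegrable_iff_integrableOn_Ioc_of_le hrR).1 (hint ϑ hϑ)).mul_const c
    · exact h.mul_const c
  refine ⟨⟨hray _ ⟨le_rfl, h1⟩ hi.lower, ?_, hray _ ⟨h1, le_rfl⟩ hi.upper⟩, ?_⟩
  · refine ContinuousOn.intervalIntegrable fun ϑ hϑ => ?_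
    rw [uIcc_of_le h1] at hϑ
    exact (continuousAt_ofLog_angular (hg r ⟨le_rfl, hrR⟩ ϑ hϑ).continuousAt).continuousWithinAt
  · unfold hankelIntegral
    rw [hsplit _ ⟨le_rfl, h1⟩ hi.lower, hsplit _ ⟨h1, le_rfl⟩ hi.upper]
    have h := integral_boundary_sector hr hrR h1 hg
    linear_combination h

/-! ### Integrals of `exp ξ / ξ` times a bounded function -/

/-- The function `exp ξ / ξ` of `w = log ξ`. -/
def expDiv (w : ℂ) : ℂ := Complex.exp (Complex.exp w) * Complex.exp (-w)

theorem differentiable_expDiv : Differentiable ℂ expDiv := by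
  unfold expDiv; fun_prop

theorem polarPoint_re (ρ ϑ : ℝ) : (polarPoint ρ ϑ).re = ρ * Real.cos ϑ := by
  rw [polarPoint, Complex.re_ofReal_mul, mul_comm Complex.I, Complex.exp_ofReal_mul_I_re]

theorem norm_exp_I_mul (ϑ : ℝ) : ‖Complex.exp (Complex.I * ϑ)‖ = 1 := by
  rw [mul_comm, Complex.norm_exp_ofReal_mul_I]

theorem norm_polarPoint {ρ : ℝ} (hρ : 0 < ρ) (ϑ : ℝ) : ‖polarPoint ρ ϑ‖ = ρ := by
  rw [polarPoint, norm_mul, norm_exp_I_mul, mul_one, Complex.norm_real, Real.norm_of_nonneg hρ.le]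

theorem norm_expDiv {ρ : ℝ} (hρ : 0 < ρ) (ϑ : ℝ) :
    ‖expDiv (logPt ρ ϑ)‖ = Real.exp (ρ * Real.cos ϑ) / ρ := by
  rw [expDiv, exp_logPt hρ, Complex.exp_neg, exp_logPt hρ, norm_mul, norm_inv, norm_polarPoint hρ,
    Complex.norm_exp, polarPoint_re, div_eq_mul_inv]

theorem cos_neg_of_mem {θ : ℝ} (h1 : Real.pi / 2 < θ) (h2 : θ ≤ Real.pi) : Real.cos θ < 0 :=
  Real.cos_neg_of_pi_div_two_lt_of_lt h1 (by linarith [Real.pi_pos])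

theorem integrableOn_exp_mul_div {c r : ℝ} (hc : c < 0) (hr : 0 < r) :
    IntegrableOn (fun ρ : ℝ => Real.exp (ρ * c) / ρ) (Ioi r) := by
  refine integrable_of_isBigO_exp_neg (b := -c) (by linarith) ?_ ?_
  · refine ContinuousOn.div (by fun_prop) continuousOn_id fun ρ hρ => ?_
    exact (hr.trans_le hρ).ne'
  · refine Asymptotics.IsBigO.of_bound 1 ?_
    filter_upwards [eventually_ge_atTop 1] with ρ hρ
    have h0 : 0 < ρ := by linarith
    rw [one_mul, Real.norm_of_nonneg (by positivity), Real.norm_of_nonneg (by positivity), neg_neg,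
      mul_comm c]
    exact div_le_self (Real.exp_pos _).le hρ

section Bounded

variable {m : ℂ → ℂ} {C r θ : ℝ}

theorem norm_ofLog_expDiv_mul_le (hr : 0 < r)
    (hb : ∀ ρ ϑ : ℝ, r ≤ ρ → ϑ ∈ Icc (-θ) θ → ‖m (logPt ρ ϑ)‖ ≤ C) {ρ ϑ : ℝ} (hρ : r ≤ ρ)
    (hϑ : ϑ ∈ Icc (-θ) θ) :
    ‖ofLog (fun w => expDiv w * m w) ρ ϑ‖ ≤ C * (Real.exp (ρ * Real.cos ϑ) / ρ) := by
  have h0 : 0 < ρ := hr.trans_le hρ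
  rw [ofLog, norm_mul, norm_expDiv h0, mul_comm]
  exact mul_le_mul_of_nonneg_right (hb ρ ϑ hρ hϑ) (by positivity)

theorem hankelIntegrable_expDiv_mul (hr : 0 < r) (hθ : Real.pi / 2 < θ) (hθ' : θ ≤ Real.pi)
    (hm : ∀ ρ ϑ : ℝ, r ≤ ρ → ϑ ∈ Icc (-θ) θ → ContinuousAt m (logPt ρ ϑ))
    (hb : ∀ ρ ϑ : ℝ, r ≤ ρ → ϑ ∈ Icc (-θ) θ → ‖m (logPt ρ ϑ)‖ ≤ C) :
    HankelIntegrable r θ (ofLog fun w => expDiv w * m w) := by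
  have h0 : -θ ≤ θ := by linarith [Real.pi_pos]
  have hc := cos_neg_of_mem hθ hθ'
  have hcont : ∀ ρ ϑ : ℝ, r ≤ ρ → ϑ ∈ Icc (-θ) θ →
      ContinuousAt (fun w => expDiv w * m w) (logPt ρ ϑ) := fun ρ ϑ hρ hϑ =>
    (differentiable_expDiv _).continuousAt.mul (hm ρ ϑ hρ hϑ)
  have hray : ∀ ϑ ∈ Icc (-θ) θ, Real.cos ϑ = Real.cos θ →
      IntegrableOn (fun ρ => ofLog (fun w => expDiv w * m w) ρ ϑ) (Ioi r) := by
    intro ϑ hϑ hcos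
    refine Integrable.mono' ((integrableOn_exp_mul_div hc hr).const_mul C) ?_ ?_
    · refine ContinuousOn.aestronglyMeasurable (fun ρ hρ => ?_) measurableSet_Ioi
      exact (continuousAt_ofLog_radial (hr.trans hρ)
        (hcont ρ ϑ (le_of_lt hρ) hϑ)).continuousWithinAt
    · refine (ae_restrict_iff' measurableSet_Ioi).2 (Eventually.of_forall fun ρ hρ => ?_)
      rw [← hcos]
      exact norm_ofLog_expDiv_mul_le hr hb (le_of_lt hρ) hϑ
  refine ⟨hray _ ⟨le_rfl, h0⟩ (Real.cos_neg θ), ?_, hray _ ⟨h0, le_rfl⟩ rfl⟩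
  refine ContinuousOn.intervalIntegrable fun ϑ hϑ => ?_
  rw [uIcc_of_le h0] at hϑ
  exact (continuousAt_ofLog_angular (hcont r ϑ le_rfl hϑ)).continuousWithinAt

/-- The factor `r` of `dξ` cancels the `1 / ξ` of the integrand. The bound therefore depends on the
radius only through the size `K` of `exp ξ` on the arc. -/
theorem norm_arc_expDiv_le (hr : 0 < r) {θ₁ θ₂ K : ℝ} (h12 : θ₁ ≤ θ₂)
    (hb : ∀ ϑ ∈ Icc θ₁ θ₂, ‖m (logPt r ϑ)‖ ≤ C) (hC : 0 ≤ C)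
    (hK : ∀ ϑ ∈ Icc θ₁ θ₂, Real.exp (r * Real.cos ϑ) ≤ K) :
    ‖∫ ϑ in θ₁..θ₂, ofLog (fun w => expDiv w * m w) r ϑ * (Complex.I * polarPoint r ϑ)‖
      ≤ C * K * (θ₂ - θ₁) := by
  have h := intervalIntegral.norm_integral_le_of_norm_le_const (a := θ₁) (b := θ₂) (C := C * K)
    (f := fun ϑ => ofLog (fun w => expDiv w * m w) r ϑ * (Complex.I * polarPoint r ϑ)) ?_
  · rwa [abs_of_nonneg (by linarith)] at h
  · intro ϑ hϑ
    rw [uIoc_of_le h12] at hϑ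
    have hϑ' : ϑ ∈ Icc θ₁ θ₂ := ⟨hϑ.1.le, hϑ.2⟩
    rw [ofLog, norm_mul, norm_mul, norm_mul, norm_expDiv hr, norm_polarPoint hr, Complex.norm_I,
      one_mul]
    calc Real.exp (r * Real.cos ϑ) / r * ‖m (logPt r ϑ)‖ * r
        = ‖m (logPt r ϑ)‖ * Real.exp (r * Real.cos ϑ) := by field_simp
      _ ≤ C * K := mul_le_mul (hb ϑ hϑ') (hK ϑ hϑ') (Real.exp_pos _).le hC

theorem norm_ray_expDiv_le (hr : 0 < r) {ϑ : ℝ} (hc : Real.cos ϑ < 0)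
    (hb : ∀ ρ, r ≤ ρ → ‖m (logPt ρ ϑ)‖ ≤ C) :
    ‖∫ ρ in Ioi r, ofLog (fun w => expDiv w * m w) ρ ϑ * Complex.exp (Complex.I * ϑ)‖
      ≤ C * ∫ ρ in Ioi r, Real.exp (ρ * Real.cos ϑ) / ρ := by
  rw [← integral_const_mul]
  refine norm_integral_le_of_norm_le ((integrableOn_exp_mul_div hc hr).const_mul C) ?_
  refine (ae_restrict_iff' measurableSet_Ioi).2 (Eventually.of_forall fun ρ hρ => ?_)
  have h0 : 0 < ρ := hr.trans hρ
  rw [ofLog, norm_mul, norm_mul, norm_exp_I_mul, mul_one, norm_expDiv h0, mul_comm]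
  exact mul_le_mul_of_nonneg_right (hb ρ (le_of_lt hρ)) (by positivity)

/-- A bound for `∫_Ha |exp ξ / ξ| |dξ|`. -/
def hankelMass (r θ : ℝ) : ℝ :=
  2 * (∫ ρ in Ioi r, Real.exp (ρ * Real.cos θ) / ρ) + Real.exp r * (2 * θ)

theorem norm_hankelIntegral_expDiv_mul_le (hr : 0 < r) (hθ : Real.pi / 2 < θ)
    (hθ' : θ ≤ Real.pi) (hC : 0 ≤ C)
    (hb : ∀ ρ ϑ : ℝ, r ≤ ρ → ϑ ∈ Icc (-θ) θ → ‖m (logPt ρ ϑ)‖ ≤ C) :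
    ‖hankelIntegral r θ (ofLog fun w => expDiv w * m w)‖ ≤ C * hankelMass r θ := by
  have h0 : -θ ≤ θ := by linarith [Real.pi_pos]
  have hc := cos_neg_of_mem hθ hθ'
  have h1 := norm_ray_expDiv_le hr (ϑ := -θ) (by rwa [Real.cos_neg])
    fun ρ hρ => hb ρ _ hρ ⟨le_rfl, h0⟩
  have h2 := norm_arc_expDiv_le hr h0 (fun ϑ hϑ => hb r ϑ le_rfl hϑ) hC (K := Real.exp r)
    fun ϑ _ => Real.exp_le_exp.2 (by nlinarith [Real.cos_le_one ϑ])
  have h3 := norm_ray_expDiv_le hr hc fun ρ hρ => hb ρ _ hρ ⟨h0, le_rfl⟩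
  rw [Real.cos_neg] at h1
  unfold hankelIntegral hankelMass
  refine (norm_add₃_le).trans ?_
  rw [norm_neg]
  calc _ ≤ _ := add_le_add (add_le_add h1 h2) h3
    _ = _ := by ring

/-- The rays of a Hankel contour may be turned through the left half-plane. -/
theorem hankelIntegral_angle (hr : 0 < r) (hθ : Real.pi / 2 < θ) (hθ' : θ ≤ Real.pi)
    (hC : 0 ≤ C)
    (hm : ∀ ρ ϑ : ℝ, r ≤ ρ → ϑ ∈ Icc (-Real.pi) Real.pi → DifferentiableAt ℂ m (logPt ρ ϑ))
    (hb : ∀ ρ ϑ : ℝ, r ≤ ρ → ϑ ∈ Icc (-Real.pi) Real.pi → ‖m (logPt ρ ϑ)‖ ≤ C) :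
    hankelIntegral r θ (ofLog fun w => expDiv w * m w)
      = hankelIntegral r Real.pi (ofLog fun w => expDiv w * m w) := by
  set g : ℂ → ℂ := fun w => expDiv w * m w with hgdef
  have hpi := Real.pi_pos
  have hc := cos_neg_of_mem hθ hθ'
  have hg : ∀ ρ ϑ : ℝ, r ≤ ρ → ϑ ∈ Icc (-Real.pi) Real.pi → DifferentiableAt ℂ g (logPt ρ ϑ) :=
    fun ρ ϑ hρ hϑ => (differentiable_expDiv _).mul (hm ρ ϑ hρ hϑ)
  have hI := hankelIntegrable_expDiv_mul hr (by linarith) le_rfl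
    (fun ρ ϑ hρ hϑ => (hm ρ ϑ hρ hϑ).continuousAt) hb
  have hIθ := hankelIntegrable_expDiv_mul hr hθ hθ'
    (fun ρ ϑ hρ hϑ => (hm ρ ϑ hρ ⟨by linarith [hϑ.1], hϑ.2.trans hθ'⟩).continuousAt)
    (fun ρ ϑ hρ hϑ => hb ρ ϑ hρ ⟨by linarith [hϑ.1], hϑ.2.trans hθ'⟩)
  -- Cauchy's theorem on the sector between two rays, truncated at radius `R → ∞`. The outer arc is
  -- `O(exp(R cos θ))`, because `cos ϑ ≤ cos θ < 0` on it.
  have key : ∀ θ₁ θ₂ : ℝ, θ₁ ≤ θ₂ → Icc θ₁ θ₂ ⊆ Icc (-Real.pi) Real.pi →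
      (∀ ϑ ∈ Icc θ₁ θ₂, Real.cos ϑ ≤ Real.cos θ) →
      IntegrableOn (fun ρ => ofLog g ρ θ₁) (Ioi r) → IntegrableOn (fun ρ => ofLog g ρ θ₂) (Ioi r) →
      (∫ ρ in Ioi r, ofLog g ρ θ₂ * Complex.exp (Complex.I * θ₂))
        - (∫ ρ in Ioi r, ofLog g ρ θ₁ * Complex.exp (Complex.I * θ₁))
      = - ∫ ϑ in θ₁..θ₂, ofLog g r ϑ * (Complex.I * polarPoint r ϑ) := by
    intro θ₁ θ₂ h12 hsub hcos hi1 hi2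
    have ht1 := intervalIntegral_tendsto_integral_Ioi r
      (hi1.mul_const (Complex.exp (Complex.I * θ₁))) tendsto_id
    have ht2 := intervalIntegral_tendsto_integral_Ioi r
      (hi2.mul_const (Complex.exp (Complex.I * θ₂))) tendsto_id
    have harc : Tendsto (fun R : ℝ => ∫ ϑ in θ₁..θ₂, ofLog g R ϑ * (Complex.I * polarPoint R ϑ))
        atTop (𝓝 0) := by
      have hlim : Tendsto (fun R : ℝ => C * Real.exp (R * Real.cos θ) * (θ₂ - θ₁)) atTop (𝓝 0) := by
        have : Tendsto (fun R : ℝ => Real.exp (R * Real.cos θ)) atTop (𝓝 0) :=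
          Real.tendsto_exp_atBot.comp (tendsto_id.atTop_mul_const_of_neg hc)
        simpa using (this.const_mul C).mul_const (θ₂ - θ₁)
      refine squeeze_zero_norm' ?_ hlim
      filter_upwards [eventually_ge_atTop r] with R hR
      refine norm_arc_expDiv_le (hr.trans_le hR) h12 (fun ϑ hϑ => hb R ϑ hR (hsub hϑ)) hC ?_
      exact fun ϑ hϑ => Real.exp_le_exp.2
        (mul_le_mul_of_nonneg_left (hcos ϑ hϑ) (hr.trans_le hR).le)
    have hrhs := harc.sub_const (∫ ϑ in θ₁..θ₂, ofLog g r ϑ * (Complex.I * polarPoint r ϑ))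
    rw [zero_sub] at hrhs
    refine tendsto_nhds_unique (ht2.sub ht1) (hrhs.congr' ?_)
    filter_upwards [eventually_ge_atTop r] with R hR
    exact (integral_boundary_sector hr hR h12
      fun ρ hρ ϑ hϑ => hg ρ ϑ hρ.1 (hsub hϑ)).symm
  have hup := key θ Real.pi hθ' (Icc_subset_Icc (by linarith) le_rfl)
    (fun ϑ hϑ => Real.cos_le_cos_of_nonneg_of_le_pi (by linarith) hϑ.2 hϑ.1) hIθ.upper hI.upper
  have hlow := key (-Real.pi) (-θ) (by linarith) (Icc_subset_Icc le_rfl (by linarith))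
    (fun ϑ hϑ => by
      rw [← Real.cos_neg ϑ]
      exact Real.cos_le_cos_of_nonneg_of_le_pi (by linarith) (by linarith [hϑ.1])
        (by linarith [hϑ.2])) hI.lower hIθ.lower
  have hii : ∀ a b : ℝ, a ∈ Icc (-Real.pi) Real.pi → b ∈ Icc (-Real.pi) Real.pi →
      IntervalIntegrable (fun ϑ => ofLog g r ϑ * (Complex.I * polarPoint r ϑ)) volume a b := by
    intro a b ha hb'
    refine hI.arc_mul.mono_set ?_
    rw [uIcc_of_le (by linarith : -Real.pi ≤ Real.pi)]
    exact (convex_Icc _ _).ordConnected.uIcc_subset ha hb'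
  have m1 : -Real.pi ∈ Icc (-Real.pi) Real.pi := ⟨le_rfl, by linarith⟩
  have m2 : -θ ∈ Icc (-Real.pi) Real.pi := ⟨by linarith, by linarith⟩
  have m3 : θ ∈ Icc (-Real.pi) Real.pi := ⟨by linarith, by linarith⟩
  have m4 : Real.pi ∈ Icc (-Real.pi) Real.pi := ⟨by linarith, le_rfl⟩
  have hsum : ∫ ϑ in (-Real.pi)..Real.pi, ofLog g r ϑ * (Complex.I * polarPoint r ϑ)
      = (∫ ϑ in (-Real.pi)..(-θ), ofLog g r ϑ * (Complex.I * polarPoint r ϑ))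
        + (∫ ϑ in (-θ)..θ, ofLog g r ϑ * (Complex.I * polarPoint r ϑ))
        + ∫ ϑ in θ..Real.pi, ofLog g r ϑ * (Complex.I * polarPoint r ϑ) := by
    rw [intervalIntegral.integral_add_adjacent_intervals (hii _ _ m1 m2) (hii _ _ m2 m3),
      intervalIntegral.integral_add_adjacent_intervals (hii _ _ m1 m3) (hii _ _ m3 m4)]
  unfold hankelIntegral
  rw [hsum]
  linear_combination -hlow - hup

end Bounded

/-! ### Hankel's formula for the reciprocal of the Gamma function -/

/-- The integrand has the primitive `h` along the whole contour. The boundary values at the two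
corners cancel and those at infinity vanish. -/
theorem hankelIntegral_deriv_eq_zero {g h h' : ℂ → ℂ} {r θ : ℝ} (hr : 0 < r)
    (hh : ∀ w, HasDerivAt h (h' w) w) (hg : ∀ w, h' w = g w * Complex.exp w)
    (hi : HankelIntegrable r θ (ofLog g))
    (hlow : Tendsto (fun ρ => ofLog h ρ (-θ)) atTop (𝓝 0))
    (hup : Tendsto (fun ρ => ofLog h ρ θ) atTop (𝓝 0)) :
    hankelIntegral r θ (ofLog g) = 0 := by
  have hrad : ∀ ρ ϑ : ℝ, 0 < ρ →
      HasDerivAt (fun ρ => ofLog h ρ ϑ) (ofLog g ρ ϑ * Complex.exp (Complex.I * ϑ)) ρ := by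
    intro ρ ϑ hρ
    have h1 : HasDerivAt (fun ρ : ℝ => logPt ρ ϑ) ((ρ⁻¹ : ℝ) : ℂ) ρ := by
      unfold logPt
      exact ((Real.hasDerivAt_log hρ.ne').ofReal_comp).add_const _
    have h2 := (hh (logPt ρ ϑ)).comp ρ h1
    refine h2.congr_deriv ?_
    rw [hg, exp_logPt hρ, polarPoint, ofLog]
    have : (ρ : ℂ) ≠ 0 := by exact_mod_cast hρ.ne'
    push_cast
    field_simp
  have hang : ∀ ϑ : ℝ, HasDerivAt (fun ϑ => ofLog h r ϑ)
      (ofLog g r ϑ * (Complex.I * polarPoint r ϑ)) ϑ := by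
    intro ϑ
    have h1 : HasDerivAt (fun ϑ : ℝ => logPt r ϑ) Complex.I ϑ := by
      unfold logPt
      simpa using ((hasDerivAt_id ϑ).ofReal_comp.mul_const Complex.I).const_add
        ((Real.log r : ℝ) : ℂ)
    have h2 := (hh (logPt r ϑ)).comp ϑ h1
    refine h2.congr_deriv ?_
    rw [hg, exp_logPt hr, ofLog]
    ring
  have ray : ∀ ϑ, Tendsto (fun ρ => ofLog h ρ ϑ) atTop (𝓝 0) →
      IntegrableOn (fun ρ => ofLog g ρ ϑ) (Ioi r) →
      ∫ ρ in Ioi r, ofLog g ρ ϑ * Complex.exp (Complex.I * ϑ) = 0 - ofLog h r ϑ := fun ϑ ht hI =>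
    integral_Ioi_of_hasDerivAt_of_tendsto (hrad r ϑ hr).continuousAt.continuousWithinAt
      (fun ρ hρ => hrad ρ ϑ (hr.trans hρ)) (hI.mul_const _) ht
  unfold hankelIntegral
  rw [ray _ hlow hi.lower, ray _ hup hi.upper,
    intervalIntegral.integral_eq_sub_of_hasDerivAt (fun ϑ _ => hang ϑ) hi.arc_mul]
  ring

/-- The function `exp ξ · ξ ^ (-p-1)` of `w = log ξ`. -/
def expDivPow (p : ℝ) (w : ℂ) : ℂ := expDiv w * Complex.exp (((-p : ℝ) : ℂ) * w)

theorem differentiable_expDivPow (p : ℝ) : Differentiable ℂ (expDivPow p) := by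
  unfold expDivPow expDiv; fun_prop

theorem norm_exp_mul_logPt {ρ : ℝ} (hρ : 0 < ρ) (s ϑ : ℝ) :
    ‖Complex.exp ((s : ℂ) * logPt ρ ϑ)‖ = ρ ^ s := by
  rw [exp_mul_logPt hρ, polarPow, norm_mul, Complex.norm_real, Real.norm_of_nonneg (by positivity),
    ← Complex.ofReal_mul, norm_exp_I_mul, mul_one]

theorem norm_expDivPow {ρ : ℝ} (hρ : 0 < ρ) (p ϑ : ℝ) :
    ‖ofLog (expDivPow p) ρ ϑ‖ = Real.exp (ρ * Real.cos ϑ) * ρ ^ (-p - 1) := by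
  rw [ofLog, expDivPow, norm_mul, norm_expDiv hρ, norm_exp_mul_logPt hρ, Real.rpow_sub hρ,
    Real.rpow_one]
  ring

theorem hankelIntegrable_expDivPow {r : ℝ} (hr : 0 < r) (p : ℝ) :
    HankelIntegrable r Real.pi (ofLog (expDivPow p)) := by
  have hc := (differentiable_expDivPow p).continuous
  have ray : ∀ ϑ, Real.cos ϑ = -1 → IntegrableOn (fun ρ => ofLog (expDivPow p) ρ ϑ) (Ioi r) := by
    intro ϑ hϑ
    have hdom : IntegrableOn (fun ρ : ℝ => Real.exp (-ρ) * ρ ^ (-p - 1)) (Ioi r) := by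
      refine integrable_of_isBigO_exp_neg (b := 1 / 2) (by norm_num) ?_ ?_
      · refine ContinuousOn.mul (by fun_prop) fun ρ hρ => ?_
        exact (Real.continuousAt_rpow_const _ _
          (Or.inl (hr.trans_le hρ).ne')).continuousWithinAt
      · have h1 := (isLittleO_rpow_exp_pos_mul_atTop (-p - 1) (b := 1 / 2) (by norm_num)).isBigO
        have h2 := (Asymptotics.isBigO_refl (fun ρ : ℝ => Real.exp (-ρ)) atTop).mul h1
        refine h2.congr (fun ρ => rfl) fun ρ => ?_
        rw [← Real.exp_add]
        ring_nf
    refine Integrable.mono' hdom ?_ ?_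
    · exact ContinuousOn.aestronglyMeasurable (fun ρ hρ => (continuousAt_ofLog_radial
        (hr.trans hρ) hc.continuousAt).continuousWithinAt) measurableSet_Ioi
    · refine (ae_restrict_iff' measurableSet_Ioi).2 (Eventually.of_forall fun ρ hρ => ?_)
      rw [norm_expDivPow (hr.trans hρ), hϑ]
      simp
  refine ⟨ray _ (by simp), ?_, ray _ Real.cos_pi⟩
  exact ContinuousOn.intervalIntegrable fun ϑ _ =>
    (continuousAt_ofLog_angular hc.continuousAt).continuousWithinAt

theorem tendsto_expDivPow (p : ℝ) {ϑ : ℝ} (hϑ : Real.cos ϑ = -1) :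
    Tendsto (fun ρ => ofLog (expDivPow p) ρ ϑ) atTop (𝓝 0) := by
  have h := (tendsto_rpow_mul_exp_neg_mul_atTop_nhds_zero (-p - 1) 1 one_pos)
  refine squeeze_zero_norm' ?_ h
  filter_upwards [eventually_gt_atTop 0] with ρ hρ
  rw [norm_expDivPow hρ, hϑ, mul_comm]
  simp

/-- Integration by parts: the derivative of `exp ξ · ξ^(-p-1)` is `exp ξ · ξ^(-p-1) - (p + 1) exp ξ
· ξ^(-p-2)` and integrates to zero. This is the functional equation of `Γ` on the Hankel side. -/
theorem hankelIntegral_expDivPow_succ {r : ℝ} (hr : 0 < r) (p : ℝ) :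
    hankelIntegral r Real.pi (ofLog (expDivPow p))
      = (p + 1 : ℝ) * hankelIntegral r Real.pi (ofLog (expDivPow (p + 1))) := by
  have h0 := hankelIntegrable_expDivPow hr p
  have h1 := (hankelIntegrable_expDivPow hr (p + 1)).const_mul (-((p + 1 : ℝ) : ℂ))
  have hz := hankelIntegral_deriv_eq_zero (θ := Real.pi) (h := expDivPow p)
    (g := fun w => expDivPow p w + -((p + 1 : ℝ) : ℂ) * expDivPow (p + 1) w)
    (h' := fun w => (expDivPow p w + -((p + 1 : ℝ) : ℂ) * expDivPow (p + 1) w) * Complex.exp w)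
    hr ?_ (fun _ => rfl) (h0.add h1) (tendsto_expDivPow p (by simp))
    (tendsto_expDivPow p Real.cos_pi)
  · have h2 := hankelIntegral_add h0 h1
    rw [hankelIntegral_const_mul] at h2
    have h3 : hankelIntegral r Real.pi (ofLog (expDivPow p))
        + -((p + 1 : ℝ) : ℂ) * hankelIntegral r Real.pi (ofLog (expDivPow (p + 1))) = 0 := by
      rw [← h2, ← hz]; rfl
    linear_combination h3
  · intro w
    have e1 : HasDerivAt (fun w => Complex.exp (Complex.exp w))
        (Complex.exp (Complex.exp w) * Complex.exp w) w :=
      (Complex.hasDerivAt_exp w).cexp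
    have e2 : HasDerivAt (fun w : ℂ => Complex.exp (-w)) (Complex.exp (-w) * (-1)) w :=
      (hasDerivAt_neg w).cexp
    have e3 : HasDerivAt (fun w : ℂ => Complex.exp (((-p : ℝ) : ℂ) * w))
        (Complex.exp (((-p : ℝ) : ℂ) * w) * ((-p : ℝ) : ℂ)) w := by
      simpa using (((hasDerivAt_id w).const_mul ((-p : ℝ) : ℂ))).cexp
    have e := (e1.mul e2).mul e3
    refine e.congr_deriv ?_
    have e4 : Complex.exp (((-(p + 1) : ℝ) : ℂ) * w)
        = Complex.exp (((-p : ℝ) : ℂ) * w) * Complex.exp (-w) := by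
      rw [← Complex.exp_add]; congr 1; push_cast; ring
    have e5 : Complex.exp (-w) * Complex.exp w = 1 := by rw [← Complex.exp_add]; simp
    simp only [expDivPow, expDiv, Pi.mul_apply, e4]
    push_cast
    linear_combination (Complex.exp (Complex.exp w) * Complex.exp (-w) *
      Complex.exp (-(p : ℂ) * w) * (p + 1)) * e5

theorem hankelIntegral_expDivPow_radius {r R : ℝ} (hr : 0 < r) (hrR : r ≤ R) (p : ℝ) :
    hankelIntegral r Real.pi (ofLog (expDivPow p))
      = hankelIntegral R Real.pi (ofLog (expDivPow p)) :=
  (hankelIntegral_radius hr hrR Real.pi_pos.le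
    (fun _ _ _ _ => (differentiable_expDivPow p).differentiableAt)
    (hankelIntegrable_expDivPow (hr.trans_le hrR) p)).2

theorem ofLog_expDivPow {ρ : ℝ} (hρ : 0 < ρ) (p ϑ : ℝ) :
    ofLog (expDivPow p) ρ ϑ * Complex.exp (Complex.I * ϑ)
      = Complex.exp (polarPoint ρ ϑ) * ((ρ ^ (-p - 1) : ℝ) : ℂ) *
        Complex.exp (Complex.I * ((-p * ϑ : ℝ) : ℂ)) := by
  have h1 : Complex.exp (-logPt ρ ϑ) = ((ρ ^ (-1 : ℝ) : ℝ) : ℂ) * Complex.exp (-(Complex.I * ϑ)) := by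
    have := exp_mul_logPt hρ (-1) ϑ
    rw [polarPow] at this
    simpa using this
  have h2 : Complex.exp (-(Complex.I * ϑ)) * Complex.exp (Complex.I * ϑ) = 1 := by
    rw [← Complex.exp_add]; simp
  rw [ofLog, expDivPow, expDiv, exp_logPt hρ, h1, exp_mul_logPt hρ, polarPow, sub_eq_add_neg,
    Real.rpow_add hρ]
  push_cast
  linear_combination (Complex.exp (polarPoint ρ ϑ) * ((ρ ^ (-1 : ℝ) : ℝ) : ℂ) *
    ((ρ ^ (-p) : ℝ) : ℂ) * Complex.exp (Complex.I * (-(p : ℂ) * ϑ))) * h2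

theorem polarPoint_pi (ρ : ℝ) : polarPoint ρ Real.pi = ((-ρ : ℝ) : ℂ) := by
  rw [polarPoint, mul_comm Complex.I, Complex.exp_pi_mul_I]; push_cast; ring

theorem polarPoint_neg_pi (ρ : ℝ) : polarPoint ρ (-Real.pi) = ((-ρ : ℝ) : ℂ) := by
  rw [polarPoint]
  have : Complex.I * ((-Real.pi : ℝ) : ℂ) = -(Real.pi * Complex.I) := by push_cast; ring
  rw [this, Complex.exp_neg, Complex.exp_pi_mul_I]; push_cast; norm_num

/-- The contribution of the two rays to Hankel's integral, and the one of the circle. -/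
theorem hankelIntegral_expDivPow_eq {r : ℝ} (hr : 0 < r) (p : ℝ) :
    hankelIntegral r Real.pi (ofLog (expDivPow p))
      = -(2 * Complex.I * (Real.sin (p * Real.pi) : ℝ)) *
          ((∫ ρ in Ioi r, Real.exp (-ρ) * ρ ^ (-p - 1) : ℝ) : ℂ)
        + ∫ ϑ in (-Real.pi)..Real.pi, ofLog (expDivPow p) r ϑ * (Complex.I * polarPoint r ϑ) := by
  have ray : ∀ ϑ : ℝ, (∀ ρ, polarPoint ρ ϑ = ((-ρ : ℝ) : ℂ)) →
      ∫ ρ in Ioi r, ofLog (expDivPow p) ρ ϑ * Complex.exp (Complex.I * ϑ)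
        = ((∫ ρ in Ioi r, Real.exp (-ρ) * ρ ^ (-p - 1) : ℝ) : ℂ) *
          Complex.exp (Complex.I * ((-p * ϑ : ℝ) : ℂ)) := by
    intro ϑ hϑ
    rw [← integral_complex_ofReal, ← integral_mul_const]
    refine setIntegral_congr_fun measurableSet_Ioi fun ρ hρ => ?_
    simp only [ofLog_expDivPow (hr.trans hρ), hϑ]
    push_cast
    rfl
  unfold hankelIntegral
  rw [ray _ polarPoint_neg_pi, ray _ polarPoint_pi]
  have hs : (2 * Complex.I * (Real.sin (p * Real.pi) : ℝ))
      = Complex.exp (Complex.I * ((-p * -Real.pi : ℝ) : ℂ))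
        - Complex.exp (Complex.I * ((-p * Real.pi : ℝ) : ℂ)) := by
    have e1 : Complex.I * ((-p * -Real.pi : ℝ) : ℂ) = ((p * Real.pi : ℝ) : ℂ) * Complex.I := by
      push_cast; ring
    have e2 : Complex.I * ((-p * Real.pi : ℝ) : ℂ) = ((-(p * Real.pi) : ℝ) : ℂ) * Complex.I := by
      push_cast; ring
    rw [e1, e2, Complex.exp_mul_I, Complex.exp_mul_I]
    push_cast
    rw [Complex.cos_neg, Complex.sin_neg]
    ring
  rw [hs]
  ring

/-- For `p = 0` the integrand `exp ξ / ξ` is single-valued, so the two rays cancel and the circle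
gives Cauchy's integral formula for `exp` at `0`. -/
theorem hankelIntegral_expDivPow_zero {r : ℝ} (hr : 0 < r) :
    hankelIntegral r Real.pi (ofLog (expDivPow 0)) = 2 * Real.pi * Complex.I := by
  rw [hankelIntegral_expDivPow_eq hr]
  simp only [zero_mul, Real.sin_zero, Complex.ofReal_zero, mul_zero, neg_zero, zero_add]
  -- Periodicity moves the range of the angle from `[-π, π]` to `[0, 2π]`, the one used by
  -- `circleIntegral`.
  have hper : Function.Periodic
      (fun ϑ : ℝ => Complex.I * Complex.exp (polarPoint r ϑ)) (2 * Real.pi) := by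
    intro ϑ
    have : polarPoint r (ϑ + 2 * Real.pi) = polarPoint r ϑ := by
      unfold polarPoint
      push_cast
      rw [mul_add, Complex.exp_add,
        show Complex.I * (2 * (Real.pi : ℂ)) = 2 * Real.pi * Complex.I by ring,
        Complex.exp_two_pi_mul_I, mul_one]
    simp only [this]
  have h1 : ∀ ϑ : ℝ, ofLog (expDivPow 0) r ϑ * (Complex.I * polarPoint r ϑ)
      = Complex.I * Complex.exp (polarPoint r ϑ) := by
    intro ϑ
    have h := ofLog_expDivPow hr 0 ϑ
    have hr' : (r : ℂ) ≠ 0 := by exact_mod_cast hr.ne'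
    have h2 : ((r ^ (-(0 : ℝ) - 1) : ℝ) : ℂ) * r = 1 := by
      rw [neg_zero, zero_sub, Real.rpow_neg_one]; push_cast; field_simp
    calc _ = (ofLog (expDivPow 0) r ϑ * Complex.exp (Complex.I * ϑ)) * (Complex.I * r) := by
          rw [polarPoint]; ring
      _ = Complex.I * Complex.exp (polarPoint r ϑ) * (((r ^ (-(0 : ℝ) - 1) : ℝ) : ℂ) * r) := by
          rw [h]; simp; ring
      _ = _ := by rw [h2, mul_one]
  rw [intervalIntegral.integral_congr fun ϑ _ => h1 ϑ]
  have h2 := hper.intervalIntegral_add_eq (-Real.pi) 0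
  rw [show -Real.pi + 2 * Real.pi = Real.pi by ring, zero_add] at h2
  rw [h2]
  have h3 := Complex.circleIntegral_sub_inv_smul_of_differentiable_on_off_countable
    (f := Complex.exp) (c := 0) (w := 0) (R := r) (s := ∅) countable_empty (by simpa using hr)
    Complex.continuous_exp.continuousOn fun _ _ => Complex.differentiableAt_exp
  rw [Complex.exp_zero, smul_eq_mul, mul_one] at h3
  rw [← h3, circleIntegral]
  refine intervalIntegral.integral_congr fun ϑ _ => ?_
  have hr' : (r : ℂ) ≠ 0 := by exact_mod_cast hr.ne'
  simp only [deriv_circleMap, circleMap, zero_add, sub_zero, smul_eq_mul, polarPoint,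
    mul_comm Complex.I (ϑ : ℂ)]
  have := Complex.exp_ne_zero (ϑ * Complex.I)
  field_simp

/-- For `-1 < p < 0` the contour can be shrunk onto the cut. The circle contributes `O(r^(-p)) → 0`,
the rays tend to `-2i sin(pπ) Γ(-p)`, and Euler's reflection formula rewrites this limit. -/
theorem hankelIntegral_expDivPow_of_neg {r p : ℝ} (hr : 0 < r) (hp : -1 < p) (hp0 : p < 0) :
    hankelIntegral r Real.pi (ofLog (expDivPow p))
      = 2 * Real.pi * Complex.I / (Real.Gamma (p + 1) : ℝ) := by
  have hrn : ∀ n : ℕ, 0 < 1 / ((n : ℝ) + 1) := fun n => by positivity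
  have hconst : ∀ s : ℝ, 0 < s → hankelIntegral s Real.pi (ofLog (expDivPow p))
      = hankelIntegral r Real.pi (ofLog (expDivPow p)) := by
    intro s hs
    rcases le_total s r with h | h
    · exact hankelIntegral_expDivPow_radius hs h p
    · exact (hankelIntegral_expDivPow_radius hr h p).symm
  have hconv : IntegrableOn (fun ρ : ℝ => Real.exp (-ρ) * ρ ^ (-p - 1)) (Ioi 0) :=
    Real.GammaIntegral_convergent (by linarith)
  have hray : Tendsto (fun n : ℕ => ∫ ρ in Ioi (1 / ((n : ℝ) + 1)), Real.exp (-ρ) * ρ ^ (-p - 1))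
      atTop (𝓝 (Real.Gamma (-p))) := by
    have hU : ⋃ n : ℕ, Ioi (1 / ((n : ℝ) + 1)) = Ioi 0 := by
      ext x
      simp only [mem_iUnion, mem_Ioi]
      exact ⟨fun ⟨n, hn⟩ => (hrn n).trans hn, fun hx => exists_nat_one_div_lt hx⟩
    rw [Real.Gamma_eq_integral (by linarith), ← hU]
    refine tendsto_setIntegral_of_monotone (fun n => measurableSet_Ioi) ?_ (by rwa [hU])
    intro n m hnm
    exact Ioi_subset_Ioi (one_div_le_one_div_of_le (by positivity) (by
      have : (n : ℝ) ≤ m := by exact_mod_cast hnm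
      linarith))
  have hpi := Real.pi_pos
  have harc : Tendsto (fun n : ℕ => ∫ ϑ in (-Real.pi)..Real.pi,
      ofLog (expDivPow p) (1 / ((n : ℝ) + 1)) ϑ * (Complex.I * polarPoint (1 / ((n : ℝ) + 1)) ϑ))
      atTop (𝓝 0) := by
    have hlim : Tendsto (fun n : ℕ => (1 / ((n : ℝ) + 1)) ^ (-p) * Real.exp 1 *
        (Real.pi - -Real.pi)) atTop (𝓝 0) := by
      have h1 : Tendsto (fun n : ℕ => (1 / ((n : ℝ) + 1)) ^ (-p)) atTop (𝓝 0) := by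
        have := (tendsto_one_div_add_atTop_nhds_zero_nat (𝕜 := ℝ)).rpow_const (p := -p)
          (Or.inr (by linarith))
        rwa [Real.zero_rpow (by linarith)] at this
      simpa using (h1.mul_const (Real.exp 1)).mul_const (Real.pi - -Real.pi)
    refine squeeze_zero_norm (fun n => ?_) hlim
    refine norm_arc_expDiv_le (hrn n) (by linarith) (fun ϑ _ => ?_) (by positivity) fun ϑ _ => ?_
    · rw [norm_exp_mul_logPt (hrn n)]
    · refine Real.exp_le_exp.2 ?_
      have h1 : 1 / ((n : ℝ) + 1) ≤ 1 := by
        rw [div_le_one (by positivity)]; linarith [(Nat.cast_nonneg n : (0 : ℝ) ≤ n)]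
      nlinarith [Real.cos_le_one ϑ, hrn n]
  have hlim := ((((Complex.continuous_ofReal.tendsto _).comp hray).const_mul
    (-(2 * Complex.I * (Real.sin (p * Real.pi) : ℝ))))).add harc
  have heq : ∀ n : ℕ, hankelIntegral r Real.pi (ofLog (expDivPow p)) = _ := fun n =>
    (hconst _ (hrn n)).symm.trans (hankelIntegral_expDivPow_eq (hrn n) p)
  have hfin := tendsto_nhds_unique (tendsto_const_nhds.congr heq) hlim
  rw [hfin, add_zero]
  have hG := Real.Gamma_mul_Gamma_one_sub (-p)
  have hsin : Real.sin (Real.pi * -p) ≠ 0 :=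
    (Real.sin_pos_of_pos_of_lt_pi (by nlinarith) (by nlinarith)).ne'
  have hGp : Real.Gamma (p + 1) ≠ 0 := (Real.Gamma_pos_of_pos (by linarith)).ne'
  rw [show 1 - -p = p + 1 by ring, eq_div_iff hsin] at hG
  rw [show p * Real.pi = -(Real.pi * -p) by ring, Real.sin_neg,
    eq_div_iff (by exact_mod_cast hGp)]
  have hGc := congrArg (fun x : ℝ => (x : ℂ)) hG
  simp only [Complex.ofReal_mul] at hGc
  rw [Complex.ofReal_neg]
  linear_combination (2 * Complex.I) * hGc

/-- Hankel's formula `∫_Ha exp ξ ξ ^ (-p-1) dξ = 2πi / Γ(p+1)`. -/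
theorem hankelIntegral_expDivPow {r p : ℝ} (hr : 0 < r) (hp : -1 < p) :
    hankelIntegral r Real.pi (ofLog (expDivPow p))
      = 2 * Real.pi * Complex.I / (Real.Gamma (p + 1) : ℝ) := by
  have h : ∀ n : ℕ, ∀ p : ℝ, -1 < p → p ≤ n → hankelIntegral r Real.pi (ofLog (expDivPow p))
      = 2 * Real.pi * Complex.I / (Real.Gamma (p + 1) : ℝ) := by
    intro n
    -- The base case covers `-1 < p ≤ 0`. Each further unit interval is reached by the recurrence
    -- from `p - 1` to `p`.
    induction n with
    | zero =>
      intro p hp hpn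
      rcases hpn.lt_or_eq with h | h
      · exact hankelIntegral_expDivPow_of_neg hr hp (by simpa using h)
      · rw [h]; simp [hankelIntegral_expDivPow_zero hr]
    | succ n ih =>
      intro p hp hpn
      rcases le_or_gt p 0 with h | h
      · exact ih p hp (h.trans (Nat.cast_nonneg n))
      · have h1 := hankelIntegral_expDivPow_succ hr (p - 1)
        rw [ih (p - 1) (by linarith) (by push_cast at hpn; linarith), sub_add_cancel] at h1
        have hp' : (p : ℂ) ≠ 0 := by exact_mod_cast h.ne'
        have hG : (Real.Gamma p : ℂ) ≠ 0 := by
          exact_mod_cast (Real.Gamma_pos_of_pos h).ne'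
        rw [Real.Gamma_add_one h.ne']
        push_cast
        field_simp
        field_simp at h1
        linear_combination -h1
  obtain ⟨n, hn⟩ := exists_nat_ge p
  exact h n p hp hn

/-! ### Riemann–Liouville integrals -/

/-- The Riemann–Liouville integral of order `γ > 0`. -/
def fracInt (γ : ℝ) (f : ℝ → ℂ) (t : ℝ) : ℂ :=
  (((Real.Gamma γ)⁻¹ : ℝ) : ℂ) * ∫ τ in (0 : ℝ)..t, (((t - τ) ^ (γ - 1) : ℝ) : ℂ) * f τ

theorem fracInt_zero_right (γ : ℝ) (f : ℝ → ℂ) : fracInt γ f 0 = 0 := by simp [fracInt]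

theorem intervalIntegrable_sub_rpow {γ : ℝ} (hγ : 0 < γ) (t : ℝ) :
    IntervalIntegrable (fun τ => (t - τ) ^ (γ - 1)) volume 0 t := by
  have h := (intervalIntegral.intervalIntegrable_rpow' (a := 0) (b := t) (r := γ - 1)
    (by linarith)).comp_sub_left t
  simpa using h.symm

theorem intervalIntegrable_fracKernel_mul {γ t : ℝ} (hγ : 0 < γ) {f : ℝ → ℂ}
    (hf : ContinuousOn f (uIcc 0 t)) :
    IntervalIntegrable (fun τ => (((t - τ) ^ (γ - 1) : ℝ) : ℂ) * f τ) volume 0 t :=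
  IntervalIntegrable.mul_continuousOn
    ⟨(intervalIntegrable_sub_rpow hγ t).1.ofReal, (intervalIntegrable_sub_rpow hγ t).2.ofReal⟩ hf

theorem fracInt_congr {γ t : ℝ} (ht : 0 ≤ t) {f g : ℝ → ℂ} (h : ∀ τ ∈ Ioc 0 t, f τ = g τ) :
    fracInt γ f t = fracInt γ g t := by
  unfold fracInt
  congr 1
  rw [intervalIntegral.integral_of_le ht, intervalIntegral.integral_of_le ht]
  exact setIntegral_congr_fun measurableSet_Ioc fun τ hτ => by simp only [h τ hτ]

theorem fracInt_add {γ t : ℝ} (hγ : 0 < γ) {f g : ℝ → ℂ} (hf : ContinuousOn f (uIcc 0 t))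
    (hg : ContinuousOn g (uIcc 0 t)) :
    fracInt γ (fun τ => f τ + g τ) t = fracInt γ f t + fracInt γ g t := by
  unfold fracInt
  simp only [mul_add]
  rw [intervalIntegral.integral_add (intervalIntegrable_fracKernel_mul hγ hf)
    (intervalIntegrable_fracKernel_mul hγ hg), mul_add]

theorem fracInt_sub {γ t : ℝ} (hγ : 0 < γ) {f g : ℝ → ℂ} (hf : ContinuousOn f (uIcc 0 t))
    (hg : ContinuousOn g (uIcc 0 t)) :
    fracInt γ (fun τ => f τ - g τ) t = fracInt γ f t - fracInt γ g t := by
  unfold fracInt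
  simp only [mul_sub]
  rw [intervalIntegral.integral_sub (intervalIntegrable_fracKernel_mul hγ hf)
    (intervalIntegrable_fracKernel_mul hγ hg), mul_sub]

theorem fracInt_const_mul (γ t : ℝ) (c : ℂ) (f : ℝ → ℂ) :
    fracInt γ (fun τ => c * f τ) t = c * fracInt γ f t := by
  unfold fracInt
  simp only [mul_left_comm _ c]
  rw [intervalIntegral.integral_const_mul]
  ring

theorem integral_beta {μ ν τ t : ℝ} (hμ : 0 < μ) (hν : 0 < ν) (hτ : τ < t) :
    ∫ s in τ..t, (t - s) ^ (μ - 1) * (s - τ) ^ (ν - 1)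
      = (t - τ) ^ (μ + ν - 1) * (Real.Gamma μ * Real.Gamma ν / Real.Gamma (μ + ν)) := by
  have ha : 0 < t - τ := sub_pos.2 hτ
  have h1 : ∫ s in τ..t, (t - s) ^ (μ - 1) * (s - τ) ^ (ν - 1)
      = ∫ x in (0 : ℝ)..(t - τ), x ^ (ν - 1) * ((t - τ) - x) ^ (μ - 1) := by
    have := intervalIntegral.integral_comp_sub_right (a := τ) (b := t)
      (fun x : ℝ => x ^ (ν - 1) * ((t - τ) - x) ^ (μ - 1)) τ
    rw [sub_self] at this
    rw [← this]
    refine intervalIntegral.integral_congr fun s _ => ?_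
    simp only [show t - τ - (s - τ) = t - s by ring]
    ring
  have h2 := Complex.betaIntegral_scaled (ν : ℂ) (μ : ℂ) ha
  have h3 := Complex.Gamma_mul_Gamma_eq_betaIntegral (s := (ν : ℂ)) (t := (μ : ℂ))
    (by simpa using hν) (by simpa using hμ)
  have hG : Complex.Gamma (ν + μ) ≠ 0 := by
    rw [← Complex.ofReal_add, Complex.Gamma_ofReal]
    exact_mod_cast (Real.Gamma_pos_of_pos (by linarith)).ne'
  rw [h1]
  apply Complex.ofReal_injective
  rw [← intervalIntegral.integral_ofReal]
  have h4 : ∫ x in (0 : ℝ)..(t - τ), ((x ^ (ν - 1) * ((t - τ) - x) ^ (μ - 1) : ℝ) : ℂ)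
      = ∫ x in (0 : ℝ)..(t - τ), (x : ℂ) ^ ((ν : ℂ) - 1) * (((t - τ : ℝ) : ℂ) - x) ^ ((μ : ℂ) - 1) := by
    refine intervalIntegral.integral_congr fun x hx => ?_
    rw [uIcc_of_le ha.le] at hx
    rw [Complex.ofReal_mul, Complex.ofReal_cpow hx.1, Complex.ofReal_cpow (by linarith [hx.2])]
    push_cast
    rfl
  rw [h4, h2, Complex.ofReal_mul, Complex.ofReal_cpow ha.le]
  have h5 : Complex.betaIntegral ν μ
      = ((Real.Gamma μ * Real.Gamma ν / Real.Gamma (μ + ν) : ℝ) : ℂ) := by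
    push_cast
    rw [← Complex.Gamma_ofReal, ← Complex.Gamma_ofReal, ← Complex.Gamma_ofReal, Complex.ofReal_add,
      add_comm (μ : ℂ), eq_div_iff hG]
    linear_combination -h3
  rw [h5]
  congr 2
  push_cast
  ring

/-- The Beta integral just computed is positive, whereas the integral of a non-integrable function
is `0` by convention. -/
theorem intervalIntegrable_beta {μ ν τ t : ℝ} (hμ : 0 < μ) (hν : 0 < ν) (hτ : τ < t) :
    IntervalIntegrable (fun s => (t - s) ^ (μ - 1) * (s - τ) ^ (ν - 1)) volume τ t := by
  refine intervalIntegral.intervalIntegrable_of_integral_ne_zero ?_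
  rw [integral_beta hμ hν hτ]
  have h1 := Real.Gamma_pos_of_pos hμ
  have h2 := Real.Gamma_pos_of_pos hν
  have h3 := Real.Gamma_pos_of_pos (add_pos hμ hν)
  have h4 : 0 < t - τ := sub_pos.2 hτ
  positivity

theorem fracInt_rpow {γ p t : ℝ} (hγ : 0 < γ) (hp : 0 ≤ p) (ht : 0 ≤ t) :
    fracInt γ (fun τ => ((τ ^ p / Real.Gamma (p + 1) : ℝ) : ℂ)) t
      = ((t ^ (p + γ) / Real.Gamma (p + γ + 1) : ℝ) : ℂ) := by
  rcases ht.eq_or_lt with rfl | ht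
  · rw [fracInt_zero_right, Real.zero_rpow (by linarith)]
    simp
  · have h := integral_beta (μ := γ) (ν := p + 1) hγ (by linarith) ht
    unfold fracInt
    have e : ∀ τ : ℝ, (((t - τ) ^ (γ - 1) : ℝ) : ℂ) * ((τ ^ p / Real.Gamma (p + 1) : ℝ) : ℂ)
        = ((((t - τ) ^ (γ - 1) * (τ - 0) ^ (p + 1 - 1)) * (Real.Gamma (p + 1))⁻¹ : ℝ) : ℂ) := by
      intro τ
      rw [← Complex.ofReal_mul, sub_zero, add_sub_cancel_right]
      congr 1
      ring
    simp only [e]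
    rw [intervalIntegral.integral_ofReal, intervalIntegral.integral_mul_const, h,
      ← Complex.ofReal_mul]
    congr 1
    have h1 := (Real.Gamma_pos_of_pos hγ).ne'
    have h2 := (Real.Gamma_pos_of_pos (show 0 < p + 1 by linarith)).ne'
    rw [sub_zero, show γ + (p + 1) - 1 = p + γ by ring, show γ + (p + 1) = p + γ + 1 by ring]
    field_simp

/-- Exponentially weighted bound for the Riemann–Liouville integral. -/
theorem norm_fracInt_le {γ l B t : ℝ} (hγ : 0 < γ) (hl : 0 < l) (hB : 0 ≤ B) (ht : 0 ≤ t)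
    {f : ℝ → ℂ} (hf : ∀ τ ∈ Ioc 0 t, ‖f τ‖ ≤ B * Real.exp (l * τ)) :
    ‖fracInt γ f t‖ ≤ l ^ (-γ) * (B * Real.exp (l * t)) := by
  have hG := Real.Gamma_pos_of_pos hγ
  have hint : IntervalIntegrable (fun τ => (t - τ) ^ (γ - 1) * (B * Real.exp (l * τ))) volume 0 t :=
    (intervalIntegrable_sub_rpow hγ t).mul_continuousOn (by fun_prop)
  have h1 : ‖∫ τ in (0 : ℝ)..t, (((t - τ) ^ (γ - 1) : ℝ) : ℂ) * f τ‖
      ≤ ∫ τ in (0 : ℝ)..t, (t - τ) ^ (γ - 1) * (B * Real.exp (l * τ)) := by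
    refine intervalIntegral.norm_integral_le_of_norm_le ht
      (Eventually.of_forall fun τ hτ => ?_) hint
    have h0 : 0 ≤ (t - τ) ^ (γ - 1) := Real.rpow_nonneg (by linarith [hτ.2]) _
    rw [norm_mul, Complex.norm_real, Real.norm_of_nonneg h0]
    exact mul_le_mul_of_nonneg_left (hf τ hτ) h0
  have h2 : ∫ τ in (0 : ℝ)..t, (t - τ) ^ (γ - 1) * (B * Real.exp (l * τ))
      = B * Real.exp (l * t) * ∫ s in (0 : ℝ)..t, s ^ (γ - 1) * Real.exp (-(l * s)) := by
    have := intervalIntegral.integral_comp_sub_left (a := 0) (b := t)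
      (fun s => s ^ (γ - 1) * (B * Real.exp (l * (t - s)))) t
    simp only [sub_sub_cancel, sub_self, sub_zero] at this
    rw [this, ← intervalIntegral.integral_const_mul]
    refine intervalIntegral.integral_congr fun s _ => ?_
    rw [mul_sub, sub_eq_add_neg (l * t), Real.exp_add]
    ring
  -- Extending the range of integration to `(0, ∞)` gives a Gamma integral; this is the source of
  -- the gain `l^(-γ)`.
  have h3 : ∫ s in (0 : ℝ)..t, s ^ (γ - 1) * Real.exp (-(l * s)) ≤ (1 / l) ^ γ * Real.Gamma γ := by
    rw [← Real.integral_rpow_mul_exp_neg_mul_Ioi hγ hl, intervalIntegral.integral_of_le ht]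
    refine setIntegral_mono_set ?_ ?_ (Eventually.of_forall fun x hx => hx.1)
    · refine Integrable.of_integral_ne_zero ?_
      rw [Real.integral_rpow_mul_exp_neg_mul_Ioi hγ hl]
      positivity
    · exact (ae_restrict_iff' measurableSet_Ioi).2 (Eventually.of_forall fun s hs =>
        mul_nonneg (Real.rpow_nonneg (le_of_lt hs) _) (Real.exp_pos _).le)
  rw [fracInt, norm_mul, Complex.norm_real, Real.norm_of_nonneg (inv_pos.2 hG).le]
  calc (Real.Gamma γ)⁻¹ * ‖∫ τ in (0 : ℝ)..t, (((t - τ) ^ (γ - 1) : ℝ) : ℂ) * f τ‖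
      ≤ (Real.Gamma γ)⁻¹ * (B * Real.exp (l * t) * ((1 / l) ^ γ * Real.Gamma γ)) := by
        refine mul_le_mul_of_nonneg_left ?_ (inv_pos.2 hG).le
        refine (h1.trans_eq h2).trans (mul_le_mul_of_nonneg_left h3 (by positivity))
    _ = l ^ (-γ) * (B * Real.exp (l * t)) := by
        rw [one_div, Real.inv_rpow hl.le, Real.rpow_neg hl.le]
        field_simp

/-- The semigroup property of the Riemann–Liouville integrals. -/
theorem fracInt_fracInt {μ ν t : ℝ} (hμ : 0 < μ) (hν : 0 < ν) (hμν : 1 ≤ μ + ν) (ht : 0 ≤ t)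
    {g : ℝ → ℂ} (hg : IntegrableOn g (Ioc 0 t)) :
    IntervalIntegrable (fun s => (((t - s) ^ (μ - 1) : ℝ) : ℂ) * fracInt ν g s) volume 0 t ∧
      fracInt μ (fracInt ν g) t = fracInt (μ + ν) g t := by
  have hΓμ := Real.Gamma_pos_of_pos hμ
  have hΓν := Real.Gamma_pos_of_pos hν
  have hΓ := Real.Gamma_pos_of_pos (add_pos hμ hν)
  set Bc : ℝ := Real.Gamma μ * Real.Gamma ν / Real.Gamma (μ + ν) with hBc
  have hBc0 : 0 ≤ Bc := by positivity
  -- The product of the two kernels, cut off to the triangle `τ < s`, so that Fubini can be applied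
  -- on a square.
  set k : ℝ → ℝ → ℝ := fun s τ =>
    (Ioi τ).indicator (fun s => (t - s) ^ (μ - 1) * (s - τ) ^ (ν - 1)) s with hk
  have hset : ∀ τ ∈ Ioc (0 : ℝ) t, Ioc 0 t ∩ Ioi τ = Ioc τ t := by
    intro τ hτ
    ext s
    simp only [mem_inter_iff, mem_Ioc, mem_Ioi]
    exact ⟨fun h => ⟨h.2, h.1.2⟩, fun h => ⟨⟨hτ.1.trans h.1, h.2⟩, h.1⟩⟩
  have hkint : ∀ τ ∈ Ioo (0 : ℝ) t, IntegrableOn (fun s => k s τ) (Ioc 0 t) := by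
    intro τ hτ
    rw [hk, IntegrableOn, integrable_indicator_iff measurableSet_Ioi, IntegrableOn,
      Measure.restrict_restrict measurableSet_Ioi, inter_comm, hset τ ⟨hτ.1, hτ.2.le⟩]
    exact (intervalIntegrable_iff_integrableOn_Ioc_of_le hτ.2.le).1
      (intervalIntegrable_beta hμ hν hτ.2)
  have hkval : ∀ τ ∈ Ioo (0 : ℝ) t, ∫ s in Ioc 0 t, k s τ = (t - τ) ^ (μ + ν - 1) * Bc := by
    intro τ hτ
    rw [hk, setIntegral_indicator measurableSet_Ioi, hset τ ⟨hτ.1, hτ.2.le⟩,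
      ← intervalIntegral.integral_of_le hτ.2.le, integral_beta hμ hν hτ.2]
  have hknn : ∀ s τ, s ≤ t → 0 ≤ k s τ := by
    intro s τ hs
    refine indicator_apply_nonneg (fun h => ?_)
    exact mul_nonneg (Real.rpow_nonneg (by linarith) _)
      (Real.rpow_nonneg (by linarith [mem_Ioi.1 h]) _)
  have hkmeas : Measurable (fun p : ℝ × ℝ => k p.1 p.2) := by
    have : (fun p : ℝ × ℝ => k p.1 p.2) = {p : ℝ × ℝ | p.2 < p.1}.indicator
        (fun p => (t - p.1) ^ (μ - 1) * (p.1 - p.2) ^ (ν - 1)) := by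
      ext p
      simp only [hk, indicator, mem_Ioi, mem_ofPred_eq]
    rw [this]
    exact Measurable.indicator (by fun_prop) (measurableSet_lt measurable_snd measurable_fst)
  have hae : ∀ᵐ τ ∂(volume.restrict (Ioc (0 : ℝ) t)), τ ∈ Ioo (0 : ℝ) t := by
    rw [← restrict_Ioo_eq_restrict_Ioc]
    exact ae_restrict_mem measurableSet_Ioo
  have hswap : Integrable (Function.uncurry fun s τ => (k s τ : ℂ) * g τ)
      ((volume.restrict (Ioc (0 : ℝ) t)).prod (volume.restrict (Ioc (0 : ℝ) t))) := by
    have hm : AEStronglyMeasurable (Function.uncurry fun s τ => (k s τ : ℂ) * g τ)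
        ((volume.restrict (Ioc (0 : ℝ) t)).prod (volume.restrict (Ioc (0 : ℝ) t))) :=
      (Complex.measurable_ofReal.comp hkmeas).aestronglyMeasurable.mul hg.1.comp_snd
    refine (integrable_prod_iff' hm).2 ⟨?_, ?_⟩
    · filter_upwards [hae] with τ hτ
      exact (hkint τ hτ).ofReal.mul_const (g τ)
    · have h1 : ∀ᵐ τ ∂(volume.restrict (Ioc (0 : ℝ) t)),
          ((t - τ) ^ (μ + ν - 1) * Bc) * ‖g τ‖
          = ∫ s in Ioc 0 t, ‖Function.uncurry (fun s τ => (k s τ : ℂ) * g τ) (s, τ)‖ := by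
        filter_upwards [hae] with τ hτ
        rw [← hkval τ hτ, ← integral_mul_const]
        refine setIntegral_congr_fun measurableSet_Ioc fun s hs => ?_
        simp only [Function.uncurry, norm_mul, Complex.norm_real,
          Real.norm_of_nonneg (hknn s τ hs.2)]
      refine Integrable.congr ?_ h1
      -- Here `1 ≤ μ + ν` is needed: the composed kernel `(t - τ)^(μ + ν - 1)` is then bounded, and
      -- integrability of `g` suffices at every single `t`.
      refine Integrable.bdd_mul (c := t ^ (μ + ν - 1) * Bc) hg.norm ?_ ?_
      · exact (Measurable.aestronglyMeasurable (by fun_prop))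
      · filter_upwards [hae] with τ hτ
        have h2 : 0 ≤ t - τ := by linarith [hτ.2]
        rw [Real.norm_of_nonneg (by positivity)]
        refine mul_le_mul_of_nonneg_right ?_ hBc0
        exact Real.rpow_le_rpow h2 (by linarith [hτ.1]) (by linarith)
  have hfub := integral_integral_swap hswap
  have hpt : ∀ s ∈ Ioc 0 t, ∫ τ in Ioc 0 t, (k s τ : ℂ) * g τ
      = (((t - s) ^ (μ - 1) : ℝ) : ℂ) *
          ∫ τ in (0 : ℝ)..s, (((s - τ) ^ (ν - 1) : ℝ) : ℂ) * g τ := by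
    intro s hs
    have hs' : Ioc (0 : ℝ) t ∩ Iio s = Ioo 0 s := by
      ext τ
      simp only [mem_inter_iff, mem_Ioc, mem_Iio, mem_Ioo]
      exact ⟨fun h => ⟨h.1.1, h.2⟩, fun h => ⟨⟨h.1, (h.2.trans_le hs.2).le⟩, h.2⟩⟩
    have e : (fun τ => (k s τ : ℂ) * g τ) = (Iio s).indicator (fun τ =>
        (((t - s) ^ (μ - 1) : ℝ) : ℂ) * ((((s - τ) ^ (ν - 1) : ℝ) : ℂ) * g τ)) := by
      ext τ
      by_cases h : τ < s
      · simp only [hk, indicator, mem_Ioi, mem_Iio, h, if_true]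
        push_cast; ring
      · simp [hk, indicator, h]
    rw [e, setIntegral_indicator measurableSet_Iio, hs', integral_const_mul,
      intervalIntegral.integral_of_le hs.1.le, integral_Ioc_eq_integral_Ioo]
  have hL := setIntegral_congr_fun (μ := volume) measurableSet_Ioc hpt
  have hR : ∫ τ in Ioc 0 t, ∫ s in Ioc 0 t, (k s τ : ℂ) * g τ
      = ∫ τ in Ioc 0 t, (Bc : ℂ) * ((((t - τ) ^ (μ + ν - 1) : ℝ) : ℂ) * g τ) := by
    refine integral_congr_ae ?_
    filter_upwards [hae] with τ hτ
    rw [integral_mul_const, integral_complex_ofReal, hkval τ hτ]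
    push_cast; ring
  refine ⟨?_, ?_⟩
  · rw [intervalIntegrable_iff_integrableOn_Ioc_of_le ht]
    refine ((hswap.integral_prod_left.congr ((ae_restrict_iff' measurableSet_Ioc).2
      (Eventually.of_forall hpt))).const_mul (((Real.Gamma ν)⁻¹ : ℝ) : ℂ)).congr
      (Eventually.of_forall fun s => ?_)
    simp only [fracInt]
    ring
  rw [hL, hR, integral_const_mul] at hfub
  unfold fracInt
  simp only [mul_left_comm _ (((Real.Gamma ν)⁻¹ : ℝ) : ℂ)]
  rw [intervalIntegral.integral_const_mul, intervalIntegral.integral_of_le ht, hfub,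
    intervalIntegral.integral_of_le ht, hBc, ← mul_assoc, ← mul_assoc]
  congr 1
  push_cast
  have h1 : (Real.Gamma μ : ℂ) ≠ 0 := by exact_mod_cast hΓμ.ne'
  have h2 : (Real.Gamma ν : ℂ) ≠ 0 := by exact_mod_cast hΓν.ne'
  field_simp

theorem fracInt_one (f : ℝ → ℂ) (t : ℝ) : fracInt 1 f t = ∫ τ in (0 : ℝ)..t, f τ := by
  simp [fracInt]

/-- The Riemann–Liouville integral commutes with integration over a parameter. -/
theorem integrable_fracInt_and_fracInt_integral {X : Type*} [MeasurableSpace X] {μ : Measure X} [SFinite μ] {γ t : ℝ}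
    (hγ : 0 < γ) (ht : 0 ≤ t) {F : X → ℝ → ℂ} {G : X → ℝ} (hG : Integrable G μ)
    (hF : AEStronglyMeasurable (Function.uncurry F) (μ.prod (volume.restrict (Ioc 0 t))))
    (hFG : ∀ x, ∀ τ ∈ Ioc 0 t, ‖F x τ‖ ≤ G x) :
    Integrable (fun x => fracInt γ (F x) t) μ ∧
      fracInt γ (fun τ => ∫ x, F x τ ∂μ) t = ∫ x, fracInt γ (F x) t ∂μ := by
  have hk : IntegrableOn (fun τ => (t - τ) ^ (γ - 1)) (Ioc 0 t) :=
    (intervalIntegrable_iff_integrableOn_Ioc_of_le ht).1 (intervalIntegrable_sub_rpow hγ t)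
  have hint : Integrable (Function.uncurry fun x τ => (((t - τ) ^ (γ - 1) : ℝ) : ℂ) * F x τ)
      (μ.prod (volume.restrict (Ioc 0 t))) := by
    refine Integrable.mono' (hG.mul_prod hk) ?_ ?_
    · exact (Complex.measurable_ofReal.comp (by fun_prop :
        Measurable fun p : X × ℝ => (t - p.2) ^ (γ - 1))).aestronglyMeasurable.mul hF
    · have : ∀ᵐ p ∂(μ.prod (volume.restrict (Ioc (0 : ℝ) t))), p.2 ∈ Ioc 0 t :=
        Measure.quasiMeasurePreserving_snd.ae (ae_restrict_mem measurableSet_Ioc)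
      filter_upwards [this] with p hp
      have h0 : 0 ≤ (t - p.2) ^ (γ - 1) := Real.rpow_nonneg (by linarith [hp.2]) _
      simp only [Function.uncurry, norm_mul, Complex.norm_real, Real.norm_of_nonneg h0]
      rw [mul_comm]
      exact mul_le_mul_of_nonneg_right (hFG _ _ hp) h0
  have h := integral_integral_swap hint
  unfold fracInt
  refine ⟨?_, ?_⟩
  · have h' := hint.integral_prod_left
    simp only [intervalIntegral.integral_of_le ht]
    exact h'.const_mul _
  rw [integral_const_mul]
  congr 1
  simp only [intervalIntegral.integral_of_le ht]
  rw [h]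
  simp only [integral_const_mul]

/-! ### The Hankel integral of the solution, in reduced variables -/

/-- The power `ξ ^ (-p)` of `ξ = exp w`. -/
def negPow (p : ℝ) (w : ℂ) : ℂ := Complex.exp (((-p : ℝ) : ℂ) * w)

theorem differentiable_negPow (p : ℝ) : Differentiable ℂ (negPow p) := by
  unfold negPow; fun_prop

theorem negPow_zero (w : ℂ) : negPow 0 w = 1 := by simp [negPow]

theorem negPow_add (p q : ℝ) (w : ℂ) : negPow (p + q) w = negPow p w * negPow q w := by
  rw [negPow, negPow, negPow, ← Complex.exp_add]; congr 1; push_cast; ring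

theorem norm_negPow {ρ : ℝ} (hρ : 0 < ρ) (p ϑ : ℝ) : ‖negPow p (logPt ρ ϑ)‖ = ρ ^ (-p) :=
  norm_exp_mul_logPt hρ _ _

theorem norm_negPow_le {R ρ p : ℝ} (hR : 0 < R) (hρ : R ≤ ρ) (hp : 0 ≤ p) (ϑ : ℝ) :
    ‖negPow p (logPt ρ ϑ)‖ ≤ R ^ (-p) := by
  rw [norm_negPow (hR.trans_le hρ)]
  exact Real.rpow_le_rpow_of_nonpos hR hρ (by linarith)

/-- `x ξ ^ (-β) + y ξ ^ (-γ)`. -/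
def lowerTerms (β γ x y : ℝ) (w : ℂ) : ℂ := x * negPow β w + y * negPow γ w

/-- `(1 + x ξ ^ (-β)) / (1 + x ξ ^ (-β) + y ξ ^ (-γ))`. -/
def symbol (β γ x y : ℝ) (w : ℂ) : ℂ := (1 + x * negPow β w) / (1 + lowerTerms β γ x y w)

/-- The radius `R` is so large that the Neumann series of the symbol converges. -/
def Large (β γ x y R : ℝ) : Prop := 0 < R ∧ x * R ^ (-β) + y * R ^ (-γ) ≤ 1 / 2

/-- A radius that is large for all `x, y ≥ 0` with `x + y ≤ M`. -/
def largeRadius (β M : ℝ) : ℝ := 1 + (2 * M) ^ (1 / β)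

section ReducedVariables

variable {β γ x y R : ℝ}

theorem one_le_largeRadius (β : ℝ) {M : ℝ} (hM : 0 ≤ M) : 1 ≤ largeRadius β M := by
  have : 0 ≤ (2 * M) ^ (1 / β) := by positivity
  unfold largeRadius; linarith

/-- The summand `1` in the radius gives `R ≥ 1`, hence `R^(-γ) ≤ R^(-β)`. The other summand gives
`R^β ≥ 2M`, so both terms together are at most `M R^(-β) ≤ 1/2`. -/
theorem large_largeRadius {M : ℝ} (hβ : 0 < β) (hβγ : β ≤ γ) (hx : 0 ≤ x) (hy : 0 ≤ y)
    (hM : x + y ≤ M) : Large β γ x y (largeRadius β M) := by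
  have hM0 : 0 ≤ M := by linarith
  have h1 := one_le_largeRadius β hM0
  have h0 : 0 < largeRadius β M := by linarith
  refine ⟨h0, ?_⟩
  have h2 : largeRadius β M ^ (-γ) ≤ largeRadius β M ^ (-β) :=
    Real.rpow_le_rpow_of_exponent_le h1 (by linarith)
  have h3 : 2 * M ≤ largeRadius β M ^ β := by
    calc 2 * M = ((2 * M) ^ (1 / β)) ^ β := by
          rw [← Real.rpow_mul (by positivity), one_div, inv_mul_cancel₀ hβ.ne', Real.rpow_one]
      _ ≤ _ := Real.rpow_le_rpow (by positivity) (by unfold largeRadius; linarith) hβ.le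
  have h4 : 0 < largeRadius β M ^ β := by positivity
  calc x * largeRadius β M ^ (-β) + y * largeRadius β M ^ (-γ)
      ≤ x * largeRadius β M ^ (-β) + y * largeRadius β M ^ (-β) := by gcongr
    _ = (x + y) * largeRadius β M ^ (-β) := by ring
    _ ≤ M * largeRadius β M ^ (-β) := by gcongr
    _ ≤ 1 / 2 := by
      rw [Real.rpow_neg h0.le, ← div_eq_mul_inv, div_le_iff₀ h4]
      linarith

theorem Large.mono (h : Large β γ x y R) (hβ : 0 < β) (hβγ : β ≤ γ) (hx : 0 ≤ x) (hy : 0 ≤ y)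
    {R' : ℝ} (hR : R ≤ R') : Large β γ x y R' := by
  refine ⟨h.1.trans_le hR, le_trans ?_ h.2⟩
  have h1 : R' ^ (-β) ≤ R ^ (-β) := Real.rpow_le_rpow_of_nonpos h.1 hR (by linarith)
  have h2 : R' ^ (-γ) ≤ R ^ (-γ) := Real.rpow_le_rpow_of_nonpos h.1 hR (by linarith)
  gcongr

theorem Large.mono_arg (h : Large β γ x y R) {x' y' : ℝ} (hx : x' ≤ x) (hy : y' ≤ y) :
    Large β γ x' y' R := by
  have := h.1
  refine ⟨h.1, le_trans ?_ h.2⟩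
  gcongr

theorem norm_mul_negPow_le {R ρ p a : ℝ} (hR : 0 < R) (hρ : R ≤ ρ) (hp : 0 ≤ p) (ϑ : ℝ) :
    ‖(a : ℂ) * negPow p (logPt ρ ϑ)‖ ≤ |a| * R ^ (-p) := by
  rw [norm_mul, Complex.norm_real, Real.norm_eq_abs]
  exact mul_le_mul_of_nonneg_left (norm_negPow_le hR hρ hp ϑ) (abs_nonneg a)

/-! ### Bounds on the symbol outside a large disc -/

section Estimates

variable (h : Large β γ x y R) (hβ : 0 < β) (hβγ : β ≤ γ) (hx : 0 ≤ x) (hy : 0 ≤ y)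
  {ρ : ℝ} (hρ : R ≤ ρ) (ϑ : ℝ)
include h hβ hβγ hx hy hρ

theorem norm_lowerTerms_le : ‖lowerTerms β γ x y (logPt ρ ϑ)‖ ≤ 1 / 2 := by
  refine (norm_add_le _ _).trans (le_trans (add_le_add
    (norm_mul_negPow_le h.1 hρ hβ.le ϑ) (norm_mul_negPow_le h.1 hρ (by linarith) ϑ)) ?_)
  rw [abs_of_nonneg hx, abs_of_nonneg hy]
  exact h.2

omit hβγ in
theorem norm_one_add_le : ‖1 + (x : ℂ) * negPow β (logPt ρ ϑ)‖ ≤ 3 / 2 := by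
  have h1 := norm_mul_negPow_le (a := x) h.1 hρ hβ.le ϑ
  rw [abs_of_nonneg hx] at h1
  have h2 : 0 ≤ y * R ^ (-γ) := mul_nonneg hy (Real.rpow_nonneg h.1.le _)
  have h3 := norm_add_le (1 : ℂ) ((x : ℂ) * negPow β (logPt ρ ϑ))
  rw [norm_one] at h3
  linarith [h.2]

theorem half_le_norm_one_add_lowerTerms : 1 / 2 ≤ ‖1 + lowerTerms β γ x y (logPt ρ ϑ)‖ := by
  have h1 := norm_lowerTerms_le h hβ hβγ hx hy hρ ϑ
  have h2 := norm_sub_norm_le (1 : ℂ) (-lowerTerms β γ x y (logPt ρ ϑ))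
  rw [norm_neg, norm_one, sub_neg_eq_add] at h2
  linarith

theorem one_add_lowerTerms_ne_zero : 1 + lowerTerms β γ x y (logPt ρ ϑ) ≠ 0 := by
  rw [← norm_pos_iff]
  linarith [half_le_norm_one_add_lowerTerms h hβ hβγ hx hy hρ ϑ]

theorem norm_symbol_le : ‖symbol β γ x y (logPt ρ ϑ)‖ ≤ 3 := by
  have h1 := norm_one_add_le h hβ hx hy hρ ϑ
  have h2 := half_le_norm_one_add_lowerTerms h hβ hβγ hx hy hρ ϑ
  rw [symbol, norm_div, div_le_iff₀ (by linarith)]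
  linarith

theorem differentiableAt_symbol_of_large : DifferentiableAt ℂ (symbol β γ x y) (logPt ρ ϑ) := by
  unfold symbol
  refine DifferentiableAt.div ?_ ?_ (one_add_lowerTerms_ne_zero h hβ hβγ hx hy hρ ϑ)
  · exact (((differentiable_negPow β) _).const_mul _).const_add _
  · unfold lowerTerms
    exact ((((differentiable_negPow β) _).const_mul _).add
      (((differentiable_negPow γ) _).const_mul _)).const_add _

end Estimates

theorem differentiableAt_symbol {w : ℂ} (hw : 1 + lowerTerms β γ x y w ≠ 0) :
    DifferentiableAt ℂ (symbol β γ x y) w := by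
  unfold symbol
  refine DifferentiableAt.div ?_ ?_ hw
  · exact (((differentiable_negPow β) _).const_mul _).const_add _
  · unfold lowerTerms
    exact ((((differentiable_negPow β) _).const_mul _).add
      (((differentiable_negPow γ) _).const_mul _)).const_add _

theorem norm_hankelIntegral_sub_le {r ε C₁ C₂ : ℝ} (hr : 0 < r) (hε : 0 ≤ ε) {m₁ m₂ : ℂ → ℂ}
    (hc₁ : ∀ ρ ϑ : ℝ, r ≤ ρ → ϑ ∈ Icc (-Real.pi) Real.pi → ContinuousAt m₁ (logPt ρ ϑ))
    (hb₁ : ∀ ρ ϑ : ℝ, r ≤ ρ → ϑ ∈ Icc (-Real.pi) Real.pi → ‖m₁ (logPt ρ ϑ)‖ ≤ C₁)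
    (hc₂ : ∀ ρ ϑ : ℝ, r ≤ ρ → ϑ ∈ Icc (-Real.pi) Real.pi → ContinuousAt m₂ (logPt ρ ϑ))
    (hb₂ : ∀ ρ ϑ : ℝ, r ≤ ρ → ϑ ∈ Icc (-Real.pi) Real.pi → ‖m₂ (logPt ρ ϑ)‖ ≤ C₂)
    (h : ∀ ρ ϑ : ℝ, r ≤ ρ → ϑ ∈ Icc (-Real.pi) Real.pi →
      ‖m₁ (logPt ρ ϑ) - m₂ (logPt ρ ϑ)‖ ≤ ε) :
    ‖hankelIntegral r Real.pi (ofLog fun w => expDiv w * m₁ w)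
      - hankelIntegral r Real.pi (ofLog fun w => expDiv w * m₂ w)‖
      ≤ ε * hankelMass r Real.pi := by
  have hpi : Real.pi / 2 < Real.pi := by linarith [Real.pi_pos]
  have h1 := hankelIntegrable_expDiv_mul hr hpi le_rfl hc₁ hb₁
  have h2 := (hankelIntegrable_expDiv_mul hr hpi le_rfl hc₂ hb₂).const_mul (-1)
  have h3 := hankelIntegral_add h1 h2
  rw [hankelIntegral_const_mul] at h3
  have h4 := norm_hankelIntegral_expDiv_mul_le (m := fun w => m₁ w - m₂ w) hr hpi le_rfl hε h
  rw [sub_eq_add_neg, ← neg_one_mul, ← h3]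
  convert h4 using 3
  ext ρ ϑ
  simp only [ofLog]
  ring

/-- The Hankel integral `(2πi)⁻¹ ∫_Ha exp ξ / ξ · symbol dξ`. -/
def hankelSol (β γ x y : ℝ) : ℂ :=
  1 / (2 * (Real.pi : ℂ) * Complex.I) * hankelIntegral (largeRadius β (x + y)) Real.pi
    (ofLog fun w => expDiv w * symbol β γ x y w)

theorem norm_one_div_two_pi_I : ‖1 / (2 * (Real.pi : ℂ) * Complex.I)‖ = 1 / (2 * Real.pi) := by
  simp [abs_of_pos Real.pi_pos]

theorem hankelMass_nonneg {r θ : ℝ} (hr : 0 < r) (hθ : 0 ≤ θ) : 0 ≤ hankelMass r θ := by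
  have : 0 ≤ ∫ ρ in Ioi r, Real.exp (ρ * Real.cos θ) / ρ :=
    setIntegral_nonneg measurableSet_Ioi fun ρ hρ =>
      div_nonneg (Real.exp_pos _).le (hr.trans hρ).le
  unfold hankelMass
  positivity

/-! ### Independence of the radius, and continuity in the parameters -/

section Solution

variable (hβ : 0 < β) (hβγ : β ≤ γ)
include hβ hβγ

/-- The defining radius varies with `x + y`. Freedom of radius lets integrals with different
parameters be compared on one contour. -/
theorem hankelSol_eq (hx : 0 ≤ x) (hy : 0 ≤ y) (h : Large β γ x y R) :
    hankelSol β γ x y = 1 / (2 * (Real.pi : ℂ) * Complex.I) *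
      hankelIntegral R Real.pi (ofLog fun w => expDiv w * symbol β γ x y w) := by
  have key : ∀ R₁ R₂ : ℝ, Large β γ x y R₁ → R₁ ≤ R₂ →
      hankelIntegral R₁ Real.pi (ofLog fun w => expDiv w * symbol β γ x y w)
      = hankelIntegral R₂ Real.pi (ofLog fun w => expDiv w * symbol β γ x y w) := by
    intro R₁ R₂ h1 h12
    have h2 := h1.mono hβ hβγ hx hy h12
    refine (hankelIntegral_radius h1.1 h12 Real.pi_pos.le (fun ρ hρ ϑ _ =>
      (differentiable_expDiv _).mul
        (differentiableAt_symbol_of_large h1 hβ hβγ hx hy hρ.1 ϑ)) ?_).2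
    exact hankelIntegrable_expDiv_mul h2.1 (by linarith [Real.pi_pos]) le_rfl
      (fun ρ ϑ hρ _ => (differentiableAt_symbol_of_large h2 hβ hβγ hx hy hρ ϑ).continuousAt)
      (fun ρ ϑ hρ _ => norm_symbol_le h2 hβ hβγ hx hy hρ ϑ)
  have hL := large_largeRadius (M := x + y) hβ hβγ hx hy le_rfl
  unfold hankelSol
  congr 1
  rcases le_total (largeRadius β (x + y)) R with hle | hle
  · exact key _ _ hL hle
  · exact (key _ _ h hle).symm

/-- On a common contour the symbol is Lipschitz in `(x, y)`, uniformly in `ξ`, and `exp ξ / ξ` has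
finite mass there. -/
theorem continuousOn_hankelSol :
    ContinuousOn (fun p : ℝ × ℝ => hankelSol β γ p.1 p.2) (Ici 0 ×ˢ Ici 0) := by
  rintro ⟨x₀, y₀⟩ ⟨hx₀, hy₀⟩
  simp only [mem_Ici] at hx₀ hy₀
  -- The extra `1` makes this radius admissible for all nearby parameters as well.
  set R := largeRadius β (x₀ + y₀ + 1) with hRdef
  have hR0 : 0 < R := by linarith [one_le_largeRadius β (show 0 ≤ x₀ + y₀ + 1 by linarith)]
  have hL₀ : Large β γ x₀ y₀ R := large_largeRadius hβ hβγ hx₀ hy₀ (by linarith)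
  have hlim : Tendsto (fun p : ℝ × ℝ => 1 / (2 * Real.pi) *
      (6 * (2 * (|p.1 - x₀| * R ^ (-β)) + |p.2 - y₀| * R ^ (-γ)) * hankelMass R Real.pi))
      (𝓝[Ici 0 ×ˢ Ici 0] (x₀, y₀)) (𝓝 0) := by
    have hc : Continuous (fun p : ℝ × ℝ => 1 / (2 * Real.pi) *
      (6 * (2 * (|p.1 - x₀| * R ^ (-β)) + |p.2 - y₀| * R ^ (-γ)) * hankelMass R Real.pi)) := by
      fun_prop
    have := (hc.tendsto (x₀, y₀)).mono_left (nhdsWithin_le_nhds (s := Ici (0:ℝ) ×ˢ Ici (0:ℝ)))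
    simpa using this
  refine tendsto_iff_norm_sub_tendsto_zero.2 (squeeze_zero' (Eventually.of_forall fun _ =>
    norm_nonneg _) ?_ hlim)
  have hnear : ∀ᶠ p : ℝ × ℝ in 𝓝[Ici 0 ×ˢ Ici 0] (x₀, y₀), p.1 + p.2 < x₀ + y₀ + 1 :=
    nhdsWithin_le_nhds ((continuous_fst.add continuous_snd).tendsto (x₀, y₀)
      |>.eventually_lt_const (by simp))
  filter_upwards [hnear, self_mem_nhdsWithin] with p hp hp0
  obtain ⟨hx, hy⟩ := hp0
  simp only [mem_Ici] at hx hy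
  have hL : Large β γ p.1 p.2 R := large_largeRadius hβ hβγ hx hy hp.le
  rw [hankelSol_eq hβ hβγ hx hy hL, hankelSol_eq hβ hβγ hx₀ hy₀ hL₀, ← mul_sub, norm_mul,
    norm_one_div_two_pi_I]
  refine mul_le_mul_of_nonneg_left ?_ (by positivity)
  have hRβ : 0 < R ^ (-β) := Real.rpow_pos_of_pos hR0 _
  have hRγ : 0 < R ^ (-γ) := Real.rpow_pos_of_pos hR0 _
  refine norm_hankelIntegral_sub_le hR0 (by positivity)
    (fun ρ ϑ hρ _ => (differentiableAt_symbol_of_large hL hβ hβγ hx hy hρ ϑ).continuousAt)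
    (fun ρ ϑ hρ _ => norm_symbol_le hL hβ hβγ hx hy hρ ϑ)
    (fun ρ ϑ hρ _ => (differentiableAt_symbol_of_large hL₀ hβ hβγ hx₀ hy₀ hρ ϑ).continuousAt)
    (fun ρ ϑ hρ _ => norm_symbol_le hL₀ hβ hβγ hx₀ hy₀ hρ ϑ) fun ρ ϑ hρ _ => ?_
  have n1 := half_le_norm_one_add_lowerTerms hL hβ hβγ hx hy hρ ϑ
  have n2 := half_le_norm_one_add_lowerTerms hL₀ hβ hβγ hx₀ hy₀ hρ ϑ
  have z1 := one_add_lowerTerms_ne_zero hL hβ hβγ hx hy hρ ϑ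
  have z2 := one_add_lowerTerms_ne_zero hL₀ hβ hβγ hx₀ hy₀ hρ ϑ
  have a0 := norm_one_add_le hL₀ hβ hx₀ hy₀ hρ ϑ
  have l0 := norm_lowerTerms_le hL₀ hβ hβγ hx₀ hy₀ hρ ϑ
  have d1 := norm_mul_negPow_le (a := p.1 - x₀) hR0 hρ hβ.le ϑ
  have d2 := norm_mul_negPow_le (a := p.2 - y₀) hR0 hρ (hβ.le.trans hβγ) ϑ
  set w := logPt ρ ϑ
  set u := ((p.1 - x₀ : ℝ) : ℂ) * negPow β w with hu
  set v := ((p.2 - y₀ : ℝ) : ℂ) * negPow γ w with hv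
  -- The numerator is at most `(3/2)|u| + (3/2)(|u| + |v|)` and the denominator at least `1/4`,
  -- which gives the constant in `6 (2|u| + |v|)`.
  have e : symbol β γ p.1 p.2 w - symbol β γ x₀ y₀ w
      = (u * (1 + lowerTerms β γ x₀ y₀ w) - (1 + x₀ * negPow β w) * (u + v))
        / ((1 + lowerTerms β γ p.1 p.2 w) * (1 + lowerTerms β γ x₀ y₀ w)) := by
    rw [symbol, symbol, div_sub_div _ _ z1 z2, hu, hv]
    congr 1
    unfold lowerTerms
    push_cast
    ring
  rw [e, norm_div, norm_mul, div_le_iff₀ (by positivity)]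
  have b1 : ‖u * (1 + lowerTerms β γ x₀ y₀ w)‖ ≤ ‖u‖ * (3 / 2) := by
    rw [norm_mul]
    refine mul_le_mul_of_nonneg_left ?_ (norm_nonneg _)
    refine (norm_add_le _ _).trans ?_
    rw [norm_one]; linarith
  have b2 : ‖(1 + x₀ * negPow β w) * (u + v)‖ ≤ 3 / 2 * (‖u‖ + ‖v‖) := by
    rw [norm_mul]
    exact mul_le_mul a0 (norm_add_le _ _) (norm_nonneg _) (by norm_num)
  have b3 : (1 : ℝ) / 4 ≤ ‖1 + lowerTerms β γ p.1 p.2 w‖ * ‖1 + lowerTerms β γ x₀ y₀ w‖ := by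
    nlinarith
  have b4 := norm_sub_le (u * (1 + lowerTerms β γ x₀ y₀ w)) ((1 + x₀ * negPow β w) * (u + v))
  have b5 : 0 ≤ 6 * (2 * (|p.1 - x₀| * R ^ (-β)) + |p.2 - y₀| * R ^ (-γ)) := by positivity
  nlinarith [mul_le_mul_of_nonneg_left b3 b5]

end Solution

/-! ### The Volterra equation -/

/-- Finite linear combinations of the functions `t ^ p ξ ^ (-p)`, `p ≥ 0`. -/
inductive PowSum : (ℝ → ℂ → ℂ) → Prop
  | pow (p : ℝ) (hp : 0 ≤ p) : PowSum fun t w => ((t ^ p : ℝ) : ℂ) * negPow p w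
  | add {F G : ℝ → ℂ → ℂ} : PowSum F → PowSum G → PowSum fun t w => F t w + G t w
  | smul (c : ℂ) {F : ℝ → ℂ → ℂ} : PowSum F → PowSum fun t w => c * F t w
  -- Equality is required only for `t ≥ 0`, since `t^(p + q) = t^p t^q` may fail for negative `t`.
  | congr {F G : ℝ → ℂ → ℂ} : PowSum F → (∀ t, 0 ≤ t → ∀ w, F t w = G t w) → PowSum G

namespace PowSum

theorem one : PowSum fun _ _ => 1 := by
  simpa [negPow_zero] using PowSum.pow 0 le_rfl

theorem pow_mul {F : ℝ → ℂ → ℂ} (hF : PowSum F) {q : ℝ} (hq : 0 ≤ q) :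
    PowSum fun t w => ((t ^ q : ℝ) : ℂ) * negPow q w * F t w := by
  induction hF with
  | pow p hp =>
    refine (PowSum.pow (q + p) (by linarith)).congr fun t ht w => ?_
    rw [Real.rpow_add_of_nonneg ht hq hp, negPow_add]
    push_cast; ring
  | add _ _ h1 h2 => exact (h1.add h2).congr fun t _ w => by ring
  | smul c _ h => exact (h.smul c).congr fun t _ w => by ring
  | congr _ h h1 => exact h1.congr fun t ht w => by rw [h t ht w]

theorem mul {F G : ℝ → ℂ → ℂ} (hF : PowSum F) (hG : PowSum G) :
    PowSum fun t w => F t w * G t w := by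
  induction hF with
  | pow p hp => exact hG.pow_mul hp
  | add _ _ h1 h2 => exact (h1.add h2).congr fun t _ w => by ring
  | smul c _ h => exact (h.smul c).congr fun t _ w => by ring
  | congr _ h h1 => exact h1.congr fun t ht w => by rw [h t ht w]

theorem npow {F : ℝ → ℂ → ℂ} (hF : PowSum F) (n : ℕ) : PowSum fun t w => F t w ^ n := by
  induction n with
  | zero => simpa using one
  | succ n ih => exact (ih.mul hF).congr fun t _ w => (pow_succ _ _).symm

theorem sum_range {F : ℕ → ℝ → ℂ → ℂ} (hF : ∀ n, PowSum (F n)) (N : ℕ) :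
    PowSum fun t w => ∑ n ∈ Finset.range N, F n t w := by
  induction N with
  | zero => exact (one.smul 0).congr fun t _ w => by simp
  | succ N ih => exact (ih.add (hF N)).congr fun t _ w => (Finset.sum_range_succ _ _).symm

/-- The Hankel integral of `exp ξ / ξ · F(t, ξ)`. -/
def hankel (R : ℝ) (F : ℝ → ℂ → ℂ) (t : ℝ) : ℂ :=
  hankelIntegral R Real.pi (ofLog fun w => expDiv w * F t w)

theorem hankelIntegrable {F : ℝ → ℂ → ℂ} (hF : PowSum F) (hR : 0 < R) :
    ∀ t, 0 ≤ t → HankelIntegrable R Real.pi (ofLog fun w => expDiv w * F t w) := by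
  induction hF with
  | pow p hp =>
    intro t _
    convert (hankelIntegrable_expDivPow hR p).const_mul ((t ^ p : ℝ) : ℂ) using 1
    ext ρ ϑ
    simp only [ofLog, expDivPow, negPow]
    ring
  | add _ _ h1 h2 =>
    intro t ht
    convert (h1 t ht).add (h2 t ht) using 1
    ext ρ ϑ
    simp only [ofLog]
    ring
  | smul c _ h =>
    intro t ht
    convert (h t ht).const_mul c using 1
    ext ρ ϑ
    simp only [ofLog]
    ring
  | congr _ h h1 =>
    intro t ht
    convert h1 t ht using 1
    ext ρ ϑ
    simp only [ofLog, h t ht]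

/-- Up to the factor `2πi` this is the inverse Laplace transform of `s^(-p-1)`, after the
substitution `ξ = t s`. -/
theorem hankel_pow (hR : 0 < R) {p : ℝ} (hp : 0 ≤ p) (t : ℝ) :
    hankel R (fun t w => ((t ^ p : ℝ) : ℂ) * negPow p w) t
      = 2 * Real.pi * Complex.I * ((t ^ p / Real.Gamma (p + 1) : ℝ) : ℂ) := by
  have h : hankel R (fun t w => ((t ^ p : ℝ) : ℂ) * negPow p w) t
      = ((t ^ p : ℝ) : ℂ) * hankelIntegral R Real.pi (ofLog (expDivPow p)) := by
    rw [← hankelIntegral_const_mul, hankel]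
    congr 1
    ext ρ ϑ
    simp only [ofLog, expDivPow, negPow]
    ring
  rw [h, hankelIntegral_expDivPow hR (by linarith)]
  push_cast
  ring

theorem hankel_add {F G : ℝ → ℂ → ℂ} (hF : PowSum F) (hG : PowSum G) (hR : 0 < R) {t : ℝ}
    (ht : 0 ≤ t) : hankel R (fun t w => F t w + G t w) t = hankel R F t + hankel R G t := by
  rw [hankel, hankel, hankel, ← hankelIntegral_add (hF.hankelIntegrable hR t ht)
    (hG.hankelIntegrable hR t ht)]
  congr 1
  ext ρ ϑ
  simp only [ofLog]
  ring

theorem hankel_smul (R : ℝ) (c : ℂ) (F : ℝ → ℂ → ℂ) (t : ℝ) :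
    hankel R (fun t w => c * F t w) t = c * hankel R F t := by
  rw [hankel, hankel, ← hankelIntegral_const_mul]
  congr 1
  ext ρ ϑ
  simp only [ofLog]
  ring

theorem hankel_congr (R : ℝ) {F G : ℝ → ℂ → ℂ} {t : ℝ} (h : ∀ w, F t w = G t w) :
    hankel R F t = hankel R G t := by
  rw [hankel, hankel]
  simp only [h]

theorem continuousOn_hankel {F : ℝ → ℂ → ℂ} (hF : PowSum F) (hR : 0 < R) :
    ContinuousOn (hankel R F) (Ici 0) := by
  induction hF with
  | pow p hp =>
    refine ContinuousOn.congr ?_ fun t _ => hankel_pow hR hp t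
    refine continuousOn_const.mul (Complex.continuous_ofReal.comp_continuousOn ?_)
    exact ((Real.continuous_rpow_const hp).div_const _).continuousOn
  | add h1 h2 c1 c2 => exact (c1.add c2).congr fun t ht => hankel_add h1 h2 hR ht
  | smul c _ h => exact (continuousOn_const.mul h).congr fun t _ => hankel_smul R c _ t
  | congr _ h h1 => exact h1.congr fun t ht => hankel_congr R fun w => (h t ht w).symm

/-- Under the Hankel integral, `J ^ δ` is multiplication by `t ^ δ ξ ^ (-δ)`. -/
theorem fracInt_hankel {F : ℝ → ℂ → ℂ} (hF : PowSum F) (hR : 0 < R) {δ : ℝ} (hδ : 0 < δ) :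
    ∀ t, 0 ≤ t → fracInt δ (hankel R F) t
      = hankel R (fun t w => ((t ^ δ : ℝ) : ℂ) * negPow δ w * F t w) t := by
  have hcon : ∀ {G : ℝ → ℂ → ℂ}, PowSum G → ∀ {t : ℝ}, 0 ≤ t →
      ContinuousOn (hankel R G) (uIcc 0 t) := fun hG t ht =>
    (hG.continuousOn_hankel hR).mono (by rw [uIcc_of_le ht]; exact Icc_subset_Ici_self)
  induction hF with
  | pow p hp =>
    intro t ht
    rw [fracInt_congr ht fun τ _ => hankel_pow hR hp τ, fracInt_const_mul, fracInt_rpow hδ hp ht,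
      ← hankel_pow hR (by linarith : 0 ≤ p + δ)]
    refine hankel_congr R fun w => ?_
    rw [Real.rpow_add_of_nonneg ht hp hδ.le, negPow_add]
    push_cast; ring
  | add h1 h2 i1 i2 =>
    intro t ht
    rw [fracInt_congr ht fun τ hτ => hankel_add h1 h2 hR hτ.1.le,
      fracInt_add hδ (hcon h1 ht) (hcon h2 ht), i1 t ht, i2 t ht,
      ← hankel_add (h1.pow_mul hδ.le) (h2.pow_mul hδ.le) hR ht]
    exact hankel_congr R fun w => by ring
  | smul c _ h =>
    intro t ht
    rw [fracInt_congr ht fun τ _ => hankel_smul R c _ τ, fracInt_const_mul, h t ht,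
      ← hankel_smul]
    exact hankel_congr R fun w => by ring
  | congr _ h h1 =>
    intro t ht
    rw [← fracInt_congr ht fun τ hτ => hankel_congr R fun w => h τ hτ.1.le w, h1 t ht]
    exact hankel_congr R fun w => by rw [h t ht w]

end PowSum

theorem continuousOn_hankelSol_time (hβ : 0 < β) (hβγ : β ≤ γ) {a b : ℝ} (ha : 0 ≤ a)
    (hb : 0 ≤ b) : ContinuousOn (fun t => hankelSol β γ (a * t ^ β) (b * t ^ γ)) (Ici 0) := by
  refine (continuousOn_hankelSol hβ hβγ).comp (f := fun t : ℝ => (a * t ^ β, b * t ^ γ)) ?_ ?_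
  · exact ((continuous_const.mul (Real.continuous_rpow_const hβ.le)).prodMk
      (continuous_const.mul (Real.continuous_rpow_const (hβ.le.trans hβγ)))).continuousOn
  · intro t ht
    have : 0 ≤ t := ht
    exact ⟨mem_Ici.2 (by positivity), mem_Ici.2 (by positivity)⟩

/-- The Volterra equation satisfied by the Hankel integral as a function of time. -/
theorem hankelSol_volterra (hβ : 0 < β) (hβγ : β ≤ γ) {a b t : ℝ} (ha : 0 ≤ a) (hb : 0 ≤ b)
    (ht : 0 ≤ t) :
    hankelSol β γ (a * t ^ β) (b * t ^ γ)
      + a * fracInt β (fun s => hankelSol β γ (a * s ^ β) (b * s ^ γ)) t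
      + b * fracInt γ (fun s => hankelSol β γ (a * s ^ β) (b * s ^ γ)) t
      = 1 + a * ((t ^ β / Real.Gamma (β + 1) : ℝ) : ℂ) := by
  have hγ : 0 < γ := hβ.trans_le hβγ
  set h : ℝ → ℂ := fun s => hankelSol β γ (a * s ^ β) (b * s ^ γ) with hh
  -- The reduced variables increase with time, so the radius chosen for the final time `t` serves
  -- all `s ≤ t`.
  set R := largeRadius β (a * t ^ β + b * t ^ γ) with hR
  have hLt : Large β γ (a * t ^ β) (b * t ^ γ) R :=
    large_largeRadius hβ hβγ (by positivity) (by positivity) le_rfl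
  have hR0 : 0 < R := hLt.1
  have hx : ∀ s, 0 ≤ s → 0 ≤ a * s ^ β := fun s hs => by positivity
  have hy : ∀ s, 0 ≤ s → 0 ≤ b * s ^ γ := fun s hs => by positivity
  have hL : ∀ s, 0 ≤ s → s ≤ t → Large β γ (a * s ^ β) (b * s ^ γ) R := fun s hs hst =>
    hLt.mono_arg (mul_le_mul_of_nonneg_left (Real.rpow_le_rpow hs hst hβ.le) ha)
      (mul_le_mul_of_nonneg_left (Real.rpow_le_rpow hs hst hγ.le) hb)
  set X : ℝ → ℂ → ℂ := fun s w => lowerTerms β γ (a * s ^ β) (b * s ^ γ) w with hX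
  set A : ℝ → ℂ → ℂ := fun s w => 1 + ((a * s ^ β : ℝ) : ℂ) * negPow β w with hA
  -- Truncated Neumann series of `A / (1 + X)`, with remainder `T N / (1 + X)`. Both `S N` and `T N`
  -- are finite sums of monomials `t^p ξ^(-p)`, for which the action of `J^δ` is known.
  set S : ℕ → ℝ → ℂ → ℂ := fun N s w => A s w * ∑ n ∈ Finset.range N, (-X s w) ^ n with hS
  set T : ℕ → ℝ → ℂ → ℂ := fun N s w => A s w * (-X s w) ^ N with hT
  set c₀ : ℂ := 1 / (2 * (Real.pi : ℂ) * Complex.I) with hc₀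
  have pA : PowSum A := by
    refine (PowSum.one.add ((PowSum.pow β hβ.le).smul a)).congr fun s _ w => ?_
    simp only [hA]; push_cast; ring
  have pX : PowSum fun s w => -X s w := by
    refine (((PowSum.pow β hβ.le).smul (-a)).add ((PowSum.pow γ hγ.le).smul (-b))).congr
      fun s _ w => ?_
    simp only [hX, lowerTerms]; push_cast; ring
  have pS : ∀ N, PowSum (S N) := fun N => pA.mul (PowSum.sum_range (fun n => pX.npow n) N)
  have pT : ∀ N, PowSum (T N) := fun N => pA.mul (pX.npow N)
  have geom : ∀ N s w, S N s w * (1 + X s w) = A s w - T N s w := by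
    intro N s w
    have := geom_sum_mul (-X s w) N
    simp only [hS, hT]
    linear_combination (-(A s w)) * this
  have hc₀n : ‖c₀‖ = 1 / (2 * Real.pi) := norm_one_div_two_pi_I
  have hmass : 0 ≤ hankelMass R Real.pi := hankelMass_nonneg hR0 Real.pi_pos.le
  have hTn : ∀ N s, 0 ≤ s → s ≤ t → ∀ ρ ϑ : ℝ, R ≤ ρ → ϑ ∈ Icc (-Real.pi) Real.pi →
      ‖T N s (logPt ρ ϑ)‖ ≤ 3 / 2 * (1 / 2) ^ N := by
    intro N s hs hst ρ ϑ hρ _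
    simp only [hT, norm_mul, norm_pow, norm_neg]
    exact mul_le_mul (norm_one_add_le (hL s hs hst) hβ (hx s hs) (hy s hs) hρ ϑ)
      (pow_le_pow_left₀ (norm_nonneg _)
        (norm_lowerTerms_le (hL s hs hst) hβ hβγ (hx s hs) (hy s hs) hρ ϑ) N)
      (by positivity) (by norm_num)
  have hsymS : ∀ N s, 0 ≤ s → s ≤ t → ∀ ρ ϑ : ℝ, R ≤ ρ →
      symbol β γ (a * s ^ β) (b * s ^ γ) (logPt ρ ϑ) - S N s (logPt ρ ϑ)
        = T N s (logPt ρ ϑ) / (1 + X s (logPt ρ ϑ)) := by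
    intro N s hs hst ρ ϑ hρ
    have hne := one_add_lowerTerms_ne_zero (hL s hs hst) hβ hβγ (hx s hs) (hy s hs) hρ ϑ
    rw [eq_div_iff hne, sub_mul, geom N s, symbol, div_mul_cancel₀ _ hne]
    simp only [hA]; ring
  have hdiffn : ∀ N s, 0 ≤ s → s ≤ t → ∀ ρ ϑ : ℝ, R ≤ ρ → ϑ ∈ Icc (-Real.pi) Real.pi →
      ‖symbol β γ (a * s ^ β) (b * s ^ γ) (logPt ρ ϑ) - S N s (logPt ρ ϑ)‖
        ≤ 3 * (1 / 2) ^ N := by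
    intro N s hs hst ρ ϑ hρ hϑ
    have h1 := half_le_norm_one_add_lowerTerms (hL s hs hst) hβ hβγ (hx s hs) (hy s hs) hρ ϑ
    have h2 := hTn N s hs hst ρ ϑ hρ hϑ
    rw [hsymS N s hs hst ρ ϑ hρ, norm_div, div_le_iff₀ (by linarith)]
    have h3 : (0 : ℝ) < (1 / 2) ^ N := by positivity
    nlinarith
  have hSc : ∀ N s w, ContinuousAt (S N s) w := by
    intro N s w
    have e1 : Continuous (A s) := by
      simp only [hA]
      exact continuous_const.add (continuous_const.mul (differentiable_negPow β).continuous)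
    have e2 : Continuous (X s) := by
      simp only [hX]
      unfold lowerTerms
      exact (continuous_const.mul (differentiable_negPow β).continuous).add
        (continuous_const.mul (differentiable_negPow γ).continuous)
    exact (e1.mul (continuous_finsetSum _ fun n _ => (e2.neg.pow n))).continuousAt
  set ε : ℕ → ℝ := fun N => 1 / (2 * Real.pi) * (3 * (1 / 2) ^ N * hankelMass R Real.pi) with hε
  have hε0 : ∀ N, 0 ≤ ε N := fun N => by have := Real.pi_pos; positivity
  have hdiff : ∀ N s, 0 ≤ s → s ≤ t → ‖h s - c₀ * PowSum.hankel R (S N) s‖ ≤ ε N := by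
    intro N s hs hst
    simp only [hh]
    rw [hankelSol_eq hβ hβγ (hx s hs) (hy s hs) (hL s hs hst), PowSum.hankel, ← mul_sub, norm_mul,
      norm_one_div_two_pi_I]
    refine mul_le_mul_of_nonneg_left ?_ (by positivity)
    refine norm_hankelIntegral_sub_le (C₁ := 3) (C₂ := 3 * (1 / 2) ^ N + 3) hR0 (by positivity)
      (fun ρ ϑ hρ _ => (differentiableAt_symbol_of_large (hL s hs hst) hβ hβγ (hx s hs)
        (hy s hs) hρ ϑ).continuousAt)
      (fun ρ ϑ hρ _ => norm_symbol_le (hL s hs hst) hβ hβγ (hx s hs) (hy s hs) hρ ϑ)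
      (fun ρ ϑ _ _ => hSc N s _) (fun ρ ϑ hρ hϑ => ?_) (hdiffn N s hs hst)
    have h1 := hdiffn N s hs hst ρ ϑ hρ hϑ
    have h2 := norm_symbol_le (hL s hs hst) hβ hβγ (hx s hs) (hy s hs) hρ ϑ
    have h3 := norm_sub_norm_le (S N s (logPt ρ ϑ))
      (symbol β γ (a * s ^ β) (b * s ^ γ) (logPt ρ ϑ))
    rw [norm_sub_rev] at h3
    linarith
  have hcont : ContinuousOn h (uIcc 0 t) :=
    (continuousOn_hankelSol_time hβ hβγ ha hb).mono
      (by rw [uIcc_of_le ht]; exact Icc_subset_Ici_self)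
  have hcontS : ∀ N, ContinuousOn (fun s => c₀ * PowSum.hankel R (S N) s) (uIcc 0 t) := fun N =>
    continuousOn_const.mul (((pS N).continuousOn_hankel hR0).mono
      (by rw [uIcc_of_le ht]; exact Icc_subset_Ici_self))
  have hJ : ∀ N δ, 0 < δ →
      ‖fracInt δ h t - c₀ * PowSum.hankel R (fun s w => ((s ^ δ : ℝ) : ℂ) * negPow δ w * S N s w) t‖
        ≤ ε N * Real.exp t := by
    intro N δ hδ
    rw [← (pS N).fracInt_hankel hR0 hδ t ht, ← fracInt_const_mul,
      ← fracInt_sub hδ hcont (hcontS N)]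
    -- With the weight `exp τ ≥ 1` the uniform error `ε N` yields the error `ε N · exp t` after
    -- fractional integration.
    have := norm_fracInt_le (γ := δ) (l := 1) (B := ε N) hδ one_pos (hε0 N) ht
      (f := fun τ => h τ - c₀ * PowSum.hankel R (S N) τ) fun τ hτ => ?_
    · simpa using this
    · refine (hdiff N τ hτ.1.le hτ.2).trans ?_
      rw [one_mul]
      exact le_mul_of_one_le_right (hε0 N) (Real.one_le_exp hτ.1.le)
  have hsum : ∀ N, PowSum.hankel R (S N) t
      + a * PowSum.hankel R (fun s w => ((s ^ β : ℝ) : ℂ) * negPow β w * S N s w) t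
      + b * PowSum.hankel R (fun s w => ((s ^ γ : ℝ) : ℂ) * negPow γ w * S N s w) t
      = PowSum.hankel R A t - PowSum.hankel R (T N) t := by
    intro N
    rw [← PowSum.hankel_smul, ← PowSum.hankel_smul,
      ← PowSum.hankel_add (pS N) (((pS N).pow_mul hβ.le).smul _) hR0 ht,
      ← PowSum.hankel_add ((pS N).add (((pS N).pow_mul hβ.le).smul _))
        (((pS N).pow_mul hγ.le).smul _) hR0 ht, eq_sub_iff_add_eq,
      ← PowSum.hankel_add (((pS N).add (((pS N).pow_mul hβ.le).smul _)).add
        (((pS N).pow_mul hγ.le).smul _)) (pT N) hR0 ht]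
    refine PowSum.hankel_congr R fun w => ?_
    have := geom N t w
    have e : X t w = a * (((t ^ β : ℝ) : ℂ) * negPow β w) + b * (((t ^ γ : ℝ) : ℂ) * negPow γ w) := by
      simp only [hX, lowerTerms]; push_cast; ring
    rw [e] at this
    linear_combination this
  have hAval : c₀ * PowSum.hankel R A t = 1 + a * ((t ^ β / Real.Gamma (β + 1) : ℝ) : ℂ) := by
    have e : PowSum.hankel R A t = PowSum.hankel R (fun s w =>
        ((s ^ (0 : ℝ) : ℝ) : ℂ) * negPow 0 w + a * (((s ^ β : ℝ) : ℂ) * negPow β w)) t := by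
      refine PowSum.hankel_congr R fun w => ?_
      simp only [hA, negPow_zero, Real.rpow_zero]; push_cast; ring
    rw [e, PowSum.hankel_add (PowSum.pow 0 le_rfl) ((PowSum.pow β hβ.le).smul _) hR0 ht,
      PowSum.hankel_smul, PowSum.hankel_pow hR0 le_rfl, PowSum.hankel_pow hR0 hβ.le, hc₀]
    have hpi : (Real.pi : ℂ) ≠ 0 := by exact_mod_cast Real.pi_ne_zero
    simp
    field_simp
    rw [Complex.I_sq]
    ring
  have hTh : ∀ N, ‖c₀ * PowSum.hankel R (T N) t‖ ≤ ε N := by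
    intro N
    rw [norm_mul, hc₀n]
    refine mul_le_mul_of_nonneg_left ?_ (by have := Real.pi_pos; positivity)
    have := norm_hankelIntegral_expDiv_mul_le (m := T N t) hR0 (by linarith [Real.pi_pos]) le_rfl
      (by positivity) (hTn N t ht le_rfl)
    refine this.trans (mul_le_mul_of_nonneg_right ?_ hmass)
    have : (0 : ℝ) < (1 / 2) ^ N := by positivity
    linarith
  -- The left side is independent of `N`, while every error on the right is a multiple of `2^(-N)`;
  -- letting `N → ∞` gives the equation.
  have hbound : ∀ N, ‖h t + a * fracInt β h t + b * fracInt γ h t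
      - (1 + a * ((t ^ β / Real.Gamma (β + 1) : ℝ) : ℂ))‖
      ≤ ε N + a * (ε N * Real.exp t) + b * (ε N * Real.exp t) + ε N := by
    intro N
    have e : h t + a * fracInt β h t + b * fracInt γ h t
        - (1 + a * ((t ^ β / Real.Gamma (β + 1) : ℝ) : ℂ))
        = (h t - c₀ * PowSum.hankel R (S N) t)
          + a * (fracInt β h t - c₀ * PowSum.hankel R
            (fun s w => ((s ^ β : ℝ) : ℂ) * negPow β w * S N s w) t)
          + b * (fracInt γ h t - c₀ * PowSum.hankel R
            (fun s w => ((s ^ γ : ℝ) : ℂ) * negPow γ w * S N s w) t)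
          - c₀ * PowSum.hankel R (T N) t := by
      rw [← hAval]
      linear_combination c₀ * hsum N
    rw [e]
    refine (norm_sub_le _ _).trans (add_le_add ?_ (hTh N))
    refine norm_add₃_le.trans (add_le_add (add_le_add (hdiff N t ht le_rfl) ?_) ?_)
    · rw [norm_mul, Complex.norm_real, Real.norm_of_nonneg ha]
      exact mul_le_mul_of_nonneg_left (hJ N β hβ) ha
    · rw [norm_mul, Complex.norm_real, Real.norm_of_nonneg hb]
      exact mul_le_mul_of_nonneg_left (hJ N γ hγ) hb
  have hεlim : Tendsto ε atTop (𝓝 0) := by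
    have h1 : Tendsto (fun N : ℕ => ((1 : ℝ) / 2) ^ N) atTop (𝓝 0) :=
      tendsto_pow_atTop_nhds_zero_of_lt_one (by norm_num) (by norm_num)
    have h2 := ((h1.const_mul 3).mul_const (hankelMass R Real.pi)).const_mul (1 / (2 * Real.pi))
    simp only [mul_zero, zero_mul] at h2
    exact h2
  have hlim : Tendsto (fun N => ε N + a * (ε N * Real.exp t) + b * (ε N * Real.exp t) + ε N)
      atTop (𝓝 0) := by
    simpa using ((hεlim.add ((hεlim.mul_const (Real.exp t)).const_mul a)).add
      ((hεlim.mul_const (Real.exp t)).const_mul b)).add hεlim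
  have := ge_of_tendsto' hlim hbound
  exact sub_eq_zero.1 (norm_le_zero_iff.1 this)

/-! ### Polynomial growth in the frequency -/

section Growth

variable {α : ℝ}

theorem cos_mul_nonneg {p ϑ : ℝ} (hp : |p| ≤ 1) (hϑ : ϑ ∈ Icc (-(Real.pi / 2)) (Real.pi / 2)) :
    0 ≤ Real.cos (p * ϑ) := by
  have h1 : |p * ϑ| ≤ Real.pi / 2 := by
    rw [abs_mul]
    calc |p| * |ϑ| ≤ 1 * (Real.pi / 2) :=
          mul_le_mul hp (abs_le.2 hϑ) (abs_nonneg _) zero_le_one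
      _ = _ := one_mul _
  exact Real.cos_nonneg_of_mem_Icc (abs_le.1 h1)

theorem sin_le_cos_mul {ϑ : ℝ} (hα : 0 < α) (hα1 : α ≤ 1)
    (hϑ : ϑ ∈ Icc (-(Real.pi / 2)) (Real.pi / 2)) :
    Real.sin (α * (Real.pi / 2)) ≤ Real.cos ((α - 1) * ϑ) := by
  have hpi := Real.pi_pos
  rw [← Real.cos_pi_div_two_sub, ← Real.cos_abs ((α - 1) * ϑ)]
  have h1 : |(α - 1) * ϑ| ≤ Real.pi / 2 - α * (Real.pi / 2) := by
    rw [abs_mul, abs_of_nonpos (by linarith)]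
    have h2 := mul_le_mul_of_nonneg_left (abs_le.2 hϑ) (by linarith : 0 ≤ -(α - 1))
    linarith
  have h3 : 0 < α * (Real.pi / 2) := by positivity
  exact Real.cos_le_cos_of_nonneg_of_le_pi (abs_nonneg _) (by linarith) h1

theorem negPow_logPt_re {ρ : ℝ} (hρ : 0 < ρ) (p ϑ : ℝ) :
    (negPow (-p) (logPt ρ ϑ)).re = ρ ^ p * Real.cos (p * ϑ) := by
  rw [negPow, neg_neg, exp_mul_logPt hρ, polarPow, Complex.re_ofReal_mul, mul_comm Complex.I,
    ← Complex.ofReal_mul, Complex.exp_ofReal_mul_I_re]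

/-- In the closed right half-plane the denominator is bounded below. -/
theorem le_norm_one_add_lowerTerms (hα : 0 < α) (hα1 : α ≤ 1) (h1 : 1 < α + β)
    (h2 : α + β ≤ 2) (hx : 0 ≤ x) (hy : 0 ≤ y) {ρ ϑ : ℝ} (hρ : 0 < ρ)
    (hϑ : ϑ ∈ Icc (-(Real.pi / 2)) (Real.pi / 2)) :
    x * Real.sin (α * (Real.pi / 2)) * ρ ^ (-β)
      ≤ ‖1 + lowerTerms β (α + β) x y (logPt ρ ϑ)‖ := by
  set w := logPt ρ ϑ with hw
  -- Multiplication by `ξ^(α+β-1)` brings the three exponents to `α+β-1`, `α-1` and `-1`, all in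
  -- `[-1, 1]`. For `|arg ξ| ≤ π/2` every term then has nonnegative real part, and the middle one
  -- alone provides the lower bound.
  have e : (1 + lowerTerms β (α + β) x y w) * negPow (-(α + β - 1)) w
      = negPow (-(α + β - 1)) w + x * negPow (-(α - 1)) w + y * negPow (-(-1)) w := by
    have e1 : negPow (-(α - 1)) w = negPow β w * negPow (-(α + β - 1)) w := by
      rw [← negPow_add]; congr 1; ring
    have e2 : negPow (-(-1)) w = negPow (α + β) w * negPow (-(α + β - 1)) w := by
      rw [← negPow_add]; congr 1; ring
    rw [e1, e2, lowerTerms]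
    ring
  have hre : x * (ρ ^ (α - 1) * Real.sin (α * (Real.pi / 2)))
      ≤ ((1 + lowerTerms β (α + β) x y w) * negPow (-(α + β - 1)) w).re := by
    rw [e, Complex.add_re, Complex.add_re, Complex.re_ofReal_mul, Complex.re_ofReal_mul, hw,
      negPow_logPt_re hρ, negPow_logPt_re hρ, negPow_logPt_re hρ]
    have c1 : 0 ≤ ρ ^ (α + β - 1) * Real.cos ((α + β - 1) * ϑ) :=
      mul_nonneg (Real.rpow_nonneg hρ.le _)
        (cos_mul_nonneg (abs_le.2 ⟨by linarith, by linarith⟩) hϑ)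
    have c2 : 0 ≤ y * (ρ ^ (-1 : ℝ) * Real.cos (-1 * ϑ)) :=
      mul_nonneg hy (mul_nonneg (Real.rpow_nonneg hρ.le _) (cos_mul_nonneg (by simp) hϑ))
    have c3 : x * (ρ ^ (α - 1) * Real.sin (α * (Real.pi / 2)))
        ≤ x * (ρ ^ (α - 1) * Real.cos ((α - 1) * ϑ)) :=
      mul_le_mul_of_nonneg_left (mul_le_mul_of_nonneg_left (sin_le_cos_mul hα hα1 hϑ)
        (Real.rpow_nonneg hρ.le _)) hx
    linarith
  have hn := hre.trans (Complex.re_le_norm _)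
  rw [norm_mul, hw, norm_negPow hρ, neg_neg] at hn
  have hp : 0 < ρ ^ (α + β - 1) := Real.rpow_pos_of_pos hρ _
  refine le_of_mul_le_mul_right (le_of_eq_of_le ?_ hn) hp
  rw [show α - 1 = -β + (α + β - 1) by ring, Real.rpow_add hρ]
  ring

/-- The bound does not involve `y`, hence not the frequency. Positivity of `x` both excludes zeros
in the right half-plane and keeps the quotient finite. -/
theorem norm_symbol_le_right (hα : 0 < α) (hα1 : α ≤ 1) (h1 : 1 < α + β)
    (h2 : α + β ≤ 2) (hx : 0 < x) (hy : 0 ≤ y) {ρ ϑ : ℝ} (hρ : 0 < ρ)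
    (hϑ : ϑ ∈ Icc (-(Real.pi / 2)) (Real.pi / 2)) :
    1 + lowerTerms β (α + β) x y (logPt ρ ϑ) ≠ 0 ∧
    ‖symbol β (α + β) x y (logPt ρ ϑ)‖ ≤ (ρ ^ β + x) / (x * Real.sin (α * (Real.pi / 2))) := by
  have h := le_norm_one_add_lowerTerms hα hα1 h1 h2 hx.le hy hρ hϑ
  have hpi := Real.pi_pos
  have hs : 0 < Real.sin (α * (Real.pi / 2)) :=
    Real.sin_pos_of_pos_of_lt_pi (by positivity) (by nlinarith)
  have hρβ : 0 < ρ ^ (-β) := Real.rpow_pos_of_pos hρ _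
  have hpos : 0 < x * Real.sin (α * (Real.pi / 2)) * ρ ^ (-β) := by positivity
  refine ⟨norm_pos_iff.1 (hpos.trans_le h), ?_⟩
  have hnum : ‖1 + (x : ℂ) * negPow β (logPt ρ ϑ)‖ ≤ 1 + x * ρ ^ (-β) := by
    refine (norm_add_le _ _).trans_eq ?_
    rw [norm_one, norm_mul, norm_negPow hρ, Complex.norm_real, Real.norm_of_nonneg hx.le]
  rw [symbol, norm_div]
  calc _ ≤ (1 + x * ρ ^ (-β)) / (x * Real.sin (α * (Real.pi / 2)) * ρ ^ (-β)) :=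
        div_le_div₀ (by positivity) hnum hpos h
    _ = _ := by
      rw [Real.rpow_neg hρ.le]
      have : 0 < ρ ^ β := Real.rpow_pos_of_pos hρ _
      field_simp

/-- On the imaginary axis `|exp ξ| = 1`, and `1 / |ξ| ≤ 1` outside the unit disc. -/
theorem norm_segment_expDiv_le {m : ℂ → ℂ} {C r R ϑ : ℝ} (hr : 1 ≤ r) (hrR : r ≤ R)
    (hϑ : Real.cos ϑ = 0) (hb : ∀ ρ ∈ Icc r R, ‖m (logPt ρ ϑ)‖ ≤ C) :
    ‖∫ ρ in r..R, ofLog (fun w => expDiv w * m w) ρ ϑ * Complex.exp (Complex.I * ϑ)‖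
      ≤ C * (R - r) := by
  have h := intervalIntegral.norm_integral_le_of_norm_le_const (a := r) (b := R) (C := C)
    (f := fun ρ => ofLog (fun w => expDiv w * m w) ρ ϑ * Complex.exp (Complex.I * ϑ)) ?_
  · rwa [abs_of_nonneg (by linarith)] at h
  · intro ρ hρ
    rw [uIoc_of_le hrR] at hρ
    have h0 : 1 ≤ ρ := hr.trans hρ.1.le
    rw [ofLog, norm_mul, norm_mul, norm_exp_I_mul, norm_expDiv (by linarith), hϑ, mul_zero,
      Real.exp_zero, mul_one]
    calc 1 / ρ * ‖m (logPt ρ ϑ)‖ ≤ 1 * C :=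
          mul_le_mul ((div_le_one (by linarith)).2 h0) (hb ρ ⟨hρ.1.le, hρ.2⟩) (norm_nonneg _)
            zero_le_one
      _ = C := one_mul C

/-- The bound for the Hankel integral obtained by moving the central part of the contour to the
imaginary axis. -/
theorem norm_hankelSol_le (hα : 0 < α) (hα1 : α ≤ 1) (h1 : 1 < α + β)
    (h2 : α + β ≤ 2) (hx : 0 < x) :
    ∃ C : ℝ, ∀ y : ℝ, 0 ≤ y → ‖hankelSol β (α + β) x y‖
      ≤ C * largeRadius β (x + y) ^ 3 := by
  have hpi := Real.pi_pos
  have hβ : 0 < β := by linarith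
  have hs : 0 < Real.sin (α * (Real.pi / 2)) :=
    Real.sin_pos_of_pos_of_lt_pi (by positivity) (by nlinarith)
  set I₁ : ℝ := ∫ ρ in Ioi 1, Real.exp (ρ * Real.cos Real.pi) / ρ with hI₁
  set q : ℝ := x * Real.sin (α * (Real.pi / 2)) with hq
  have hq0 : 0 < q := by positivity
  have hI₁0 : 0 ≤ I₁ := setIntegral_nonneg measurableSet_Ioi fun ρ hρ =>
    div_nonneg (Real.exp_pos _).le (zero_lt_one.trans hρ).le
  -- The summands belong to the two rays, the two arcs in the left half-plane, the unit half-circle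
  -- and the two imaginary segments.
  refine ⟨1 / (2 * Real.pi) *
    (6 * I₁ + 3 * Real.pi + (1 + x) / q * Real.exp 1 * Real.pi + 2 * ((1 + x) / q)),
    fun y hy => ?_⟩
  set R := largeRadius β (x + y) with hR
  have hR1 : 1 ≤ R := one_le_largeRadius β (by linarith)
  have hR0 : 0 < R := by linarith
  have hL : Large β (α + β) x y R := large_largeRadius hβ (by linarith) hx.le hy le_rfl
  set m := symbol β (α + β) x y with hm
  have hb : ∀ ρ ϑ : ℝ, R ≤ ρ → ‖m (logPt ρ ϑ)‖ ≤ 3 := fun ρ ϑ hρ =>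
    norm_symbol_le hL hβ (by linarith) hx.le hy hρ ϑ
  -- Here `β ≤ 2`, because `α > 0` and `α + β ≤ 2`. One more power of `R` comes from the length of
  -- the segments, hence the cube.
  have hRβ : R ^ β ≤ R ^ 2 := by
    rw [← Real.rpow_natCast R 2]
    exact Real.rpow_le_rpow_of_exponent_le hR1 (by push_cast; linarith)
  have hR23 : R ^ 2 ≤ R ^ 3 := pow_le_pow_right₀ hR1 (by norm_num)
  have hR3 : 1 ≤ R ^ 3 := one_le_pow₀ hR1
  have hray : ∀ ϑ : ℝ, Real.cos ϑ = Real.cos Real.pi →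
      ‖∫ ρ in Ioi R, ofLog (fun w => expDiv w * m w) ρ ϑ * Complex.exp (Complex.I * ϑ)‖
        ≤ 3 * I₁ := by
    intro ϑ hϑ
    refine (norm_ray_expDiv_le hR0 (by rw [hϑ, Real.cos_pi]; norm_num)
      fun ρ hρ => hb ρ ϑ hρ).trans ?_
    refine mul_le_mul_of_nonneg_left ?_ (by norm_num)
    rw [hϑ]
    refine setIntegral_mono_set (integrableOn_exp_mul_div (by simp) one_pos) ?_
      (Ioi_subset_Ioi hR1).eventuallyLE
    exact (ae_restrict_iff' measurableSet_Ioi).2 (Eventually.of_forall fun ρ hρ =>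
      div_nonneg (Real.exp_pos _).le (zero_lt_one.trans hρ).le)
  have hcosneg : ∀ ϑ : ℝ, Real.cos ϑ ≤ 0 → Real.exp (R * Real.cos ϑ) ≤ 1 := fun ϑ hϑ =>
    Real.exp_le_one_iff.2 (mul_nonpos_of_nonneg_of_nonpos hR0.le hϑ)
  have harc1 := norm_arc_expDiv_le (m := m) (θ₁ := -Real.pi) (θ₂ := -(Real.pi / 2)) (K := 1) hR0
    (by linarith) (fun ϑ _ => hb R ϑ le_rfl) (by norm_num) fun ϑ hϑ => hcosneg ϑ (by
      rw [← Real.cos_neg]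
      exact Real.cos_nonpos_of_pi_div_two_le_of_le (by linarith [hϑ.2]) (by linarith [hϑ.1]))
  have harc3 := norm_arc_expDiv_le (m := m) (θ₁ := Real.pi / 2) (θ₂ := Real.pi) (K := 1) hR0
    (by linarith) (fun ϑ _ => hb R ϑ le_rfl) (by norm_num) fun ϑ hϑ => hcosneg ϑ
      (Real.cos_nonpos_of_pi_div_two_le_of_le (by linarith [hϑ.1]) (by linarith [hϑ.2]))
  have hbound : ∀ ρ ϑ : ℝ, ρ ∈ Icc 1 R → ϑ ∈ Icc (-(Real.pi / 2)) (Real.pi / 2) →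
      ‖m (logPt ρ ϑ)‖ ≤ (ρ ^ β + x) / q := fun ρ ϑ hρ hϑ =>
    (norm_symbol_le_right hα hα1 h1 h2 hx hy (by linarith [hρ.1]) hϑ).2
  have hin := norm_arc_expDiv_le (m := m) (C := (1 + x) / q) (θ₁ := -(Real.pi / 2))
    (θ₂ := Real.pi / 2) (K := Real.exp 1) one_pos (by linarith)
    (fun ϑ hϑ => by simpa using hbound 1 ϑ ⟨le_rfl, hR1⟩ hϑ) (by positivity)
    fun ϑ _ => Real.exp_le_exp.2 (by linarith [Real.cos_le_one ϑ])
  have hseg : ∀ ϑ : ℝ, ϑ ∈ Icc (-(Real.pi / 2)) (Real.pi / 2) → Real.cos ϑ = 0 →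
      ‖∫ ρ in (1 : ℝ)..R, ofLog (fun w => expDiv w * m w) ρ ϑ * Complex.exp (Complex.I * ϑ)‖
        ≤ (1 + x) / q * R ^ 3 := by
    intro ϑ hϑ hcos
    refine (norm_segment_expDiv_le (C := (R ^ 2 + x) / q) le_rfl hR1 hcos (fun ρ hρ => ?_)).trans ?_
    · refine (hbound ρ ϑ hρ hϑ).trans ?_
      have : ρ ^ β ≤ R ^ β := Real.rpow_le_rpow (by linarith [hρ.1]) hρ.2 hβ.le
      exact div_le_div_of_nonneg_right (by linarith) hq0.le
    · have e : (1 + x) / q * R ^ 3 = ((1 + x) * R ^ 2) / q * R := by ring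
      rw [e]
      have h3 : 1 ≤ R ^ 2 := one_le_pow₀ hR1
      exact mul_le_mul (div_le_div_of_nonneg_right (by nlinarith) hq0.le) (by linarith)
        (by linarith) (by positivity)
  -- Trades the right half of the large circle for the right half of the unit circle and two
  -- segments of the imaginary axis.
  have hsector := integral_boundary_sector (g := fun w => expDiv w * m w) (θ₁ := -(Real.pi / 2))
    (θ₂ := Real.pi / 2) one_pos hR1 (by linarith) fun ρ hρ ϑ hϑ =>
      (differentiable_expDiv _).mul (differentiableAt_symbol
        (norm_symbol_le_right hα hα1 h1 h2 hx hy (by linarith [hρ.1]) hϑ).1)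
  have hI := hankelIntegrable_expDiv_mul hR0 (by linarith) le_rfl
    (fun ρ ϑ hρ (_ : ϑ ∈ Icc (-Real.pi) Real.pi) =>
      (differentiableAt_symbol_of_large hL hβ (by linarith) hx.le hy hρ ϑ).continuousAt)
    (fun ρ ϑ hρ _ => hb ρ ϑ hρ)
  have hii : ∀ a b : ℝ, a ∈ Icc (-Real.pi) Real.pi → b ∈ Icc (-Real.pi) Real.pi →
      IntervalIntegrable (fun ϑ => ofLog (fun w => expDiv w * m w) R ϑ *
        (Complex.I * polarPoint R ϑ)) volume a b := by
    intro a b ha hb'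
    refine hI.arc_mul.mono_set ?_
    rw [uIcc_of_le (by linarith : -Real.pi ≤ Real.pi)]
    exact (convex_Icc _ _).ordConnected.uIcc_subset ha hb'
  have m1 : -Real.pi ∈ Icc (-Real.pi) Real.pi := ⟨le_rfl, by linarith⟩
  have m2 : -(Real.pi / 2) ∈ Icc (-Real.pi) Real.pi := ⟨by linarith, by linarith⟩
  have m3 : Real.pi / 2 ∈ Icc (-Real.pi) Real.pi := ⟨by linarith, by linarith⟩
  have m4 : Real.pi ∈ Icc (-Real.pi) Real.pi := ⟨by linarith, le_rfl⟩
  have hsplit : ∫ ϑ in (-Real.pi)..Real.pi, ofLog (fun w => expDiv w * m w) R ϑ *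
        (Complex.I * polarPoint R ϑ)
      = (∫ ϑ in (-Real.pi)..(-(Real.pi / 2)), ofLog (fun w => expDiv w * m w) R ϑ *
        (Complex.I * polarPoint R ϑ))
        + (∫ ϑ in (-(Real.pi / 2))..(Real.pi / 2), ofLog (fun w => expDiv w * m w) R ϑ *
        (Complex.I * polarPoint R ϑ))
        + ∫ ϑ in (Real.pi / 2)..Real.pi, ofLog (fun w => expDiv w * m w) R ϑ *
        (Complex.I * polarPoint R ϑ) := by
    rw [intervalIntegral.integral_add_adjacent_intervals (hii _ _ m1 m2) (hii _ _ m2 m3),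
      intervalIntegral.integral_add_adjacent_intervals (hii _ _ m1 m3) (hii _ _ m3 m4)]
  have hs1 := hseg (Real.pi / 2) ⟨by linarith, le_rfl⟩ Real.cos_pi_div_two
  have hs2 := hseg (-(Real.pi / 2)) ⟨le_rfl, by linarith⟩ (by simp)
  have hmid : ‖∫ ϑ in (-(Real.pi / 2))..(Real.pi / 2), ofLog (fun w => expDiv w * m w) R ϑ *
      (Complex.I * polarPoint R ϑ)‖
      ≤ (1 + x) / q * R ^ 3 + (1 + x) / q * R ^ 3 + (1 + x) / q * Real.exp 1 * Real.pi := by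
    rw [eq_sub_iff_add_eq] at hsector
    rw [← hsector]
    refine (norm_add_le _ _).trans (add_le_add ((norm_sub_le _ _).trans (add_le_add hs1 hs2)) ?_)
    refine hin.trans_eq ?_
    ring
  rw [hankelSol_eq hβ (by linarith) hx.le hy hL, norm_mul, norm_one_div_two_pi_I, mul_assoc]
  refine mul_le_mul_of_nonneg_left ?_ (by positivity)
  unfold hankelIntegral
  rw [hsplit]
  have f1 := hray (-Real.pi) (Real.cos_neg _)
  have f2 := hray Real.pi rfl
  refine norm_add₃_le.trans ?_
  rw [norm_neg]
  refine (add_le_add (add_le_add f1 (norm_add₃_le.trans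
    (add_le_add (add_le_add harc1 hmid) harc3))) f2).trans ?_
  have g1 : 0 ≤ (6 * I₁ + 3 * Real.pi + (1 + x) / q * Real.exp 1 * Real.pi) * (R ^ 3 - 1) :=
    mul_nonneg (by positivity) (by linarith)
  linarith

end Growth

end ReducedVariables

/-! ### The contour of the statement -/

section Contour

variable {c D α β : ℝ}

theorem polarPow_eq_negPow {ρ : ℝ} (hρ : 0 < ρ) (s ϑ : ℝ) :
    polarPow s ρ ϑ = negPow (-s) (logPt ρ ϑ) := by
  rw [negPow, neg_neg, exp_mul_logPt hρ]

/-- The factor `ξ^(α+β)` never vanishes, so a contour encloses the singularities exactly when `1 +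
lowerTerms` has no zero on or outside it. -/
theorem denominator_eq (κ : E3) (t : ℝ) {ρ : ℝ} (hρ : 0 < ρ) (ϑ : ℝ) :
    denominator c D α β κ t ρ ϑ = negPow (-(α + β)) (logPt ρ ϑ) *
      (1 + lowerTerms β (α + β) (c ^ 2 * D⁻¹ * t ^ β) (‖κ‖ ^ 2 * c ^ 2 * t ^ (α + β))
        (logPt ρ ϑ)) := by
  have e1 : negPow (-α) (logPt ρ ϑ) = negPow (-(α + β)) (logPt ρ ϑ) * negPow β (logPt ρ ϑ) := by
    rw [← negPow_add]; congr 1; ring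
  have e2 : negPow (-(α + β)) (logPt ρ ϑ) * negPow (α + β) (logPt ρ ϑ) = 1 := by
    rw [← negPow_add, neg_add_cancel, negPow_zero]
  rw [denominator, polarPow_eq_negPow hρ, polarPow_eq_negPow hρ, e1, lowerTerms]
  push_cast
  linear_combination (-((‖κ‖ : ℂ) ^ 2 * (c : ℂ) ^ 2 * ((t ^ (α + β) : ℝ) : ℂ))) * e2

theorem integrand_eq (κ : E3) (t : ℝ) {ρ : ℝ} (hρ : 0 < ρ) (ϑ : ℝ) :
    integrand c D α β κ t ρ ϑ = ofLog (fun w => expDiv w *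
      symbol β (α + β) (c ^ 2 * D⁻¹ * t ^ β) (‖κ‖ ^ 2 * c ^ 2 * t ^ (α + β)) w) ρ ϑ := by
  set w := logPt ρ ϑ with hw
  have e1 : negPow (-(α - 1)) w = negPow (-(α + β)) w * negPow β w * Complex.exp (-w) := by
    have : Complex.exp (-w) = negPow 1 w := by simp [negPow]
    rw [this, ← negPow_add, ← negPow_add]; congr 1; ring
  have e2 : negPow β w * negPow (-β) w = 1 := by
    rw [← negPow_add, add_neg_cancel, negPow_zero]
  have e3 : negPow (-(α + β)) w ≠ 0 := Complex.exp_ne_zero _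
  rw [integrand, denominator_eq κ t hρ, polarPow_eq_negPow hρ, polarPow_eq_negPow hρ, ofLog,
    expDiv, symbol, ← hw, e1, ← exp_logPt hρ, ← hw]
  calc _ = Complex.exp (Complex.exp w) * Complex.exp (-w) *
        ((negPow (-(α + β)) w * (negPow β w * negPow (-β) w +
          ((c ^ 2 * D⁻¹ * t ^ β : ℝ) : ℂ) * negPow β w)) /
        (negPow (-(α + β)) w * (1 + lowerTerms β (α + β) (c ^ 2 * D⁻¹ * t ^ β)
          (‖κ‖ ^ 2 * c ^ 2 * t ^ (α + β)) w))) := by ring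
    _ = _ := by rw [mul_div_mul_left _ _ e3, e2]

/-- Between the given radius and a large one the integrand is holomorphic by the enclosure
condition. Beyond the large radius there are no zeros at any angle, so the rays can be turned to the
cut. -/
theorem hankelSol_eq_contour (hD : 0 < D) (hα : 0 < α) (hβ : 0 < β) (κ : E3)
    {t : ℝ} (ht : 0 ≤ t) {θ : ℝ} (hθ : Real.pi / 2 < θ) (hθ' : θ ≤ Real.pi) :
    (∃ r : ℝ, 0 < r ∧ Encloses c D α β κ t r θ) ∧
    ∀ r : ℝ, 0 < r → Encloses c D α β κ t r θ →
      HankelIntegrable r θ (integrand c D α β κ t) ∧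
      hankelSol β (α + β) (c ^ 2 * D⁻¹ * t ^ β) (‖κ‖ ^ 2 * c ^ 2 * t ^ (α + β))
        = 1 / (2 * (Real.pi : ℂ) * Complex.I) * hankelIntegral r θ (integrand c D α β κ t) := by
  set x := c ^ 2 * D⁻¹ * t ^ β with hxdef
  set y := ‖κ‖ ^ 2 * c ^ 2 * t ^ (α + β) with hydef
  have hx : 0 ≤ x := by positivity
  have hy : 0 ≤ y := by positivity
  have hβγ : β ≤ α + β := by linarith
  have hL : Large β (α + β) x y (largeRadius β (x + y)) := large_largeRadius hβ hβγ hx hy le_rfl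
  have hθ0 : 0 ≤ θ := by linarith [Real.pi_pos]
  refine ⟨⟨_, hL.1, fun ρ ϑ hρ _ => ?_⟩, fun r hr henc => ?_⟩
  · rw [denominator_eq κ t (hL.1.trans_le hρ)]
    exact mul_ne_zero (Complex.exp_ne_zero _) (one_add_lowerTerms_ne_zero hL hβ hβγ hx hy hρ ϑ)
  · set R := max r (largeRadius β (x + y)) with hR
    have hLR : Large β (α + β) x y R := hL.mono hβ hβγ hx hy (le_max_right _ _)
    have hd : ∀ ρ ϑ : ℝ, R ≤ ρ → DifferentiableAt ℂ (symbol β (α + β) x y) (logPt ρ ϑ) :=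
      fun ρ ϑ hρ => differentiableAt_symbol_of_large hLR hβ hβγ hx hy hρ ϑ
    have hb : ∀ ρ ϑ : ℝ, R ≤ ρ → ‖symbol β (α + β) x y (logPt ρ ϑ)‖ ≤ 3 :=
      fun ρ ϑ hρ => norm_symbol_le hLR hβ hβγ hx hy hρ ϑ
    have hI := hankelIntegrable_expDiv_mul hLR.1 hθ hθ'
      (fun ρ ϑ hρ _ => (hd ρ ϑ hρ).continuousAt) (fun ρ ϑ hρ _ => hb ρ ϑ hρ)
    have hrad := hankelIntegral_radius
      (g := fun w => expDiv w * symbol β (α + β) x y w) hr (le_max_left r (largeRadius β (x + y))) hθ0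
      (fun ρ hρ ϑ hϑ => (differentiable_expDiv _).mul (differentiableAt_symbol (by
        have h1 := henc ρ ϑ hρ.1 hϑ
        rw [denominator_eq κ t (hr.trans_le hρ.1)] at h1
        exact right_ne_zero_of_mul h1))) hI
    have hcongr : ∀ ρ ϑ : ℝ, r ≤ ρ → ϑ ∈ Icc (-θ) θ →
        ofLog (fun w => expDiv w * symbol β (α + β) x y w) ρ ϑ = integrand c D α β κ t ρ ϑ :=
      fun ρ ϑ hρ _ => (integrand_eq κ t (hr.trans_le hρ) ϑ).symm
    refine ⟨hrad.1.congr hθ0 hcongr, ?_⟩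
    rw [← hankelIntegral_congr hθ0 hcongr, hrad.2,
      hankelIntegral_angle hLR.1 hθ hθ' (by norm_num : (0 : ℝ) ≤ 3)
        (fun ρ ϑ hρ _ => hd ρ ϑ hρ) (fun ρ ϑ hρ _ => hb ρ ϑ hρ)]
    exact hankelSol_eq hβ hβγ hx hy hLR

end Contour

/-! ### From the Caputo equation to a Volterra equation -/

section Caputo

variable {f : ℝ → ℂ}

/-- Integrability of `f''` near `0` gives `f'` a limit at `0⁺`. That limit must be the one-sided
derivative at `0`, which vanishes. -/
theorem deriv_eq_integral (hf : ContDiffOn ℝ 2 f (Ioi 0))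
    (hi : ∀ T : ℝ, IntegrableOn (iteratedDeriv 2 f) (Ioc 0 T))
    (h0 : HasDerivWithinAt f 0 (Ici 0) 0) {t : ℝ} (ht : 0 < t) :
    deriv f t = ∫ s in (0 : ℝ)..t, iteratedDeriv 2 f s := by
  have hd2 : ∀ s, 0 < s → HasDerivAt (deriv f) (iteratedDeriv 2 f s) s := by
    intro s hs
    have h1 : ContDiffOn ℝ 1 (deriv f) (Ioi 0) :=
      ((contDiffOn_succ_iff_deriv_of_isOpen (n := 1) isOpen_Ioi).1
        (by simpa [one_add_one_eq_two] using hf)).2.2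
    rw [iteratedDeriv_succ, iteratedDeriv_one]
    exact ((h1.differentiableOn (by norm_num)).differentiableAt (Ioi_mem_nhds hs)).hasDerivAt
  have hint : ∀ s, 0 ≤ s → s ≤ t → IntervalIntegrable (iteratedDeriv 2 f) volume s t := by
    intro s hs hst
    rw [intervalIntegrable_iff_integrableOn_Ioc_of_le hst]
    exact (hi t).mono_set (Ioc_subset_Ioc_left hs)
  have hftc : ∀ s, 0 < s → s ≤ t →
      deriv f s = deriv f t - ∫ u in s..t, iteratedDeriv 2 f u := by
    intro s hs hst
    rw [intervalIntegral.integral_eq_sub_of_hasDerivAt (f := deriv f)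
      (fun u hu => hd2 u ?_) (hint s hs.le hst)]
    · ring
    · rw [uIcc_of_le hst] at hu
      exact hs.trans_le hu.1
  have hlim : Tendsto (fun s => ∫ u in s..t, iteratedDeriv 2 f u) (𝓝[>] 0)
      (𝓝 (∫ u in (0 : ℝ)..t, iteratedDeriv 2 f u)) := by
    have h1 : ContinuousOn (fun s => ∫ u in s..t, iteratedDeriv 2 f u) (uIcc 0 t) := by
      refine intervalIntegral.continuousOn_primitive_interval_left ?_
      rw [uIcc_of_le ht.le]
      exact (integrableOn_Icc_iff_integrableOn_Ioc).2 (hi t)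
    have h2 := (h1 0 left_mem_uIcc).tendsto
    refine h2.mono_left ?_
    rw [uIcc_of_le ht.le, nhdsWithin_Icc_eq_nhdsGE ht]
    exact nhdsWithin_mono _ Ioi_subset_Ici_self
  have hlim' : Tendsto (deriv f) (𝓝[>] 0)
      (𝓝 (deriv f t - ∫ u in (0 : ℝ)..t, iteratedDeriv 2 f u)) := by
    refine (tendsto_const_nhds.sub hlim).congr' ?_
    filter_upwards [Ioc_mem_nhdsGT ht] with s hs
    exact (hftc s hs.1 hs.2).symm
  have h1 := hasDerivWithinAt_Ici_of_tendsto_deriv (s := Ioi 0) (a := 0)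
    (hf.differentiableOn (by norm_num)) (h0.continuousWithinAt.mono Ioi_subset_Ici_self)
    self_mem_nhdsWithin hlim'
  have h2 := (uniqueDiffOn_Ici (0 : ℝ) 0 self_mem_Ici).eq_deriv _ h1 h0
  exact sub_eq_zero.1 h2

theorem sub_eq_integral_deriv (hf : ContDiffOn ℝ 2 f (Ioi 0))
    (hi : ∀ T : ℝ, IntegrableOn (iteratedDeriv 2 f) (Ioc 0 T))
    (h0 : HasDerivWithinAt f 0 (Ici 0) 0) {t : ℝ} (ht : 0 ≤ t) :
    IntegrableOn (deriv f) (Ioc 0 t) ∧ f t - f 0 = ∫ s in (0 : ℝ)..t, deriv f s := by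
  have hI : IntegrableOn (deriv f) (Ioc 0 t) := by
    have h1 : ContinuousOn (fun s => ∫ u in (0 : ℝ)..s, iteratedDeriv 2 f u) (uIcc 0 t) := by
      refine intervalIntegral.continuousOn_primitive_interval ?_
      rw [uIcc_of_le ht]
      exact (integrableOn_Icc_iff_integrableOn_Ioc).2 (hi t)
    refine IntegrableOn.congr_fun ((h1.integrableOn_uIcc).mono_set ?_) (fun s hs =>
      (deriv_eq_integral hf hi h0 hs.1).symm) measurableSet_Ioc
    rw [uIcc_of_le ht]
    exact Ioc_subset_Icc_self
  refine ⟨hI, ?_⟩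
  refine (intervalIntegral.integral_eq_sub_of_hasDerivAt_of_le ht ?_ (fun s hs => ?_)
    ((intervalIntegrable_iff_integrableOn_Ioc_of_le ht).2 hI)).symm
  · intro s hs
    rcases hs.1.eq_or_lt with rfl | h
    · exact h0.continuousWithinAt.mono Icc_subset_Ici_self
    · exact (hf.continuousOn.continuousAt (Ioi_mem_nhds h)).continuousWithinAt
  · exact ((hf.differentiableOn (by norm_num)).differentiableAt (Ioi_mem_nhds hs.1)).hasDerivAt

theorem caputoDeriv_eq_fracInt {γ : ℝ} {n : ℕ} (hn : ⌈γ⌉₊ = n) (h : γ < n) {t : ℝ}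
    (ht : 0 ≤ t) : caputoDeriv γ f t = fracInt (n - γ) (iteratedDeriv n f) t := by
  rw [caputoDeriv, hn, if_neg h.ne, fracInt]
  congr 1
  · push_cast; rw [one_div]
  · refine intervalIntegral.integral_congr fun τ hτ => ?_
    rw [uIcc_of_le ht] at hτ
    have h1 : 0 ≤ t - τ := by linarith [hτ.2]
    rw [show (n : ℝ) - γ - 1 = -(γ + 1 - n) by ring, Real.rpow_neg h1, div_eq_mul_inv, mul_comm]
    push_cast
    rfl

theorem intervalIntegrable_fracKernel_mul_of_one_le {μ t : ℝ} (hμ : 1 ≤ μ) (ht : 0 ≤ t)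
    {g : ℝ → ℂ} (hg : IntegrableOn g (Ioc 0 t)) :
    IntervalIntegrable (fun s => (((t - s) ^ (μ - 1) : ℝ) : ℂ) * g s) volume 0 t := by
  refine IntervalIntegrable.continuousOn_mul
    ((intervalIntegrable_iff_integrableOn_Ioc_of_le ht).2 hg) ?_
  exact (Complex.continuous_ofReal.comp ((Real.continuous_rpow_const (by linarith)).comp
    (continuous_const.sub continuous_id))).continuousOn

/-- Integrating the fractional telegraph equation `α + β` times. -/
theorem volterra_of_caputo {c D α β : ℝ} (hc : 0 < c) (hα : 0 < α) (hα1 : α ≤ 1)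
    (hαβ : 1 < α + β) (hαβ2 : α + β ≤ 2) (hf : ContDiffOn ℝ 2 f (Ioi 0))
    (hi : ∀ T : ℝ, IntegrableOn (iteratedDeriv 2 f) (Ioc 0 T))
    (h0 : HasDerivWithinAt f 0 (Ici 0) 0) {g : ℝ → ℂ}
    (heq : ∀ t, 0 < t → (1 / (c : ℂ) ^ 2) * caputoDeriv (α + β) f t
      + (1 / (D : ℂ)) * caputoDeriv α f t = -g t) {t : ℝ} (ht : 0 ≤ t) :
    f t - f 0 + ((c ^ 2 * D⁻¹ : ℝ) : ℂ) * fracInt β (fun s => f s - f 0) t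
      + ((c ^ 2 : ℝ) : ℂ) * fracInt (α + β) g t = 0 := by
  have hβ : 0 < β := by linarith
  have hγ : 0 < α + β := by linarith
  have hd1 : ∀ s ∈ Ioc 0 t, fracInt 1 (iteratedDeriv 2 f) s = deriv f s := fun s hs => by
    rw [fracInt_one, deriv_eq_integral hf hi h0 hs.1]
  have hd0 : ∀ s, 0 ≤ s → fracInt 1 (deriv f) s = f s - f 0 := fun s hs => by
    rw [fracInt_one, (sub_eq_integral_deriv hf hi h0 hs).2]
  have hI1 := (sub_eq_integral_deriv hf hi h0 ht).1
  -- `J^(α+β) J^(2-α-β) f'' = J² f'' = f - f(0)`. Integrability is carried along because the Caputo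
  -- derivatives need not be continuous at `0`, so `fracInt_add` is not applicable.
  have hsecond : IntervalIntegrable
        (fun s => (((t - s) ^ (α + β - 1) : ℝ) : ℂ) * caputoDeriv (α + β) f s) volume 0 t ∧
      fracInt (α + β) (caputoDeriv (α + β) f) t = f t - f 0 := by
    have hceil : ⌈α + β⌉₊ = 2 := by
      rw [Nat.ceil_eq_iff (by norm_num)]
      exact ⟨by push_cast; linarith, by push_cast; linarith⟩
    have h2 : fracInt 2 (iteratedDeriv 2 f) t = f t - f 0 := by
      rw [← one_add_one_eq_two, ← (fracInt_fracInt one_pos one_pos (by norm_num) ht (hi t)).2,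
        fracInt_congr ht hd1, hd0 t ht]
    -- For `α + β = 2` the Caputo derivative is an ordinary one, and the semigroup law is
    -- unavailable since its second order `2 - α - β` is zero.
    rcases hαβ2.lt_or_eq with hlt | he
    · have hcap : ∀ s ∈ Ioc 0 t, caputoDeriv (α + β) f s
          = fracInt (2 - (α + β)) (iteratedDeriv 2 f) s := fun s hs => by
        simpa using caputoDeriv_eq_fracInt (f := f) hceil (by push_cast; linarith) hs.1.le
      have hJ := fracInt_fracInt (μ := α + β) (ν := 2 - (α + β)) hγ (by linarith) (by linarith) ht
        (hi t)
      refine ⟨hJ.1.congr fun s hs => ?_, ?_⟩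
      · rw [uIoc_of_le ht] at hs
        simp only [hcap s hs]
      · rw [fracInt_congr ht hcap, hJ.2, add_sub_cancel, h2]
    · have hcap : ∀ s, caputoDeriv (α + β) f s = iteratedDeriv 2 f s := fun s => by
        rw [caputoDeriv, hceil, if_pos (by push_cast; exact he)]
      simp only [funext hcap]
      exact ⟨intervalIntegrable_fracKernel_mul_of_one_le hαβ.le ht (hi t), by rw [he, h2]⟩
  -- `J^(α+β) J^(1-α) f' = J^(β+1) f' = J^β (f - f(0))`, with `α = 1` treated as an ordinary
  -- derivative.
  have hfirst : IntervalIntegrable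
        (fun s => (((t - s) ^ (α + β - 1) : ℝ) : ℂ) * caputoDeriv α f s) volume 0 t ∧
      fracInt (α + β) (caputoDeriv α f) t = fracInt β (fun s => f s - f 0) t := by
    have hceil : ⌈α⌉₊ = 1 := by
      rw [Nat.ceil_eq_iff (by norm_num)]
      exact ⟨by simpa using hα, by simpa using hα1⟩
    have h2 : fracInt (β + 1) (deriv f) t = fracInt β (fun s => f s - f 0) t := by
      rw [← (fracInt_fracInt hβ one_pos (by linarith) ht hI1).2]
      exact fracInt_congr ht fun s hs => hd0 s hs.1.le
    rcases hα1.lt_or_eq with hlt | he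
    · have hcap : ∀ s ∈ Ioc 0 t, caputoDeriv α f s = fracInt (1 - α) (deriv f) s := fun s hs => by
        simpa [iteratedDeriv_one] using
          caputoDeriv_eq_fracInt (f := f) hceil (by push_cast; linarith) hs.1.le
      have hJ := fracInt_fracInt (μ := α + β) (ν := 1 - α) hγ (by linarith) (by linarith) ht hI1
      refine ⟨hJ.1.congr fun s hs => ?_, ?_⟩
      · rw [uIoc_of_le ht] at hs
        simp only [hcap s hs]
      · rw [fracInt_congr ht hcap, hJ.2, show α + β + (1 - α) = β + 1 by ring, h2]
    · have hcap : ∀ s, caputoDeriv α f s = deriv f s := fun s => by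
        rw [caputoDeriv, hceil, if_pos (by push_cast; exact he), iteratedDeriv_one]
      simp only [funext hcap]
      refine ⟨intervalIntegrable_fracKernel_mul_of_one_le hαβ.le ht hI1, ?_⟩
      rw [he, add_comm, h2]
  have hsum : fracInt (α + β) (fun s => (1 / (c : ℂ) ^ 2) * caputoDeriv (α + β) f s
      + (1 / (D : ℂ)) * caputoDeriv α f s) t
      = (1 / (c : ℂ) ^ 2) * fracInt (α + β) (caputoDeriv (α + β) f) t
        + (1 / (D : ℂ)) * fracInt (α + β) (caputoDeriv α f) t := by
    unfold fracInt
    simp only [mul_add, mul_left_comm _ (1 / (c : ℂ) ^ 2), mul_left_comm _ (1 / (D : ℂ))]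
    rw [intervalIntegral.integral_add (hsecond.1.const_mul _) (hfirst.1.const_mul _),
      intervalIntegral.integral_const_mul, intervalIntegral.integral_const_mul]
    ring
  have hneg : fracInt (α + β) (fun s => (1 / (c : ℂ) ^ 2) * caputoDeriv (α + β) f s
      + (1 / (D : ℂ)) * caputoDeriv α f s) t = (-1) * fracInt (α + β) g t := by
    rw [← fracInt_const_mul]
    exact fracInt_congr ht fun s hs => by rw [heq s hs.1]; ring
  rw [hsum, hsecond.2, hfirst.2] at hneg
  have hc' : (c : ℂ) ≠ 0 := by exact_mod_cast hc.ne'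
  have hc2 : (c : ℂ) ^ 2 * (1 / (c : ℂ) ^ 2) = 1 := by field_simp
  push_cast
  linear_combination (c : ℂ) ^ 2 * hneg - (f t - f 0) * hc2

end Caputo

/-! ### Absolutely convergent series of Schwartz functions -/

section Series

variable {E : Type*} [NormedAddCommGroup E] [NormedSpace ℝ E]

/-- A bounded sequence in the Schwartz space can be summed against `ℓ¹` coefficients term by term,
derivatives included. This provides a map from the Banach space `ℓ¹` into the Schwartz space. -/
theorem exists_schwartz_tsum {ψ : ℕ → 𝓢(E, ℂ)} {M : ℕ → ℕ → ℝ}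
    (hψ : ∀ j n k, SchwartzMap.seminorm ℂ j n (ψ k) ≤ M j n) {a : ℕ → ℂ}
    (ha : Summable fun k => ‖a k‖) :
    ∃ s : 𝓢(E, ℂ), (∀ x, s x = ∑' k, a k * ψ k x) ∧
      ∀ j n, SchwartzMap.seminorm ℂ j n s ≤ M j n * ∑' k, ‖a k‖ := by
  have hM : ∀ j n, 0 ≤ M j n := fun j n => (apply_nonneg _ _).trans (hψ j n 0)
  have hcd : ∀ k, ContDiff ℝ ∞ fun x => a k * ψ k x := fun k => contDiff_const.mul (ψ k).smooth'
  have hder : ∀ k n x, iteratedFDeriv ℝ n (fun x => a k * ψ k x) x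
      = a k • iteratedFDeriv ℝ n (ψ k) x := by
    intro k n x
    exact iteratedFDeriv_const_smul_apply (a := a k) ((ψ k).contDiffAt n)
  have hpt : ∀ k j n x, ‖x‖ ^ j * ‖iteratedFDeriv ℝ n (fun x => a k * ψ k x) x‖
      ≤ M j n * ‖a k‖ := by
    intro k j n x
    rw [hder, norm_smul, mul_left_comm, mul_comm]
    exact mul_le_mul_of_nonneg_right ((SchwartzMap.le_seminorm ℂ j n (ψ k) x).trans (hψ j n k))
      (norm_nonneg _)
  have hbd : ∀ (n k : ℕ) (x : E), (n : ℕ∞) ≤ ⊤ →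
      ‖iteratedFDeriv ℝ n (fun x => a k * ψ k x) x‖ ≤ M 0 n * ‖a k‖ := by
    intro n k x _
    simpa using hpt k 0 n x
  have hsum : ∀ n : ℕ, (n : ℕ∞) ≤ ⊤ → Summable fun k => M 0 n * ‖a k‖ := fun n _ =>
    ha.mul_left _
  have hbound : ∀ j n x, ‖x‖ ^ j * ‖iteratedFDeriv ℝ n (fun x => ∑' k, a k * ψ k x) x‖
      ≤ M j n * ∑' k, ‖a k‖ := by
    intro j n x
    rw [iteratedFDeriv_tsum (N := ⊤) hcd hsum hbd le_top, ← tsum_mul_left]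
    have hs : Summable fun k => ‖iteratedFDeriv ℝ n (fun x => a k * ψ k x) x‖ :=
      (hsum n le_top).of_nonneg_of_le (fun _ => norm_nonneg _) fun k => hbd n k x le_top
    calc _ ≤ ‖x‖ ^ j * ∑' k, ‖iteratedFDeriv ℝ n (fun x => a k * ψ k x) x‖ :=
          mul_le_mul_of_nonneg_left (norm_tsum_le_tsum_norm hs) (by positivity)
      _ = ∑' k, ‖x‖ ^ j * ‖iteratedFDeriv ℝ n (fun x => a k * ψ k x) x‖ := tsum_mul_left.symm
      _ ≤ _ := (hs.mul_left _).tsum_le_tsum (fun k => hpt k j n x) (ha.mul_left _)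
  refine ⟨⟨fun x => ∑' k, a k * ψ k x, contDiff_tsum hcd hsum hbd,
    fun j n => ⟨_, hbound j n⟩⟩, fun x => rfl, fun j n => ?_⟩
  exact SchwartzMap.seminorm_le_bound ℂ j n _
    (mul_nonneg (hM j n) (tsum_nonneg fun _ => norm_nonneg _)) (hbound j n)

theorem lp_one_summable (a : lp (fun _ : ℕ => ℂ) 1) : Summable fun k => ‖a k‖ := by
  simpa using (lp.memℓp a).summable (by simp)

theorem lp_one_norm (a : lp (fun _ : ℕ => ℂ) 1) : ‖a‖ = ∑' k, ‖a k‖ := by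
  simpa using lp.norm_eq_tsum_rpow (by simp) a

/-- The uniform boundedness principle for a pointwise bounded family of tempered distributions and
a bounded sequence of Schwartz functions. -/
theorem uniform_bound_of_pointwise {ι : Type*} (T : ι → 𝓢'(E, ℂ))
    (hT : ∀ φ : 𝓢(E, ℂ), ∃ C : ℝ, ∀ i, ‖T i φ‖ ≤ C) {ψ : ℕ → 𝓢(E, ℂ)}
    (hψ : ∀ j n, ∃ M : ℝ, ∀ k, SchwartzMap.seminorm ℂ j n (ψ k) ≤ M) :
    ∃ C : ℝ, ∀ i k, ‖T i (ψ k)‖ ≤ C := by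
  choose M hM using hψ
  have hM0 : ∀ j n, 0 ≤ M j n := fun j n => (apply_nonneg _ _).trans (hM j n 0)
  have hex := fun a : lp (fun _ : ℕ => ℂ) 1 => exists_schwartz_tsum hM (lp_one_summable a)
  -- `L` sends the unit vectors of `ℓ¹` to the `ψ k`. The functionals `T i ∘ L` live on a Banach
  -- space, so `banach_steinhaus` applies to them.
  choose L hL hLM using hex
  have hsum : ∀ (a : lp (fun _ : ℕ => ℂ) 1) x, Summable fun k => a k * ψ k x := by
    intro a x
    refine Summable.of_norm_bounded ((lp_one_summable a).mul_right (M 0 0)) fun k => ?_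
    rw [norm_mul]
    exact mul_le_mul_of_nonneg_left
      ((SchwartzMap.norm_le_seminorm ℂ (ψ k) x).trans (hM 0 0 k)) (norm_nonneg _)
  have hLadd : ∀ a b, L (a + b) = L a + L b := by
    intro a b
    ext x
    rw [add_apply, hL, hL, hL, ← (hsum a x).tsum_add (hsum b x)]
    exact tsum_congr fun k => by simp [add_mul]
  have hLsmul : ∀ (c : ℂ) a, L (c • a) = c • L a := by
    intro c a
    ext x
    rw [smul_apply, hL, hL, smul_eq_mul, ← tsum_mul_left]
    exact tsum_congr fun k => by simp [mul_assoc]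
  have hLsingle : ∀ k, L (lp.single 1 k (1 : ℂ)) = ψ k := by
    intro k
    ext x
    rw [hL, tsum_eq_single k fun j hj => ?_]
    · simp
    · rw [lp.single_apply_ne _ _ _ hj, zero_mul]
  have hcont : ∀ i, ∃ C : ℝ, ∀ a, ‖T i (L a)‖ ≤ C * ‖a‖ := by
    intro i
    set q : Seminorm ℂ 𝓢(E, ℂ) := (normSeminorm ℂ ℂ).comp (T i).toLinearMap with hq
    have hqc : Continuous q := continuous_norm.comp (T i).continuous
    -- A continuous functional is dominated by finitely many Schwartz seminorms, and each of these
    -- is at most a constant times `‖a‖` on `L a`.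
    obtain ⟨s, C, -, hC⟩ := Seminorm.bound_of_continuous (schwartz_withSeminorms ℂ E ℂ) q hqc
    refine ⟨C * ∑ m ∈ s, M m.1 m.2, fun a => ?_⟩
    have h1 : ‖T i (L a)‖ ≤ C * (s.sup (schwartzSeminormFamily ℂ E ℂ)) (L a) := hC (L a)
    refine h1.trans ?_
    rw [mul_assoc]
    refine mul_le_mul_of_nonneg_left ?_ C.2
    refine Seminorm.finset_sup_apply_le
      (mul_nonneg (Finset.sum_nonneg fun m _ => hM0 _ _) (norm_nonneg _)) fun m hm => ?_
    rw [lp_one_norm]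
    refine (hLM a m.1 m.2).trans (mul_le_mul_of_nonneg_right ?_ (tsum_nonneg fun _ => norm_nonneg _))
    exact Finset.single_le_sum (f := fun m : ℕ × ℕ => M m.1 m.2) (fun m _ => hM0 _ _) hm
  choose C hC using hcont
  set g : ι → (lp (fun _ : ℕ => ℂ) 1 →L[ℂ] ℂ) := fun i =>
    LinearMap.mkContinuous
      { toFun := fun a => T i (L a)
        map_add' := fun a b => by rw [hLadd]; exact map_add (T i) _ _
        map_smul' := fun c a => by rw [hLsmul]; exact map_smul (T i) _ _ } (C i) (hC i) with hg
  obtain ⟨B, hB⟩ := banach_steinhaus (g := g) fun a => hT (L a)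
  refine ⟨B, fun i k => ?_⟩
  have h1 := (g i).le_of_opNorm_le (hB i) (lp.single 1 k (1 : ℂ))
  rw [lp.norm_single (by simp), norm_one, mul_one] at h1
  have h2 : g i (lp.single 1 k (1 : ℂ)) = T i (ψ k) := by
    rw [← hLsingle k]; rfl
  rwa [h2] at h1

end Series

/-! ### Multiplication by the square of the norm -/

/-- Multiplication of Schwartz functions by `‖κ‖²`. -/
def normSqMul (φ : 𝓢(E3, ℂ)) : 𝓢(E3, ℂ) :=
  SchwartzMap.smulLeftCLM ℂ (fun x : E3 => ‖x‖ ^ 2) φ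

theorem normSqMul_apply (φ : 𝓢(E3, ℂ)) (x : E3) : normSqMul φ x = ((‖x‖ ^ 2 : ℝ) : ℂ) * φ x := by
  rw [normSqMul, SchwartzMap.smulLeftCLM_apply_apply (by fun_prop), Complex.real_smul]

theorem iterate_normSqMul_apply (k : ℕ) (φ : 𝓢(E3, ℂ)) (x : E3) :
    normSqMul^[k] φ x = (((‖x‖ ^ 2) ^ k : ℝ) : ℂ) * φ x := by
  induction k with
  | zero => simp
  | succ k ih =>
    rw [Function.iterate_succ_apply', normSqMul_apply, ih]
    push_cast; ring

/-- The Taylor expansion of `‖x + h‖²` stops at order two, with coefficients of norm at most `‖x‖²`,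
`2‖x‖` and `1`. -/
theorem sum_norm_iteratedFDeriv_norm_sq_le (x : E3) (n : ℕ) :
    ∑ i ∈ Finset.range (n + 1), ‖iteratedFDeriv ℝ i (fun y : E3 => ‖y‖ ^ 2) x‖ / i.factorial
      ≤ (‖x‖ + 1) ^ 2 := by
  have hf : fderiv ℝ (fun y : E3 => ‖y‖ ^ 2) = fun y => (2 • innerSL ℝ : E3 →L[ℝ] E3 →L[ℝ] ℝ) y := by
    ext y
    rw [fderiv_norm_sq_apply]; rfl
  have h0 : ‖iteratedFDeriv ℝ 0 (fun y : E3 => ‖y‖ ^ 2) x‖ = ‖x‖ ^ 2 := by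
    rw [norm_iteratedFDeriv_zero]; simp
  have h1 : ‖iteratedFDeriv ℝ 1 (fun y : E3 => ‖y‖ ^ 2) x‖ ≤ 2 * ‖x‖ := by
    rw [norm_iteratedFDeriv_one, fderiv_norm_sq_apply]
    refine (norm_nsmul_le ..).trans ?_
    rw [innerSL_apply_norm]; simp
  have h2 : ‖iteratedFDeriv ℝ 2 (fun y : E3 => ‖y‖ ^ 2) x‖ ≤ 2 := by
    rw [← norm_iteratedFDeriv_fderiv, norm_iteratedFDeriv_one, hf,
      ContinuousLinearMap.fderiv]
    refine (norm_nsmul_le ..).trans ?_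
    have := norm_innerSL_le ℝ (E := E3)
    push_cast; linarith
  have h3 : ∀ i, 3 ≤ i → ‖iteratedFDeriv ℝ i (fun y : E3 => ‖y‖ ^ 2) x‖ = 0 := by
    intro i hi
    obtain ⟨m, rfl⟩ : ∃ m, i = m + 1 + 1 + 1 := ⟨i - 3, by omega⟩
    rw [← norm_iteratedFDeriv_fderiv, ← norm_iteratedFDeriv_fderiv, hf]
    have : fderiv ℝ (fun y : E3 => (2 • innerSL ℝ : E3 →L[ℝ] E3 →L[ℝ] ℝ) y)
        = fun _ => (2 • innerSL ℝ : E3 →L[ℝ] E3 →L[ℝ] ℝ) := by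
      ext1 y; exact ContinuousLinearMap.fderiv _
    rw [this, iteratedFDeriv_succ_const]
    simp
  have hx := norm_nonneg x
  -- The range is enlarged so that the orders `0, 1, 2` are present even for small `n`.
  have hle : ∑ i ∈ Finset.range (n + 1),
      ‖iteratedFDeriv ℝ i (fun y : E3 => ‖y‖ ^ 2) x‖ / i.factorial
      ≤ ∑ i ∈ Finset.range (n + 3),
      ‖iteratedFDeriv ℝ i (fun y : E3 => ‖y‖ ^ 2) x‖ / i.factorial :=
    Finset.sum_le_sum_of_subset_of_nonneg (Finset.range_mono (by omega))
      fun i _ _ => by positivity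
  refine hle.trans ?_
  rw [show n + 3 = 3 + n by ring, Finset.sum_range_add, Finset.sum_eq_zero (s := Finset.range n)
    fun i _ => by rw [h3 (3 + i) (by omega), zero_div]]
  simp only [Finset.sum_range_succ, Finset.range_zero, Finset.sum_empty, h0]
  generalize ‖iteratedFDeriv ℝ 1 (fun y : E3 => ‖y‖ ^ 2) x‖ = p at h1 ⊢
  generalize ‖iteratedFDeriv ℝ 2 (fun y : E3 => ‖y‖ ^ 2) x‖ = q at h2 ⊢
  norm_num [Nat.factorial]
  nlinarith

/-- Once derivatives are divided by factorials, Leibniz's rule is the product of Taylor series. The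
growth factor is then the sum of the Taylor coefficients of `‖x‖²`, with no dependence on the order
`n`; this makes the ratio common to all seminorms. -/
theorem norm_iteratedFDeriv_normSqMul_le {φ : 𝓢(E3, ℂ)} {x : E3} {N : ℕ} {B : ℝ} (hB : 0 ≤ B)
    (h : ∀ n ≤ N, ‖iteratedFDeriv ℝ n φ x‖ ≤ B * n.factorial) :
    ∀ n ≤ N, ‖iteratedFDeriv ℝ n (normSqMul φ) x‖ ≤ (‖x‖ + 1) ^ 2 * B * n.factorial := by
  intro n hn
  have e : (normSqMul φ : E3 → ℂ) = fun y => ‖y‖ ^ 2 • φ y := by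
    ext y; rw [normSqMul_apply, Complex.real_smul]
  rw [e]
  have hle := norm_iteratedFDeriv_smul_le (𝕜 := ℝ) (N := ∞) (f := fun y : E3 => ‖y‖ ^ 2) (g := φ)
    (contDiff_norm_sq ℝ) φ.smooth' x (n := n) (by exact_mod_cast le_top)
  refine hle.trans ?_
  calc _ ≤ ∑ i ∈ Finset.range (n + 1), (n.factorial * B) *
        (‖iteratedFDeriv ℝ i (fun y : E3 => ‖y‖ ^ 2) x‖ / i.factorial) := by
        refine Finset.sum_le_sum fun i hi => ?_
        have hin : i ≤ n := Nat.lt_succ_iff.1 (Finset.mem_range.1 hi)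
        have h1 := h (n - i) ((Nat.sub_le _ _).trans hn)
        have h2 : ((n.choose i : ℝ)) * (n - i).factorial = n.factorial / i.factorial := by
          rw [eq_div_iff (by positivity)]
          have := Nat.choose_mul_factorial_mul_factorial hin
          rw [← this]; push_cast; ring
        calc _ ≤ (n.choose i : ℝ) * ‖iteratedFDeriv ℝ i (fun y : E3 => ‖y‖ ^ 2) x‖ *
              (B * (n - i).factorial) := by gcongr
          _ = ((n.choose i : ℝ) * (n - i).factorial) *
              (B * ‖iteratedFDeriv ℝ i (fun y : E3 => ‖y‖ ^ 2) x‖) := by ring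
          _ = _ := by rw [h2]; ring
    _ = (n.factorial * B) * ∑ i ∈ Finset.range (n + 1),
        ‖iteratedFDeriv ℝ i (fun y : E3 => ‖y‖ ^ 2) x‖ / i.factorial := by rw [Finset.mul_sum]
    _ ≤ (n.factorial * B) * (‖x‖ + 1) ^ 2 :=
        mul_le_mul_of_nonneg_left (sum_norm_iteratedFDeriv_norm_sq_le x n) (by positivity)
    _ = _ := by ring

theorem tsupport_normSqMul_subset (φ : 𝓢(E3, ℂ)) : tsupport (normSqMul φ) ⊆ tsupport φ := by
  refine closure_mono fun x hx => ?_
  rw [Function.mem_support, normSqMul_apply] at hx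
  exact right_ne_zero_of_mul hx

theorem tsupport_iterate_normSqMul_subset (k : ℕ) (φ : 𝓢(E3, ℂ)) :
    tsupport (normSqMul^[k] φ) ⊆ tsupport φ := by
  induction k with
  | zero => exact le_rfl
  | succ k ih =>
    rw [Function.iterate_succ_apply']
    exact (tsupport_normSqMul_subset _).trans ih

/-- On a compactly supported function, the powers of the multiplication by `‖κ‖²` grow
geometrically, with the same ratio for all the seminorms. -/
theorem seminorm_iterate_normSqMul_le {φ : 𝓢(E3, ℂ)} {M : ℝ} (hM : 0 ≤ M)
    (hφ : tsupport φ ⊆ Metric.closedBall 0 M) (j n : ℕ) :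
    ∃ C : ℝ, ∀ k, SchwartzMap.seminorm ℂ j n (normSqMul^[k] φ) ≤ C * ((M + 1) ^ 2) ^ k := by
  set B : ℝ := ∑ m ∈ Finset.range (n + 1), SchwartzMap.seminorm ℂ 0 m φ with hB
  have hB0 : 0 ≤ B := Finset.sum_nonneg fun m _ => apply_nonneg _ _
  have hind : ∀ x, ‖x‖ ≤ M → ∀ k, ∀ m ≤ n, ‖iteratedFDeriv ℝ m (normSqMul^[k] φ) x‖
      ≤ B * ((M + 1) ^ 2) ^ k * m.factorial := by
    intro x hx k
    induction k with
    | zero =>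
      intro m hm
      have h1 := SchwartzMap.le_seminorm ℂ 0 m φ x
      rw [pow_zero, one_mul] at h1
      have h2 : SchwartzMap.seminorm ℂ 0 m φ ≤ B :=
        Finset.single_le_sum (f := fun m => SchwartzMap.seminorm ℂ 0 m φ)
          (fun m _ => apply_nonneg _ _) (Finset.mem_range.2 (Nat.lt_succ_of_le hm))
      rw [pow_zero, mul_one]
      refine (h1.trans h2).trans (le_mul_of_one_le_right hB0 ?_)
      exact_mod_cast Nat.succ_le_of_lt m.factorial_pos
    | succ k ih =>
      intro m hm
      rw [Function.iterate_succ_apply']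
      refine (norm_iteratedFDeriv_normSqMul_le (by positivity) ih m hm).trans ?_
      have : (‖x‖ + 1) ^ 2 ≤ (M + 1) ^ 2 := by gcongr
      calc _ ≤ (M + 1) ^ 2 * (B * ((M + 1) ^ 2) ^ k) * m.factorial := by gcongr
        _ = _ := by ring
  refine ⟨M ^ j * (B * n.factorial), fun k => ?_⟩
  refine SchwartzMap.seminorm_le_bound ℂ j n _ (by positivity) fun x => ?_
  by_cases hx : x ∈ tsupport (normSqMul^[k] φ)
  · have hxM : ‖x‖ ≤ M := by
      simpa using hφ (tsupport_iterate_normSqMul_subset k φ hx)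
    calc _ ≤ M ^ j * (B * ((M + 1) ^ 2) ^ k * n.factorial) := by
          gcongr
          exact hind x hxM k n le_rfl
      _ = _ := by ring
  · have h0 : iteratedFDeriv ℝ n (normSqMul^[k] φ) x = 0 := by
      by_contra h
      exact hx (support_iteratedFDeriv_subset n h)
    rw [h0, norm_zero, mul_zero]
    positivity

/-! ### The Laplacian of the Fourier transform -/

/-- `fourierTest` as a continuous linear map. -/
def fourierTestCLM : 𝓢(E3, ℂ) →L[ℂ] 𝓢(E3, ℂ) :=
  (SchwartzMap.compCLMOfContinuousLinearEquiv ℂ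
    (ContinuousLinearEquiv.smulLeft (R₁ := ℝ) (M₁ := E3)
      (Units.mk0 ((2 * Real.pi)⁻¹) (inv_ne_zero Real.two_pi_pos.ne')))).comp
    (FourierTransform.fourierInvCLM ℂ 𝓢(E3, ℂ))

theorem fourierTestCLM_apply (φ : 𝓢(E3, ℂ)) : fourierTestCLM φ = fourierTest φ := rfl

/-- Differentiating `exp(i⟨κ, x⟩)` brings down `i⟨κ, m⟩`; the `2π` of the inverse Fourier transform
cancels against the rescaling. -/
theorem lineDeriv_fourierTest (m : E3) (ψ : 𝓢(E3, ℂ)) : ∂_{m} (fourierTest ψ)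
    = fourierTest (Complex.I • SchwartzMap.smulLeftCLM ℂ (fun x => inner ℝ x m) ψ) := by
  have hpi : (Real.pi : ℂ) ≠ 0 := by exact_mod_cast Real.pi_ne_zero
  have h1 : (ContinuousLinearEquiv.smulLeft (R₁ := ℝ) (M₁ := E3)
      (Units.mk0 ((2 * Real.pi)⁻¹) (inv_ne_zero Real.two_pi_pos.ne'))) m
      = (2 * Real.pi)⁻¹ • m := rfl
  have h2 : ∂_{(2 * Real.pi)⁻¹ • m} (𝓕⁻ ψ)
      = 𝓕⁻ (Complex.I • SchwartzMap.smulLeftCLM ℂ (fun x => inner ℝ x m) ψ) := by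
    rw [LineDeriv.lineDerivOp_left_smul, SchwartzMap.lineDerivOp_fourierInv_eq]
    have h3 : ∀ f : 𝓢(E3, ℂ), (2 * Real.pi)⁻¹ • 𝓕⁻ ((2 * Real.pi * Complex.I) • f)
        = 𝓕⁻ (Complex.I • f) := by
      intro f
      rw [FourierTransform.fourierInv_smul, FourierTransform.fourierInv_smul]
      ext x
      simp only [smul_apply, Complex.real_smul, smul_eq_mul]
      push_cast
      field_simp
    exact h3 _
  rw [fourierTest, SchwartzMap.lineDerivOp_compCLMOfContinuousLinearEquiv, h1, h2]
  rfl

theorem laplacian_fourierTest (φ : 𝓢(E3, ℂ)) : Δ (fourierTest φ) = -fourierTest (normSqMul φ) := by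
  have hsum : normSqMul φ = ∑ i, SchwartzMap.smulLeftCLM ℂ
      (fun x : E3 => inner ℝ x (EuclideanSpace.basisFun (Fin 3) ℝ i))
      (SchwartzMap.smulLeftCLM ℂ
        (fun x : E3 => inner ℝ x (EuclideanSpace.basisFun (Fin 3) ℝ i)) φ) := by
    ext x
    rw [normSqMul_apply, sum_apply, ← (EuclideanSpace.basisFun (Fin 3) ℝ).sum_sq_inner_left]
    push_cast
    rw [Finset.sum_mul]
    refine Finset.sum_congr rfl fun i _ => ?_
    rw [SchwartzMap.smulLeftCLM_apply_apply (by fun_prop),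
      SchwartzMap.smulLeftCLM_apply_apply (by fun_prop), Complex.real_smul, Complex.real_smul]
    ring
  rw [SchwartzMap.laplacian_eq_sum (EuclideanSpace.basisFun (Fin 3) ℝ), hsum,
    ← fourierTestCLM_apply (Finset.sum _ _), map_sum, ← Finset.sum_neg_distrib]
  refine Finset.sum_congr rfl fun i _ => ?_
  have hI : ∀ (f : E3 → ℝ) (ψ : 𝓢(E3, ℂ)), f.HasTemperateGrowth →
      SchwartzMap.smulLeftCLM ℂ f (Complex.I • ψ) = Complex.I • SchwartzMap.smulLeftCLM ℂ f ψ := by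
    intro f ψ hf
    ext x
    simp only [SchwartzMap.smulLeftCLM_apply_apply hf, smul_apply, smul_eq_mul, Complex.real_smul]
    ring
  rw [lineDeriv_fourierTest, lineDeriv_fourierTest, hI _ _ (by fun_prop), smul_smul,
    Complex.I_mul_I, ← fourierTestCLM_apply, map_smul, neg_one_smul]

/-! ### Approximation by compactly supported functions -/

theorem exists_norm_iteratedFDeriv_one_sub_bump_le (χ : ContDiffBump (0 : E3)) (i : ℕ) :
    ∃ C : ℝ, 0 ≤ C ∧ ∀ x, ‖iteratedFDeriv ℝ i (fun y => 1 - χ y) x‖ ≤ C := by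
  have hχ : ContDiff ℝ ∞ χ := χ.contDiff
  have hc : Continuous (iteratedFDeriv ℝ i χ) := hχ.continuous_iteratedFDeriv (by exact_mod_cast le_top)
  obtain ⟨C, hC⟩ := (χ.hasCompactSupport.iteratedFDeriv i).exists_bound_of_continuous hc
  have hC0 : 0 ≤ C := (norm_nonneg _).trans (hC 0)
  refine ⟨1 + C, by positivity, fun x => ?_⟩
  have h1 : iteratedFDeriv ℝ i (fun y => 1 - χ y) x
      = iteratedFDeriv ℝ i (fun _ : E3 => (1 : ℝ)) x - iteratedFDeriv ℝ i χ x := by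
    exact iteratedFDeriv_sub_apply contDiffAt_const (hχ.contDiffAt.of_le (by exact_mod_cast le_top))
  rw [h1]
  refine (norm_sub_le _ _).trans (add_le_add ?_ (hC x))
  rcases i with _ | i
  · simp
  · rw [iteratedFDeriv_succ_const]; simp

/-- Cut-offs at scale `n + 1`. Beyond convergence in the Schwartz space, the pointwise domination by
`φ` prepares for dominated convergence. -/
theorem exists_compactSupport_approx (φ : 𝓢(E3, ℂ)) :
    ∃ u : ℕ → 𝓢(E3, ℂ), (∀ n, HasCompactSupport (u n)) ∧ (∀ n x, ‖u n x‖ ≤ ‖φ x‖) ∧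
      (∀ x, Tendsto (fun n => u n x) atTop (𝓝 (φ x))) ∧ Tendsto u atTop (𝓝 φ) := by
  set χ : ContDiffBump (0 : E3) := ⟨1, 2, one_pos, one_lt_two⟩ with hχdef
  have hχ : ContDiff ℝ ∞ χ := χ.contDiff
  have hpos : ∀ n : ℕ, (0 : ℝ) < n + 1 := fun n => by positivity
  set g : ℕ → E3 → ℝ := fun n x => 1 - χ (((n : ℝ) + 1)⁻¹ • x) with hg
  have hgs : ∀ n, ContDiff ℝ ∞ (g n) := fun n =>
    contDiff_const.sub (hχ.comp (contDiff_const_smul _))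
  have hcs : ∀ n : ℕ, HasCompactSupport fun x => χ (((n : ℝ) + 1)⁻¹ • x) • φ x := by
    intro n
    have h1 : HasCompactSupport fun x => χ (((n : ℝ) + 1)⁻¹ • x) :=
      χ.hasCompactSupport.comp_smul (inv_ne_zero (hpos n).ne')
    exact h1.smul_right
  have hsm : ∀ n : ℕ, ContDiff ℝ ∞ fun x => χ (((n : ℝ) + 1)⁻¹ • x) • φ x := fun n =>
    (hχ.comp (contDiff_const_smul _)).smul φ.smooth'
  have hone : ∀ (n : ℕ) (x : E3), ‖x‖ < n + 1 → χ (((n : ℝ) + 1)⁻¹ • x) = 1 := by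
    intro n x hx
    refine χ.one_of_mem_closedBall ?_
    rw [mem_closedBall_zero_iff, norm_smul, norm_inv, Real.norm_of_nonneg (hpos n).le,
      inv_mul_le_iff₀ (hpos n)]
    simpa [hχdef] using hx.le
  set u : ℕ → 𝓢(E3, ℂ) := fun n => (hcs n).toSchwartzMap (hsm n) with hu
  have hua : ∀ n x, u n x = χ (((n : ℝ) + 1)⁻¹ • x) • φ x := fun n x => rfl
  refine ⟨u, hcs, fun n x => ?_, fun x => ?_, ?_⟩
  · rw [hua, norm_smul, Real.norm_of_nonneg χ.nonneg]
    exact mul_le_of_le_one_left (norm_nonneg _) χ.le_one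
  · refine tendsto_const_nhds.congr' ?_
    filter_upwards [eventually_ge_atTop ⌈‖x‖⌉₊] with n hn
    rw [hua, hone n x, one_smul]
    have := Nat.ceil_le.1 hn
    linarith
  · rw [(schwartz_withSeminorms ℂ E3 ℂ).tendsto_nhds]
    rintro ⟨j, m⟩ ε hε
    choose C hC0 hC using exists_norm_iteratedFDeriv_one_sub_bump_le χ
    set K : ℝ := ∑ i ∈ Finset.range (m + 1), (m.choose i : ℝ) * C i *
      SchwartzMap.seminorm ℂ (j + 1) (m - i) φ with hK
    have hK0 : 0 ≤ K := Finset.sum_nonneg fun i _ =>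
      mul_nonneg (mul_nonneg (Nat.cast_nonneg _) (hC0 i)) (apply_nonneg _ _)
    have hsub : ∀ n, (⇑(u n - φ) : E3 → ℂ) = fun x => -(g n x • φ x) := by
      intro n
      ext x
      rw [sub_apply, hua, hg]
      simp only [sub_smul, one_smul]; ring
    have hbd : ∀ n : ℕ, SchwartzMap.seminorm ℂ j m (u n - φ) ≤ K / (n + 1) := by
      intro n
      refine SchwartzMap.seminorm_le_bound ℂ j m _ (by positivity) fun x => ?_
      rw [hsub]
      rcases lt_or_ge ‖x‖ ((n : ℝ) + 1) with hx | hx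
      · have h0 : (fun x => -(g n x • φ x)) =ᶠ[𝓝 x] fun _ => (0 : ℂ) := by
          have : Metric.ball (0 : E3) (n + 1) ∈ 𝓝 x :=
            Metric.isOpen_ball.mem_nhds (mem_ball_zero_iff.2 hx)
          filter_upwards [this] with y hy
          simp [hg, hone n y (mem_ball_zero_iff.1 hy)]
        rw [(h0.iteratedFDeriv ℝ m).eq_of_nhds]
        have : iteratedFDeriv ℝ m (fun _ : E3 => (0 : ℂ)) x = 0 := by
          rw [iteratedFDeriv_fun_zero]; rfl
        rw [this, norm_zero, mul_zero]
        positivity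
      · have h1 : ‖iteratedFDeriv ℝ m (fun x => -(g n x • φ x)) x‖
            = ‖iteratedFDeriv ℝ m (fun x => g n x • φ x) x‖ := by
          exact (congrArg norm (iteratedFDeriv_neg_apply (𝕜 := ℝ) (i := m) (f := fun x => g n x • φ x))).trans
            (norm_neg _)
        have h2 : ∀ i, ‖iteratedFDeriv ℝ i (g n) x‖ ≤ C i := by
          intro i
          have hs : ContDiff ℝ i fun y => 1 - χ y :=
            contDiff_const.sub (hχ.of_le (by exact_mod_cast le_top))
          rw [hg]
          simp only
          rw [iteratedFDeriv_comp_const_smul (f := fun y => 1 - χ y) _ hs, norm_smul, norm_pow,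
            norm_inv, Real.norm_of_nonneg (hpos n).le]
          refine (mul_le_of_le_one_left (norm_nonneg _) ?_).trans (hC i _)
          exact pow_le_one₀ (by positivity)
            (inv_le_one_of_one_le₀ (by linarith [Nat.cast_nonneg (α := ℝ) n]))
        have h3 := norm_iteratedFDeriv_smul_le (𝕜 := ℝ) (N := ∞) (hgs n) φ.smooth' x (n := m)
          (by exact_mod_cast le_top)
        -- The error lives where `‖x‖ ≥ n + 1`, so one additional power of `‖x‖` buys the factor `1
        -- / (n + 1)`.
        have h4 : ‖x‖ ^ j ≤ ‖x‖ ^ (j + 1) / (n + 1) := by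
          rw [le_div_iff₀ (hpos n), pow_succ]
          gcongr
        rw [h1]
        calc _ ≤ ‖x‖ ^ (j + 1) / (n + 1) * ∑ i ∈ Finset.range (m + 1), (m.choose i : ℝ) *
              ‖iteratedFDeriv ℝ i (g n) x‖ * ‖iteratedFDeriv ℝ (m - i) φ x‖ := by gcongr; exact h3
          _ = (∑ i ∈ Finset.range (m + 1), (m.choose i : ℝ) * ‖iteratedFDeriv ℝ i (g n) x‖ *
              (‖x‖ ^ (j + 1) * ‖iteratedFDeriv ℝ (m - i) φ x‖)) / (n + 1) := by
              rw [Finset.mul_sum, Finset.sum_div]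
              exact Finset.sum_congr rfl fun i _ => by ring
          _ ≤ K / (n + 1) := by
              refine div_le_div_of_nonneg_right (Finset.sum_le_sum fun i _ => ?_) (hpos n).le
              exact mul_le_mul (mul_le_mul_of_nonneg_left (h2 i) (Nat.cast_nonneg _))
                (SchwartzMap.le_seminorm ℂ (j + 1) (m - i) φ x) (by positivity)
                (mul_nonneg (Nat.cast_nonneg _) (hC0 i))
    have hlim : Tendsto (fun n : ℕ => K / ((n : ℝ) + 1)) atTop (𝓝 0) :=
      tendsto_const_div_atTop_nhds_zero_nat K |>.comp (tendsto_add_atTop_nat 1) |>.congr fun n => by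
        simp
    filter_upwards [hlim.eventually_lt_const hε] with n hn
    exact (hbd n).trans_lt hn

theorem integrable_mul_of_polynomial_bound {h : E3 → ℂ} (hc : Continuous h) {C : ℝ} {N : ℕ}
    (hb : ∀ κ, ‖h κ‖ ≤ C * (1 + ‖κ‖ ^ N)) (φ : 𝓢(E3, ℂ)) :
    Integrable fun κ => h κ * φ κ := by
  have h1 : Integrable fun κ => C * (‖κ‖ ^ 0 * ‖φ κ‖ + ‖κ‖ ^ N * ‖φ κ‖) :=
    ((φ.integrable_pow_mul volume 0).add (φ.integrable_pow_mul volume N)).const_mul C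
  refine h1.mono' (hc.mul φ.continuous).aestronglyMeasurable (Eventually.of_forall fun κ => ?_)
  rw [norm_mul]
  refine (mul_le_mul_of_nonneg_right (hb κ) (norm_nonneg _)).trans (le_of_eq ?_)
  ring

theorem pairing_of_compactSupport {T : 𝓢'(E3, ℂ)} {h : E3 → ℂ} (hc : Continuous h) {C : ℝ} {N : ℕ}
    (hb : ∀ κ, ‖h κ‖ ≤ C * (1 + ‖κ‖ ^ N))
    (hT : ∀ φ : 𝓢(E3, ℂ), HasCompactSupport φ → T (fourierTest φ) = ∫ κ, h κ * φ κ)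
    (φ : 𝓢(E3, ℂ)) : T (fourierTest φ) = ∫ κ, h κ * φ κ := by
  obtain ⟨u, hcs, hle, hpt, hlim⟩ := exists_compactSupport_approx φ
  have h1 : Tendsto (fun n => T (fourierTest (u n))) atTop (𝓝 (T (fourierTest φ))) :=
    ((T.continuous.comp fourierTestCLM.continuous).tendsto φ).comp hlim
  have h2 : Tendsto (fun n => ∫ κ, h κ * u n κ) atTop (𝓝 (∫ κ, h κ * φ κ)) := by
    refine tendsto_integral_of_dominated_convergence (fun κ => ‖h κ * φ κ‖)
      (fun n => (hc.mul (u n).continuous).aestronglyMeasurable)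
      (integrable_mul_of_polynomial_bound hc hb φ).norm
      (fun n => Eventually.of_forall fun κ => ?_)
      (Eventually.of_forall fun κ => (hpt κ).const_mul _)
    rw [norm_mul, norm_mul]
    exact mul_le_mul_of_nonneg_left (hle n κ) (norm_nonneg _)
  exact tendsto_nhds_unique h1 (h2.congr fun n => (hT (u n) (hcs n)).symm)

/-! ### Uniqueness for the hierarchy of Volterra equations -/

/-- In the norm weighted by `exp(l t)` the integral `J^δ` gains `l^(-δ)`, while stepping from `k` to
`k + 1` costs only `K`. For `l` large each use of the equations halves the bound at every level `k`
simultaneously, so the bound tends to zero. -/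
theorem eq_zero_of_volterra_hierarchy {β γ a b T B K : ℝ} (hβ : 0 < β) (hγ : 0 < γ) (ha : 0 ≤ a)
    (hb : 0 ≤ b) (hB : 0 ≤ B) (hK : 0 ≤ K) {v : ℕ → ℝ → ℂ}
    (hv : ∀ k, ∀ t ∈ Icc 0 T,
      v k t + (a : ℂ) * fracInt β (v k) t + (b : ℂ) * fracInt γ (v (k + 1)) t = 0)
    (hbd : ∀ k, ∀ t ∈ Icc 0 T, ‖v k t‖ ≤ B * K ^ k) (k : ℕ) {t : ℝ} (ht : t ∈ Icc 0 T) :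
    v k t = 0 := by
  obtain ⟨l, hl, hl0⟩ : ∃ l : ℝ, a * l ^ (-β) + b * K * l ^ (-γ) < 1 / 2 ∧ 0 < l := by
    have h1 : Tendsto (fun l : ℝ => a * l ^ (-β) + b * K * l ^ (-γ)) atTop (𝓝 0) := by
      simpa using ((tendsto_rpow_neg_atTop hβ).const_mul a).add
        ((tendsto_rpow_neg_atTop hγ).const_mul (b * K))
    exact ((h1.eventually_lt_const (by norm_num)).and (eventually_gt_atTop 0)).exists
  have key : ∀ m : ℕ, ∀ k, ∀ t ∈ Icc 0 T, ‖v k t‖ ≤ B * (1 / 2) ^ m * K ^ k * Real.exp (l * t) := by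
    intro m
    induction m with
    | zero =>
      intro k t ht
      rw [pow_zero, mul_one]
      exact (hbd k t ht).trans (le_mul_of_one_le_right (by positivity)
        (Real.one_le_exp (mul_nonneg hl0.le ht.1)))
    | succ m ih =>
      intro k t ht
      have e : v k t = -((a : ℂ) * fracInt β (v k) t + (b : ℂ) * fracInt γ (v (k + 1)) t) := by
        linear_combination hv k t ht
      have hsub : ∀ τ ∈ Ioc 0 t, τ ∈ Icc 0 T := fun τ hτ => ⟨hτ.1.le, hτ.2.trans ht.2⟩
      have h1 := norm_fracInt_le hβ hl0 (B := B * (1 / 2) ^ m * K ^ k) (by positivity) ht.1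
        fun τ hτ => ih k τ (hsub τ hτ)
      have h2 := norm_fracInt_le hγ hl0 (B := B * (1 / 2) ^ m * K ^ (k + 1)) (by positivity) ht.1
        fun τ hτ => ih (k + 1) τ (hsub τ hτ)
      rw [e, norm_neg]
      refine (norm_add_le _ _).trans ?_
      rw [norm_mul, norm_mul, Complex.norm_of_nonneg ha, Complex.norm_of_nonneg hb]
      calc _ ≤ a * (l ^ (-β) * (B * (1 / 2) ^ m * K ^ k * Real.exp (l * t)))
            + b * (l ^ (-γ) * (B * (1 / 2) ^ m * K ^ (k + 1) * Real.exp (l * t))) := by gcongr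
        _ = (a * l ^ (-β) + b * K * l ^ (-γ)) * (B * (1 / 2) ^ m * K ^ k * Real.exp (l * t)) := by
            ring
        _ ≤ 1 / 2 * (B * (1 / 2) ^ m * K ^ k * Real.exp (l * t)) := by gcongr
        _ = _ := by ring
  have hlim : Tendsto (fun m : ℕ => B * (1 / 2) ^ m * K ^ k * Real.exp (l * t)) atTop (𝓝 0) := by
    have h := tendsto_pow_atTop_nhds_zero_of_lt_one (r := (1 / 2 : ℝ)) (by norm_num) (by norm_num)
    simpa using ((h.const_mul B).mul_const (K ^ k)).mul_const (Real.exp (l * t))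
  exact norm_le_zero_iff.1 (ge_of_tendsto' hlim fun m => key m k t ht)

/-! ### The candidate for the Fourier transform -/

/-- The Fourier transform of the fundamental solution. -/
def fourierSol (c D α β : ℝ) (κ : E3) (t : ℝ) : ℂ :=
  hankelSol β (α + β) (c ^ 2 * D⁻¹ * t ^ β) (‖κ‖ ^ 2 * c ^ 2 * t ^ (α + β))

variable {c D α β : ℝ}

theorem continuousOn_fourierSol (hD : 0 < D) (hα : 0 < α) (hβ : 0 < β) :
    ContinuousOn (Function.uncurry (fourierSol c D α β)) (univ ×ˢ Ici 0) := by
  refine (continuousOn_hankelSol hβ (by linarith : β ≤ α + β)).comp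
    (f := fun p : E3 × ℝ => (c ^ 2 * D⁻¹ * p.2 ^ β, ‖p.1‖ ^ 2 * c ^ 2 * p.2 ^ (α + β))) ?_ ?_
  · exact ((continuous_const.mul ((Real.continuous_rpow_const hβ.le).comp continuous_snd)).prodMk
      (((continuous_fst.norm.pow 2).mul continuous_const).mul
        ((Real.continuous_rpow_const (by linarith)).comp continuous_snd))).continuousOn
  · rintro ⟨κ, t⟩ ⟨-, ht⟩
    have : 0 ≤ t := ht
    exact ⟨mem_Ici.2 (by positivity), mem_Ici.2 (by positivity)⟩

theorem continuous_fourierSol (hD : 0 < D) (hα : 0 < α) (hβ : 0 < β) {t : ℝ} (ht : 0 ≤ t) :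
    Continuous fun κ => fourierSol c D α β κ t :=
  (continuousOn_fourierSol hD hα hβ).comp_continuous (f := fun κ : E3 => (κ, t)) (by fun_prop)
    fun _ => ⟨mem_univ _, ht⟩

theorem fourierSol_volterra (hD : 0 < D) (hα : 0 < α) (hβ : 0 < β) (κ : E3) {t : ℝ} (ht : 0 ≤ t) :
    fourierSol c D α β κ t + ((c ^ 2 * D⁻¹ : ℝ) : ℂ) * fracInt β (fourierSol c D α β κ) t
      + ((‖κ‖ ^ 2 * c ^ 2 : ℝ) : ℂ) * fracInt (α + β) (fourierSol c D α β κ) t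
      = 1 + ((c ^ 2 * D⁻¹ : ℝ) : ℂ) * ((t ^ β / Real.Gamma (β + 1) : ℝ) : ℂ) :=
  hankelSol_volterra hβ (by linarith) (by positivity) (by positivity) ht

theorem exists_fourierSol_polynomial_bound (hc : 0 < c) (hD : 0 < D) (hα : 0 < α) (hα1 : α ≤ 1)
    (hαβ : 1 < α + β) (hαβ2 : α + β ≤ 2) {t : ℝ} (ht : 0 ≤ t) :
    ∃ (C : ℝ) (N : ℕ), ∀ κ, ‖fourierSol c D α β κ t‖ ≤ C * (1 + ‖κ‖ ^ N) := by
  have hβ : 0 < β := by linarith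
  -- At `t = 0` both reduced variables vanish and the candidate is constant in `κ`; the growth
  -- estimate itself needs `x > 0`.
  rcases ht.eq_or_lt with rfl | ht
  · refine ⟨‖hankelSol β (α + β) 0 0‖, 0, fun κ => ?_⟩
    rw [fourierSol, Real.zero_rpow hβ.ne', Real.zero_rpow (by linarith), mul_zero, mul_zero]
    have := norm_nonneg (hankelSol β (α + β) 0 0)
    rw [pow_zero]; linarith
  · set x := c ^ 2 * D⁻¹ * t ^ β with hx
    have hx0 : 0 < x := by positivity
    obtain ⟨C, hC⟩ := norm_hankelSol_le hα hα1 hαβ hαβ2 hx0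
    -- The radius grows like `‖κ‖^(2/β)`. Rounding `1 / β` up to an integer gives an honest
    -- polynomial, as the base used below is at least `1`.
    set n := ⌈1 / β⌉₊ with hn
    set A := 1 + 2 * (x + c ^ 2 * t ^ (α + β)) with hA
    have hA1 : 1 ≤ A := by
      have : 0 ≤ c ^ 2 * t ^ (α + β) := by positivity
      linarith
    have hC0 : 0 ≤ C := by
      have h := (norm_nonneg _).trans (hC 0 le_rfl)
      have h1 := one_le_largeRadius β (M := x + 0) (by linarith)
      exact nonneg_of_mul_nonneg_left h (by positivity)
    refine ⟨C * (2 * (A * 2) ^ n) ^ 3 , 2 * (n * 3), fun κ => ?_⟩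
    set s := ‖κ‖ ^ 2 with hs
    have hs0 : 0 ≤ s := by positivity
    have hy0 : 0 ≤ s * c ^ 2 * t ^ (α + β) := by positivity
    refine (hC _ hy0).trans ?_
    have h1 : largeRadius β (x + s * c ^ 2 * t ^ (α + β)) ≤ 2 * (A * (1 + s)) ^ n := by
      have e : 2 * (x + s * c ^ 2 * t ^ (α + β)) ≤ A * (1 + s) := by
        have h2 : 0 ≤ c ^ 2 * t ^ (α + β) := by positivity
        rw [hA]; nlinarith [mul_nonneg hx0.le hs0]
      have e1 : 1 ≤ A * (1 + s) := one_le_mul_of_one_le_of_one_le hA1 (by linarith)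
      have e2 : (2 * (x + s * c ^ 2 * t ^ (α + β))) ^ (1 / β) ≤ (A * (1 + s)) ^ n := by
        calc _ ≤ (A * (1 + s)) ^ (1 / β) := Real.rpow_le_rpow (by positivity) e (by positivity)
          _ ≤ (A * (1 + s)) ^ (n : ℝ) := Real.rpow_le_rpow_of_exponent_le e1 (Nat.le_ceil _)
          _ = _ := Real.rpow_natCast _ _
      have e3 : 1 ≤ (A * (1 + s)) ^ n := one_le_pow₀ e1
      unfold largeRadius; linarith
    have h0 : 0 ≤ largeRadius β (x + s * c ^ 2 * t ^ (α + β)) :=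
      zero_le_one.trans (one_le_largeRadius β (by linarith))
    have h3 : (1 + s) ^ (n * 3) ≤ 2 ^ (n * 3) * (1 + s ^ (n * 3)) := by
      rcases le_total s 1 with h | h
      · calc (1 + s) ^ (n * 3) ≤ 2 ^ (n * 3) := by gcongr; linarith
          _ ≤ _ := le_mul_of_one_le_right (by positivity)
            (by linarith [pow_nonneg hs0 (n * 3)])
      · calc (1 + s) ^ (n * 3) ≤ (2 * s) ^ (n * 3) := by gcongr; linarith
          _ = 2 ^ (n * 3) * s ^ (n * 3) := mul_pow ..
          _ ≤ _ := by gcongr; linarith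
    calc C * largeRadius β (x + s * c ^ 2 * t ^ (α + β)) ^ 3
        ≤ C * (2 * (A * (1 + s)) ^ n) ^ 3 := by gcongr
      _ = C * (2 * A ^ n) ^ 3 * (1 + s) ^ (n * 3) := by rw [pow_mul, mul_pow A]; ring
      _ ≤ C * (2 * A ^ n) ^ 3 * (2 ^ (n * 3) * (1 + s ^ (n * 3))) := by gcongr
      _ = C * (2 * (A * 2) ^ n) ^ 3 * (1 + ‖κ‖ ^ (2 * (n * 3))) := by
          rw [pow_mul ‖κ‖, pow_mul 2, mul_pow A]; ring

/-- Continuity on a compact set. The constant depends only on the ball and on `T`, so it serves all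
the functions `‖κ‖^(2k) φ` at once. -/
theorem exists_norm_fourierSol_le (hD : 0 < D) (hα : 0 < α) (hβ : 0 < β) (M T : ℝ) :
    ∃ C : ℝ, 0 ≤ C ∧ ∀ (ψ : 𝓢(E3, ℂ)), tsupport ψ ⊆ Metric.closedBall 0 M → ∀ κ, ∀ t ∈ Icc 0 T,
      ‖fourierSol c D α β κ t * ψ κ‖ ≤ C * ‖ψ κ‖ := by
  have hK : IsCompact (Metric.closedBall (0 : E3) M ×ˢ Icc 0 T) :=
    (isCompact_closedBall _ _).prod isCompact_Icc
  obtain ⟨C, hC⟩ := hK.exists_bound_of_continuousOn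
    ((continuousOn_fourierSol (c := c) hD hα hβ).mono
      (prod_mono (subset_univ _) fun t ht => ht.1))
  refine ⟨max C 0, le_max_right _ _, fun ψ hψ κ t ht => ?_⟩
  rw [norm_mul]
  by_cases hκ : κ ∈ tsupport ψ
  · exact mul_le_mul_of_nonneg_right ((hC (κ, t) ⟨hψ hκ, ht⟩).trans (le_max_left _ _))
      (norm_nonneg _)
  · rw [image_eq_zero_of_notMem_tsupport hκ]; simp

theorem continuousOn_integral_fourierSol (hD : 0 < D) (hα : 0 < α) (hβ : 0 < β) {ψ : 𝓢(E3, ℂ)}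
    {M : ℝ} (hψ : tsupport ψ ⊆ Metric.closedBall 0 M) (T : ℝ) :
    ContinuousOn (fun t => ∫ κ, fourierSol c D α β κ t * ψ κ) (Icc 0 T) := by
  obtain ⟨C, -, hC⟩ := exists_norm_fourierSol_le (c := c) hD hα hβ M T
  refine continuousOn_of_dominated (bound := fun κ => C * ‖ψ κ‖) (fun t ht => ?_)
    (fun t ht => Eventually.of_forall fun κ => hC ψ hψ κ t ht) (ψ.integrable.norm.const_mul C)
    (Eventually.of_forall fun κ => ?_)
  · exact ((continuous_fourierSol hD hα hβ ht.1).mul ψ.continuous).aestronglyMeasurable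
  · refine ContinuousOn.mul ?_ continuousOn_const
    exact (continuousOn_fourierSol hD hα hβ).comp (f := fun t : ℝ => (κ, t))
      (by fun_prop) fun t ht => ⟨mem_univ _, ht.1⟩

theorem fracInt_integral_fourierSol (hD : 0 < D) (hα : 0 < α) (hβ : 0 < β) {ψ : 𝓢(E3, ℂ)} {M : ℝ}
    (hψ : tsupport ψ ⊆ Metric.closedBall 0 M) {γ t : ℝ} (hγ : 0 < γ) (ht : 0 ≤ t) :
    Integrable (fun κ => fracInt γ (fourierSol c D α β κ) t * ψ κ) ∧
      fracInt γ (fun τ => ∫ κ, fourierSol c D α β κ τ * ψ κ) t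
        = ∫ κ, fracInt γ (fourierSol c D α β κ) t * ψ κ := by
  obtain ⟨C, -, hC⟩ := exists_norm_fourierSol_le (c := c) hD hα hβ M t
  have hmeas : AEStronglyMeasurable
      (Function.uncurry fun (κ : E3) τ => fourierSol c D α β κ τ * ψ κ)
      (volume.prod (volume.restrict (Ioc 0 t))) := by
    have h1 : ContinuousOn (Function.uncurry fun (κ : E3) τ => fourierSol c D α β κ τ * ψ κ)
        (univ ×ˢ Ioc 0 t) :=
      ((continuousOn_fourierSol hD hα hβ).mono (prod_mono le_rfl fun τ hτ => hτ.1.le)).mul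
        (ψ.continuous.comp continuous_fst).continuousOn
    have h2 := h1.aestronglyMeasurable (μ := volume.prod volume)
      (MeasurableSet.univ.prod measurableSet_Ioc)
    rwa [← Measure.prod_restrict, Measure.restrict_univ] at h2
  have h := integrable_fracInt_and_fracInt_integral hγ ht (ψ.integrable.norm.const_mul C) hmeas
    fun κ τ hτ => hC ψ hψ κ τ ⟨hτ.1.le, hτ.2⟩
  have e : ∀ κ, fracInt γ (fun τ => fourierSol c D α β κ τ * ψ κ) t
      = fracInt γ (fourierSol c D α β κ) t * ψ κ := by
    intro κ
    simp only [mul_comm _ (ψ κ)]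
    exact fracInt_const_mul ..
  simpa only [e] using h

/-- The pointwise Volterra equation is integrated against `ψ`, and the coefficient `‖κ‖²` is
transferred to the test function. The result has the same shape as the equation available for `Q`.
-/
theorem integral_fourierSol_volterra (hD : 0 < D) (hα : 0 < α) (hβ : 0 < β) {ψ : 𝓢(E3, ℂ)} {M : ℝ}
    (hψ : tsupport ψ ⊆ Metric.closedBall 0 M) {t : ℝ} (ht : 0 ≤ t) :
    (∫ κ, fourierSol c D α β κ t * ψ κ)
      + ((c ^ 2 * D⁻¹ : ℝ) : ℂ) * fracInt β (fun τ => ∫ κ, fourierSol c D α β κ τ * ψ κ) t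
      + ((c ^ 2 : ℝ) : ℂ) *
        fracInt (α + β) (fun τ => ∫ κ, fourierSol c D α β κ τ * normSqMul ψ κ) t
      = (1 + ((c ^ 2 * D⁻¹ : ℝ) : ℂ) * ((t ^ β / Real.Gamma (β + 1) : ℝ) : ℂ)) * ∫ κ, ψ κ := by
  obtain ⟨C, -, hC⟩ := exists_norm_fourierSol_le (c := c) hD hα hβ M t
  obtain ⟨i1, e1⟩ := fracInt_integral_fourierSol (c := c) hD hα hβ hψ hβ ht
  obtain ⟨i2, e2⟩ := fracInt_integral_fourierSol (c := c) hD hα hβ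
    ((tsupport_normSqMul_subset ψ).trans hψ) (add_pos hα hβ) ht
  have i0 : Integrable fun κ => fourierSol c D α β κ t * ψ κ :=
    (ψ.integrable.norm.const_mul C).mono'
      ((continuous_fourierSol hD hα hβ ht).mul ψ.continuous).aestronglyMeasurable
      (Eventually.of_forall fun κ => hC ψ hψ κ t ⟨ht, le_rfl⟩)
  have i3 : Integrable fun κ => fourierSol c D α β κ t * ψ κ
      + ((c ^ 2 * D⁻¹ : ℝ) : ℂ) * (fracInt β (fourierSol c D α β κ) t * ψ κ) :=
    i0.add (i1.const_mul _)
  rw [e1, e2, ← integral_const_mul, ← integral_const_mul, ← integral_const_mul,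
    ← integral_add i0 (i1.const_mul _), ← integral_add i3 (i2.const_mul _)]
  refine integral_congr_ae (Eventually.of_forall fun κ => ?_)
  have h := fourierSol_volterra (c := c) hD hα hβ κ ht
  simp only [normSqMul_apply]
  rw [← h]
  push_cast
  ring

/-! ### Identification of the Fourier transform -/

variable {Q : ℝ → 𝓢'(E3, ℂ)}

theorem IsFundamentalSolution.continuousOn (hQ : IsFundamentalSolution c D α β Q) (φ : 𝓢(E3, ℂ)) :
    ContinuousOn (fun t => Q t φ) (Ici 0) := by
  intro t ht
  rcases (show (0 : ℝ) ≤ t from ht).eq_or_lt with rfl | ht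
  · exact (hQ.initial_velocity φ).continuousWithinAt
  · exact ((hQ.contDiffOn φ).continuousOn.continuousAt (Ioi_mem_nhds ht)).continuousWithinAt

theorem IsFundamentalSolution.initial_fourierTest (hQ : IsFundamentalSolution c D α β Q)
    (φ : 𝓢(E3, ℂ)) : Q 0 (fourierTest φ) = ∫ κ, φ κ := by
  rw [hQ.initial_value, TemperedDistribution.delta_apply, fourierTest_apply]
  simp

theorem IsFundamentalSolution.equation_fourierTest (hQ : IsFundamentalSolution c D α β Q)
    (φ : 𝓢(E3, ℂ)) {t : ℝ} (ht : 0 < t) :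
    (1 / (c : ℂ) ^ 2) * caputoDeriv (α + β) (fun s => Q s (fourierTest φ)) t
      + (1 / (D : ℂ)) * caputoDeriv α (fun s => Q s (fourierTest φ)) t
      = -Q t (fourierTest (normSqMul φ)) := by
  rw [hQ.equation (fourierTest φ) t ht, TemperedDistribution.laplacian_apply_apply,
    laplacian_fourierTest, map_neg]

theorem IsFundamentalSolution.volterra_fourierTest (hQ : IsFundamentalSolution c D α β Q)
    (hc : 0 < c) (hα : 0 < α) (hα1 : α ≤ 1) (hαβ : 1 < α + β) (hαβ2 : α + β ≤ 2)
    (φ : 𝓢(E3, ℂ)) {t : ℝ} (ht : 0 ≤ t) :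
    Q t (fourierTest φ) + ((c ^ 2 * D⁻¹ : ℝ) : ℂ) * fracInt β (fun s => Q s (fourierTest φ)) t
      + ((c ^ 2 : ℝ) : ℂ) * fracInt (α + β) (fun s => Q s (fourierTest (normSqMul φ))) t
      = (1 + ((c ^ 2 * D⁻¹ : ℝ) : ℂ) * ((t ^ β / Real.Gamma (β + 1) : ℝ) : ℂ)) * ∫ κ, φ κ := by
  have hβ : 0 < β := by linarith
  have h := volterra_of_caputo hc hα hα1 hαβ hαβ2 (hQ.contDiffOn (fourierTest φ))
    (hQ.integrableOn _) (hQ.initial_velocity _) (fun s hs => hQ.equation_fourierTest φ hs) ht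
  have hsub : uIcc 0 t ⊆ Ici 0 := by
    rw [uIcc_of_le ht]; exact fun s hs => hs.1
  rw [fracInt_sub hβ ((hQ.continuousOn _).mono hsub) continuousOn_const] at h
  have h1 : fracInt β (fun _ => Q 0 (fourierTest φ)) t
      = ((t ^ β / Real.Gamma (β + 1) : ℝ) : ℂ) * Q 0 (fourierTest φ) := by
    have h2 := fracInt_rpow (p := 0) hβ le_rfl ht
    simp only [Real.rpow_zero, zero_add, Real.Gamma_one, div_one, Complex.ofReal_one] at h2
    have h3 := fracInt_const_mul β t (Q 0 (fourierTest φ)) fun _ => 1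
    simp only [mul_one] at h3
    rw [h3, h2, mul_comm]
  rw [h1, hQ.initial_fourierTest] at h
  linear_combination h

/-- `Q` and the candidate satisfy the same hierarchy with the same right-hand sides, so their
differences satisfy the homogeneous one. Level `k = 0` is the claim. -/
theorem IsFundamentalSolution.pairing_of_tsupport_subset (hQ : IsFundamentalSolution c D α β Q)
    (hc : 0 < c) (hD : 0 < D) (hα : 0 < α) (hα1 : α ≤ 1) (hαβ : 1 < α + β) (hαβ2 : α + β ≤ 2)
    {φ : 𝓢(E3, ℂ)} {M : ℝ} (hM : 0 ≤ M) (hφ : tsupport φ ⊆ Metric.closedBall 0 M) {T : ℝ}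
    (hT : 0 ≤ T) : Q T (fourierTest φ) = ∫ κ, fourierSol c D α β κ T * φ κ := by
  have hβ : 0 < β := by linarith
  set K : ℝ := (M + 1) ^ 2 with hK
  have hK0 : 0 < K := by positivity
  set φs : ℕ → 𝓢(E3, ℂ) := fun k => normSqMul^[k] φ with hφs
  have hsupp : ∀ k, tsupport (φs k) ⊆ Metric.closedBall 0 M := fun k =>
    (tsupport_iterate_normSqMul_subset k φ).trans hφ
  have hsucc : ∀ k, normSqMul (φs k) = φs (k + 1) := fun k =>
    (Function.iterate_succ_apply' normSqMul k φ).symm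
  set v : ℕ → ℝ → ℂ := fun k t =>
    Q t (fourierTest (φs k)) - ∫ κ, fourierSol c D α β κ t * φs k κ with hv
  have hvolt : ∀ k, ∀ t ∈ Icc 0 T, v k t + ((c ^ 2 * D⁻¹ : ℝ) : ℂ) * fracInt β (v k) t
      + ((c ^ 2 : ℝ) : ℂ) * fracInt (α + β) (v (k + 1)) t = 0 := by
    intro k t ht
    have h1 := hQ.volterra_fourierTest hc hα hα1 hαβ hαβ2 (φs k) ht.1
    have h2 := integral_fourierSol_volterra (c := c) hD hα hβ (hsupp k) ht.1
    rw [hsucc] at h1 h2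
    have hsub : uIcc 0 t ⊆ Ici 0 := by
      rw [uIcc_of_le ht.1]; exact fun s hs => hs.1
    have hcW : ∀ k, ContinuousOn (fun t => ∫ κ, fourierSol c D α β κ t * φs k κ) (uIcc 0 t) := by
      intro k
      rw [uIcc_of_le ht.1]
      exact continuousOn_integral_fourierSol hD hα hβ (hsupp k) t
    rw [hv]
    simp only
    rw [fracInt_sub hβ ((hQ.continuousOn _).mono hsub) (hcW k),
      fracInt_sub (add_pos hα hβ) ((hQ.continuousOn _).mono hsub) (hcW (k + 1))]
    linear_combination h1 - h2
  obtain ⟨B₁, hB₁⟩ : ∃ B₁ : ℝ, ∀ k, ∀ t ∈ Icc 0 T, ‖Q t (fourierTest (φs k))‖ ≤ B₁ * K ^ k := by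
    -- For a fixed test function boundedness on `[0, T]` is continuity in time. Uniformity in `k`
    -- follows from Banach–Steinhaus applied to the bounded sequence `K^(-k) ‖κ‖^(2k) φ`.
    have hpt : ∀ ψ : 𝓢(E3, ℂ), ∃ C : ℝ, ∀ t : Icc (0 : ℝ) T,
        ‖PointwiseConvergenceCLM.precomp ℂ fourierTestCLM (Q t) ψ‖ ≤ C := by
      intro ψ
      obtain ⟨C, hC⟩ := (isCompact_Icc (a := (0 : ℝ)) (b := T)).exists_bound_of_continuousOn
        ((hQ.continuousOn (fourierTest ψ)).mono fun t ht => ht.1)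
      exact ⟨C, fun t => hC t t.2⟩
    obtain ⟨C, hC⟩ := uniform_bound_of_pointwise
      (fun t : Icc (0 : ℝ) T => PointwiseConvergenceCLM.precomp ℂ fourierTestCLM (Q t)) hpt
      (ψ := fun k => (((K ^ k)⁻¹ : ℝ) : ℂ) • φs k) fun j n => by
        obtain ⟨C, hC⟩ := seminorm_iterate_normSqMul_le hM hφ j n
        refine ⟨C, fun k => ?_⟩
        rw [map_smul_eq_mul, Complex.norm_of_nonneg (by positivity), inv_mul_le_iff₀ (by positivity),
          mul_comm]
        exact hC k
    refine ⟨C, fun k t ht => ?_⟩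
    have h1 := hC ⟨t, ht⟩ k
    rw [map_smul, norm_smul, Complex.norm_of_nonneg (by positivity),
      inv_mul_le_iff₀ (by positivity), mul_comm] at h1
    exact h1
  obtain ⟨C, hC0, hC⟩ := exists_norm_fourierSol_le (c := c) hD hα hβ M T
  have hB₂ : ∀ k, ∀ t ∈ Icc 0 T, ‖∫ κ, fourierSol c D α β κ t * φs k κ‖
      ≤ (C * ∫ κ, ‖φ κ‖) * K ^ k := by
    intro k t ht
    have h1 : ∀ κ, ‖fourierSol c D α β κ t * φs k κ‖ ≤ C * K ^ k * ‖φ κ‖ := by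
      intro κ
      refine (hC (φs k) (hsupp k) κ t ht).trans ?_
      rw [mul_assoc]
      refine mul_le_mul_of_nonneg_left ?_ hC0
      by_cases hκ : κ ∈ tsupport φ
      · have h2 : ‖κ‖ ≤ M := by simpa using hφ hκ
        rw [hφs]
        simp only
        rw [iterate_normSqMul_apply, norm_mul, Complex.norm_of_nonneg (by positivity)]
        have h3 : ‖κ‖ ^ 2 ≤ K := by
          rw [hK]
          gcongr
          linarith
        gcongr
      · have h2 : κ ∉ tsupport (φs k) := fun h => hκ (tsupport_iterate_normSqMul_subset k φ h)
        rw [image_eq_zero_of_notMem_tsupport h2, norm_zero]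
        positivity
    refine (norm_integral_le_of_norm_le (φ.integrable.norm.const_mul (C * K ^ k))
      (Eventually.of_forall h1)).trans (le_of_eq ?_)
    rw [integral_const_mul]
    ring
  have hzero := eq_zero_of_volterra_hierarchy (a := c ^ 2 * D⁻¹) (b := c ^ 2) (T := T)
    (B := max B₁ 0 + C * ∫ κ, ‖φ κ‖) (K := K) hβ (add_pos hα hβ) (by positivity) (by positivity)
    (by positivity) hK0.le hvolt (fun k t ht => by
      refine (norm_sub_le _ _).trans ?_
      rw [add_mul]
      refine add_le_add ((hB₁ k t ht).trans ?_) (hB₂ k t ht)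
      exact mul_le_mul_of_nonneg_right (le_max_left _ _) (by positivity)) 0 ⟨hT, le_rfl⟩
  exact sub_eq_zero.1 hzero

theorem IsFundamentalSolution.isFourierTransform (hQ : IsFundamentalSolution c D α β Q)
    (hc : 0 < c) (hD : 0 < D) (hα : 0 < α) (hα1 : α ≤ 1) (hαβ : 1 < α + β) (hαβ2 : α + β ≤ 2)
    {t : ℝ} (ht : 0 ≤ t) : IsFourierTransform (Q t) (fun κ => fourierSol c D α β κ t) := by
  have hβ : 0 < β := by linarith
  have hcont := continuous_fourierSol (c := c) hD hα hβ ht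
  obtain ⟨C, N, hb⟩ := exists_fourierSol_polynomial_bound hc hD hα hα1 hαβ hαβ2 ht
  refine ⟨hcont, integrable_mul_of_polynomial_bound hcont hb,
    pairing_of_compactSupport hcont hb fun φ hφ => ?_⟩
  obtain ⟨M, hM, hsub⟩ := (IsCompact.isBounded hφ).subset_closedBall_lt 0 0
  exact hQ.pairing_of_tsupport_subset hc hD hα hα1 hαβ hαβ2 hM.le hsub ht

end FractionalTelegraph

end

theorem theorem2 (c D α β : ℝ) (hc : 0 < c) (hD : 0 < D) (hα : 0 < α) (hα1 : α ≤ 1)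
    (hαβ : 1 < α + β) (hαβ2 : α + β ≤ 2)
    (Q : ℝ → TemperedDistribution FractionalTelegraph.E3 ℂ)
    (hQ : FractionalTelegraph.IsFundamentalSolution c D α β Q) :
    ∃ H : FractionalTelegraph.E3 → ℝ → ℂ,
      (∀ t : ℝ, 0 ≤ t → FractionalTelegraph.IsFourierTransform (Q t) (fun κ => H κ t)) ∧
      ∀ (κ : FractionalTelegraph.E3) (t : ℝ), 0 ≤ t → ∀ θ : ℝ, Real.pi / 2 < θ → θ ≤ Real.pi →
        (∃ r : ℝ, 0 < r ∧ FractionalTelegraph.Encloses c D α β κ t r θ) ∧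
        ∀ r : ℝ, 0 < r → FractionalTelegraph.Encloses c D α β κ t r θ →
          FractionalTelegraph.HankelIntegrable r θ
            (FractionalTelegraph.integrand c D α β κ t) ∧
          H κ t = 1 / (2 * (Real.pi : ℂ) * Complex.I) *
            FractionalTelegraph.hankelIntegral r θ
              (FractionalTelegraph.integrand c D α β κ t) := by
  have hβ : 0 < β := by linarith
  exact ⟨FractionalTelegraph.fourierSol c D α β,
    fun t ht => hQ.isFourierTransform hc hD hα hα1 hαβ hαβ2 ht,
    fun κ t ht θ hθ hθ' => FractionalTelegraph.hankelSol_eq_contour hD hα hβ κ ht hθ hθ'⟩
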